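/- **Model.** A CONGEST network is a finite simple graph $G$ (not necessarily connected) with $n$ nodes, where each node has a distinct identifier of $O(\log n)$ bits and an arbitrary local numbering of its incident edges (ports). Computation is deterministic and proceeds in synchronous rounds; in each round every node sends one message of $O(\log n)$ bits to each neighbor. Initially a node knows only its identifier, its degree, the global parameters ($n$, $k$, and in part 1 also $c$, $d$) and its local input. Distances are hop distances in $G$. A family of rooted trees of $G$ is stored distributedly: every node knows the labels of the trees that contain it and, for each of them, whether it is the root or else the port leading to its parent. **Weak-diameter decomposition.** A $(c,d)$ weak-diameter decomposition of $G^{2k}$ is a partition of $V$ into clusters, each with one of $c$ colors and with a distinct $O(\log n)$-bit label, such that any two nodes in different clusters of the same color are at distance more than $2k$ in $G$; and each cluster $C$ comes with a tree $T_C\subseteq G$ of diameter at most $d$ which is rooted at a node of $C$, contains all of $C$ (and possibly nodes outside $C$), and in which every path between two nodes of $C$ without internal nodes in $C$ has length at most $2k$. It is given to the nodes in that each node knows the color and label of its cluster and its pointers in the trees $T_C$. **Neighborhood cover.** An $s$-sparse $k$-neighborhood cover of diameter $D$ is a family of clusters $C\subseteq V$ such that (A) each cluster has a rooted spanning tree of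 $G[C]$ of diameter at most $D$, (B) for every node $v$ some cluster contains all nodes at distance at most $k$ from $v$, and (C) every node is in at most $s$ clusters. To compute it means that the rooted spanning trees, and hence the clusters, are stored at the nodes as above. **Statement.** 1. For every $k\ge 1$ and all $c,d$: given a $(c,d)$ weak-diameter decomposition of $G^{2k}$, a deterministic CONGEST algorithm computes in $O(c(d+k))$ rounds a $c$-sparse $k$-neighborhood cover all of whose rooted spanning trees have depth at most $d+k$ (distance from the root) and diameter at most $d+2k$. Moreover, if all trees $T_C$ of the decomposition have depth at most $r$, then the trees of the cover have depth at most $r+k$. The constant in the $O(c(d+k))$ is absolute. 2. There is a deterministic CONGEST algorithm that, for every $k\ge 1$ and every $n$-node graph $G$, computes a $2^{O(\sqrt{\log n})}$-sparse $k$-neighborhood cover of diameter $k\cdot 2^{O(\sqrt{\log n})}$ in $k\cdot 2^{O(\sqrt{\log n})}$ rounds. Here the constants (including the one in the message size) depend only on the constant in the $O(\log n)$ bound on the identifier length. -/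

import Mathlib

/-! ### The CONGEST model -/

/-- A communication network: a graph, distinct numerical identifiers of the nodes, and at every
node `v` an arbitrary numbering of the incident edges by ports `0, …, deg v - 1`. -/
structure Network (V : Type) where
  graph : SimpleGraph V
  id : V → ℕ
  id_injective : Function.Injective id
  deg : V → ℕ
  port : (v : V) → Fin (deg v) ≃ graph.neighborSet v

/-- A deterministic synchronous message-passing algorithm with local inputs in `I` and local
outputs in `O`. A node starts from its own identifier, its number of ports and its local input.
In each round it sends one message through each port, then updates its state from the messages
that arrived (`none` at a port number that does not exist). After `rounds` rounds every node
produces its output. Local computation and memory are unrestricted. -/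
structure DistAlgorithm (I O : Type) where
  State : Type
  Msg : Type
  init : (id : ℕ) → (deg : ℕ) → I → State
  send : State → (port : ℕ) → Msg
  step : State → (received : ℕ → Option Msg) → State
  rounds : ℕ
  output : State → O

namespace DistAlgorithm

variable {I O V : Type}

/-- The state of every node after `t` rounds. -/
def exec (A : DistAlgorithm I O) (N : Network V) (input : V → I) : ℕ → V → A.State
  | 0, v => A.init (N.id v) (N.deg v) (input v)
  | t + 1, v => A.step (A.exec N input t v) fun p =>
      if h : p < N.deg v then
        let u := N.port v ⟨p, h⟩
        some (A.send (A.exec N input t u) ((N.port u).symm ⟨v, u.2.symm⟩))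
      else none

/-- The outputs of the nodes when the algorithm stops. -/
def result (A : DistAlgorithm I O) (N : Network V) (input : V → I) (v : V) : O :=
  A.output (A.exec N input A.rounds v)

/-- Every message can be encoded by `b` bits: there are at most `2 ^ b` different messages
(sending nothing counts as a message). -/
def UsesBits (A : DistAlgorithm I O) (b : ℕ) : Prop :=
  Finite A.Msg ∧ Nat.card A.Msg ≤ 2 ^ b

end DistAlgorithm

/-- The unit of length for "`O(log n)` bits": the length of the binary expansion of `n`. -/
def logBits (n : ℕ) : ℕ := Nat.log 2 n + 1

/-! ### Families of rooted trees, decompositions and covers -/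

/-- A rooted tree in `G`. It is a spanning tree of `G[C]` for `C = tree.verts`. -/
structure RootedSubtree {V : Type} (G : SimpleGraph V) where
  tree : G.Subgraph
  isTree : tree.coe.IsTree
  root : tree.verts

namespace RootedSubtree

variable {V : Type} {G : SimpleGraph V}

/-- The diameter of the tree. -/
noncomputable def diameter (T : RootedSubtree G) : ℕ∞ := T.tree.coe.ediam

/-- The depth of the tree: the largest distance in the tree from the root. -/
noncomputable def depth (T : RootedSubtree G) : ℕ∞ := T.tree.coe.eccent T.root

/-- `w` is the parent of `v`: the neighbour of `v` in the tree that is closer to the root. -/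
def IsParent (T : RootedSubtree G) (v w : T.tree.verts) : Prop :=
  T.tree.coe.Adj v w ∧ T.tree.coe.dist w T.root < T.tree.coe.dist v T.root

end RootedSubtree

/-- A family of rooted trees in `G` indexed by a set of numerical labels. -/
structure TreeFamily {V : Type} (G : SimpleGraph V) where
  labels : Set ℕ
  tree : labels → RootedSubtree G

/-- What a single node knows about a family of rooted trees: at a label, the value is `none` if
the node is not in the tree with that label, `some none` if it is the root of that tree, and
`some (some p)` if it is in that tree and its parent is the neighbour behind port `p`. -/
abbrev TreePointers : Type := ℕ → Option (Option ℕ)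

/-- The pointers stored at the nodes describe the family `F`. -/
structure Represents {V : Type} (N : Network V) (ptr : V → TreePointers)
    (F : TreeFamily N.graph) : Prop where
  mem : ∀ v l, ptr v l ≠ none ↔ ∃ h : l ∈ F.labels, v ∈ (F.tree ⟨l, h⟩).tree.verts
  root : ∀ l : F.labels, ptr ((F.tree l).root : V) l = some none
  parent : ∀ (l : F.labels) (v : (F.tree l).tree.verts), v ≠ (F.tree l).root →
    ∃ (w : (F.tree l).tree.verts) (p : Fin (N.deg v)),
      (F.tree l).IsParent v w ∧ (N.port v p : V) = w ∧ ptr v l = some (some (p : ℕ))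

/-- A `(c, d)` weak-diameter decomposition of the power `G^r`. The clusters are the fibres of
`cluster`. Each cluster has a tree in `G` that contains it, may pass through vertices outside it,
and has diameter at most `d`, with distances measured in `G`. -/
structure IsWeakDecomposition {V : Type} (G : SimpleGraph V) (c d r : ℕ)
    (color cluster : V → ℕ) (F : TreeFamily G) : Prop where
  labels_eq : F.labels = Set.range cluster
  color_lt : ∀ v, color v < c
  color_eq : ∀ u v, cluster u = cluster v → color u = color v
  /-- Different clusters of the same color have distance more than `r`. -/
  separated : ∀ u v, color u = color v → cluster u ≠ cluster v → (r : ℕ∞) < G.edist u v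
  spans : ∀ (l : F.labels) (v : V), cluster v = l → v ∈ (F.tree l).tree.verts
  root_mem : ∀ l : F.labels, cluster ((F.tree l).root : V) = l
  /-- Consecutive vertices of the cluster on the tree are adjacent in `G^r`: a path in the tree
  between two vertices of the cluster without internal vertices in the cluster has length at
  most `r`. -/
  hop : ∀ (l : F.labels) (u v : (F.tree l).tree.verts), cluster u = l → cluster v = l →
    ∀ p : (F.tree l).tree.coe.Walk u v, p.IsPath →
      (∀ w ∈ p.support, cluster w = l → w = u ∨ w = v) → p.length ≤ r
  diameter_le : ∀ l : F.labels, (F.tree l).diameter ≤ d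

/-- An `s`-sparse `k`-neighborhood cover of diameter `D`. The clusters are the vertex sets of the
trees of the family, each tree being a rooted spanning tree of the subgraph induced by its
cluster. -/
structure IsNeighborhoodCover {V : Type} (G : SimpleGraph V) (s k D : ℕ)
    (F : TreeFamily G) : Prop where
  diameter_le : ∀ l : F.labels, (F.tree l).diameter ≤ D
  covers : ∀ v : V, ∃ l : F.labels, ∀ u : V, G.edist v u ≤ k → u ∈ (F.tree l).tree.verts
  sparse : ∀ v : V, {l : F.labels | v ∈ (F.tree l).tree.verts}.encard ≤ s

/-- The local input of a node that is given a decomposition: color and label of its own cluster,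
and its pointers in the trees of the clusters. -/
structure DecompositionInput where
  color : ℕ
  cluster : ℕ
  pointers : TreePointers

/-! Part 1 treats the colors one after the other and enlarges every cluster `C` to its
`k`-neighborhood. Clusters of one color are more than `2k` apart, so these neighborhoods are
disjoint: a single wave of `k` hops, in which a node holds only one label, explores all of them, and
every vertex lies in at most one cover cluster per color (`IsWeakDecomposition.eq_of_reach`). The
tree `T_C` may leave the neighborhood and is therefore pruned to the ancestors of vertices of `C`
(`Marked`). A marked vertex lies on a tree path from a vertex of `C` below it to one above it, which
exists because the root is in `C`. With nearest such ends the path has length at most `2k`, so one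
end is within distance `k` (`Marked.reach`). Hence marking, too, needs one label per node and color,
and `d` rounds of climbing finish it. The cover tree is the pruned tree with branches of length at
most `k` along the wave pointers. This adds at most `k` to the depth, and at most `2k` to the
diameter because the retraction of `T_C` to its pruned part does not stretch walks
(`ExpandSpec.near_of_marked`).

Part 2 does not use part 1. It builds a cover with polylogarithmic parameters directly, by
deterministic cluster growing in `G^(2k)`. At the start of a class, every uncovered node is a
cluster labelled by its identifier. For each bit `i`, the labels with bit `i` set are sources. A
node with another label within distance `2k` of a source proposes to one of them. A source accepts
all its proposals if they amount to a `1 / D` fraction of its size; otherwise the proposers lose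
their labels. A source still threatened after a step has grown by the factor `1 + 1 / D`
(`GrowStep.card_growth`), which cannot go on for `D log n` steps. A rejecting source is never
threatened again during this bit, so its members pay for the lost nodes only once
(`GrowStep.potential_le`). With `D = 2B` for `B` bits, at least half of the nodes keep a label, and
labels within distance `2k` of each other are equal. In a last wave, a node within distance `k` of a
labelled node `v` receives a label from within distance `2k` of `v`, and this is the label of `v`;
so `v` is covered. About `log n` classes suffice.

The trees of part 2 are the traces of the waves and are never reset. A wave puts a node into at most
one new tree, which bounds the sparsity by the number of waves. Every hop has its own time and
parents are older than children, which bounds the depth. The trees overlap, but at each time a node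
sent at most one label and adopted at most one. Replaying the times backwards therefore sums
counters over all trees in parallel without congestion (`TreeInv.sum_collect`), and replaying them
forwards distributes the decisions (`triple_spread`).

Both algorithms are straight-line programs, verified by pre- and postconditions (`Network.Triple`)
that also keep all messages in a finite set. -/

/-! ### Programs of one-round instructions -/

/-- One communication round of every node, for nodes with local state in `σ`. -/
structure Instr (σ μ : Type) where
  send : σ → ℕ → μ
  step : σ → (ℕ → Option μ) → σ

/-- A purely local computation. -/
def Instr.localStep {σ μ : Type} [Zero μ] (f : σ → σ) : Instr σ μ where
  send _ _ := 0
  step s _ := f s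

namespace Network

variable {V σ μ : Type} (N : Network V)

/-- The messages that arrive at `v`, by port number. -/
def inbox (snd : V → ℕ → μ) (v : V) (p : ℕ) : Option μ :=
  if h : p < N.deg v then
    some (snd (N.port v ⟨p, h⟩)
      ((N.port (N.port v ⟨p, h⟩)).symm ⟨v, (N.port v ⟨p, h⟩).2.symm⟩ : Fin _))
  else none

/-- The effect of one instruction on the configuration of the network. -/
def runInstr (i : Instr σ μ) (c : V → σ) (v : V) : σ :=
  i.step (c v) (N.inbox (fun u => i.send (c u)) v)

/-- The effect of a program. -/
def run : List (Instr σ μ) → (V → σ) → V → σ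
  | [], c => c
  | i :: l, c => run l (N.runInstr i c)

/-- All messages sent by a program are in `M`. -/
def Safe (M : Set μ) : List (Instr σ μ) → (V → σ) → Prop
  | [], _ => True
  | i :: l, c => (∀ v p, i.send (c v) p ∈ M) ∧ Safe M l (N.runInstr i c)

theorem run_append (l₁ l₂ : List (Instr σ μ)) (c : V → σ) :
    N.run (l₁ ++ l₂) c = N.run l₂ (N.run l₁ c) := by
  induction l₁ generalizing c with
  | nil => rfl
  | cons i l ih => exact ih _

theorem safe_append (M : Set μ) (l₁ l₂ : List (Instr σ μ)) (c : V → σ) :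
    N.Safe M (l₁ ++ l₂) c ↔ N.Safe M l₁ c ∧ N.Safe M l₂ (N.run l₁ c) := by
  induction l₁ generalizing c with
  | nil => simp [Safe, run]
  | cons i l ih => simp [Safe, run, ih, and_assoc]

/-- From a configuration satisfying `P` the program is safe and leads to one satisfying `Q`. -/
def Triple (M : Set μ) (P : (V → σ) → Prop) (l : List (Instr σ μ)) (Q : (V → σ) → Prop) : Prop :=
  ∀ c, P c → N.Safe M l c ∧ Q (N.run l c)

variable {N} {M : Set μ} {P Q R : (V → σ) → Prop}

theorem Triple.append {l₁ l₂ : List (Instr σ μ)} (h₁ : N.Triple M P l₁ Q)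
    (h₂ : N.Triple M Q l₂ R) : N.Triple M P (l₁ ++ l₂) R := by
  intro c hc
  obtain ⟨hs, hq⟩ := h₁ c hc
  obtain ⟨hs', hr⟩ := h₂ _ hq
  exact ⟨(N.safe_append ..).2 ⟨hs, hs'⟩, by rwa [run_append]⟩

theorem Triple.single {i : Instr σ μ} (h : ∀ c, P c → ∀ v p, i.send (c v) p ∈ M)
    (h' : ∀ c, P c → Q (N.runInstr i c)) : N.Triple M P [i] Q :=
  fun c hc => ⟨⟨h c hc, trivial⟩, h' c hc⟩

theorem Triple.localStep [Zero μ] (h0 : (0 : μ) ∈ M) {f : σ → σ}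
    (h' : ∀ c, P c → Q (fun v => f (c v))) :
    N.Triple M P [Instr.localStep f] Q :=
  Triple.single (fun _ _ _ _ => h0) h'

theorem Triple.range {Inv : ℕ → (V → σ) → Prop} {f : ℕ → List (Instr σ μ)} (n : ℕ)
    (h : ∀ i < n, N.Triple M (Inv i) (f i) (Inv (i + 1))) :
    N.Triple M (Inv 0) ((List.range n).flatMap f) (Inv n) := by
  induction n with
  | zero => exact fun c hc => ⟨trivial, hc⟩
  | succ n ih =>
    rw [List.range_succ, List.flatMap_append]
    refine (ih fun i hi => h i (by omega)).append ?_
    simpa using h n (by omega)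

theorem Triple.mono {P' Q' : (V → σ) → Prop} {l : List (Instr σ μ)} (h : N.Triple M P l Q)
    (hP : ∀ c, P' c → P c) (hQ : ∀ c, Q c → Q' c) : N.Triple M P' l Q' :=
  fun c hc => ⟨(h c (hP c hc)).1, hQ _ (h c (hP c hc)).2⟩

/-- A program as a distributed algorithm whose messages are the elements of a finite set. -/
noncomputable def _root_.Instr.toAlgorithm {I O : Type} (M : Finset μ) (m₀ : M)
    (init : ℕ → ℕ → I → σ) (l : List (Instr σ μ)) (out : σ → O) : DistAlgorithm I O where
  State := List (Instr σ μ) × σ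
  Msg := M
  init i d x := (l, init i d x)
  send s p := match s.1 with
    | [] => m₀
    -- The default `m₀` makes the message type finite by construction; for a program that is `Safe`
    -- it never replaces a message.
    | i :: _ => open Classical in if h : i.send s.2 p ∈ M then ⟨_, h⟩ else m₀
  step s r := match s.1 with
    | [] => s
    | i :: l => (l, i.step s.2 fun p => (r p).map (↑))
  rounds := l.length
  output s := out s.2

theorem toAlgorithm_usesBits {I O : Type} {M : Finset μ} {m₀ : M} {init : ℕ → ℕ → I → σ}
    {l : List (Instr σ μ)} {out : σ → O} {b : ℕ} (h : M.card ≤ 2 ^ b) :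
    (Instr.toAlgorithm M m₀ init l out).UsesBits b := by
  refine ⟨inferInstanceAs (Finite M), ?_⟩
  change Nat.card M ≤ _
  simpa using h

/-- Splitting the program into an executed prefix and the rest carried in the state allows an
induction that appends to the prefix, as `exec` unfolds its last round. -/
theorem toAlgorithm_exec {I O : Type} {M : Finset μ} {m₀ : M} {init : ℕ → ℕ → I → σ}
    {l : List (Instr σ μ)} {out : σ → O} (input : V → I)
    (hs : N.Safe (M : Set μ) l fun v => init (N.id v) (N.deg v) (input v)) (l₁ l₂ : List (Instr σ μ))
    (hl : l = l₁ ++ l₂) (v : V) :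
    (Instr.toAlgorithm M m₀ init l out).exec N input l₁.length v =
      (l₂, N.run l₁ (fun v => init (N.id v) (N.deg v) (input v)) v) := by
  induction l₁ using List.reverseRecOn generalizing l₂ v with
  | nil => subst hl; rfl
  | append_singleton l₁ i ih =>
    have hl' : l = l₁ ++ (i :: l₂) := by simpa using hl
    have ih := ih (i :: l₂) hl'
    rw [List.length_append, List.length_singleton, DistAlgorithm.exec, ih, run_append]
    rw [hl', safe_append] at hs
    simp only [ih]
    simp only [Instr.toAlgorithm, run, runInstr, Prod.mk.injEq, true_and]
    congr 1
    funext p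
    unfold inbox
    by_cases h : p < N.deg v
    · have := hs.2.1 (N.port v ⟨p, h⟩)
        ((N.port (N.port v ⟨p, h⟩)).symm ⟨v, (N.port v ⟨p, h⟩).2.symm⟩ : Fin _)
      simp only [dif_pos h, Option.map_some]
      rw [dif_pos (by simpa using this)]
    · simp only [dif_neg h, Option.map_none]

theorem toAlgorithm_result {I O : Type} {M : Finset μ} {m₀ : M} {init : ℕ → ℕ → I → σ}
    {l : List (Instr σ μ)} {out : σ → O} (input : V → I)
    (hs : N.Safe (M : Set μ) l fun v => init (N.id v) (N.deg v) (input v)) :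
    (Instr.toAlgorithm M m₀ init l out).result N input =
      fun v => out (N.run l (fun v => init (N.id v) (N.deg v) (input v)) v) := by
  funext v
  have := toAlgorithm_exec (m₀ := m₀) (out := out) input hs l [] (by simp) v
  exact congrArg (fun s => out s.2) this

/-! ### Reading the inbox -/

theorem inbox_eq_some {snd : V → ℕ → μ} {v : V} {p : ℕ} {m : μ} (h : N.inbox snd v p = some m) :
    ∃ hp : p < N.deg v, snd (N.port v ⟨p, hp⟩)
      ((N.port (N.port v ⟨p, hp⟩)).symm ⟨v, (N.port v ⟨p, hp⟩).2.symm⟩ : Fin _) = m := by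
  unfold inbox at h
  split_ifs at h with hp
  exact ⟨hp, by simpa using h⟩

theorem exists_inbox_of_adj (snd : V → ℕ → μ) {u v : V} (h : N.graph.Adj u v)
    (q : Fin (N.deg u)) (hq : (N.port u q : V) = v) : ∃ p, N.inbox snd v p = some (snd u q) := by
  obtain ⟨p, hp⟩ := (N.port v).surjective ⟨u, h.symm⟩
  refine ⟨p, ?_⟩
  have hu : (N.port v p : V) = u := by rw [hp]
  subst hu
  unfold inbox
  rw [dif_pos p.2]
  congr 2
  have : (N.port (N.port v p : V)).symm ⟨v, (N.port v p).2.symm⟩ = q := by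
    rw [Equiv.symm_apply_eq]; exact Subtype.ext hq.symm
  exact congrArg Fin.val this

/-- The number of a port determines the number of the port at the other end. -/
theorem backPort_eq_iff {u v : V} (h : N.graph.Adj u v) (q : ℕ) :
    (((N.port u).symm ⟨v, h⟩ : Fin _) : ℕ) = q ↔ ∃ hq : q < N.deg u, (N.port u ⟨q, hq⟩ : V) = v := by
  constructor
  · rintro rfl
    refine ⟨Fin.is_lt _, ?_⟩
    simp
  · rintro ⟨hq, he⟩
    have : (N.port u).symm ⟨v, h⟩ = ⟨q, hq⟩ := by
      rw [Equiv.symm_apply_eq]; exact Subtype.ext he.symm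
    rw [this]

end Network

/-- A port at which a label arrives, with this label. The message `0` is no label and `x + 1` is
the label `x`. -/
noncomputable def arrivingLabel (r : ℕ → Option ℕ) : Option (ℕ × ℕ) :=
  open Classical in
  if h : ∃ q : ℕ × ℕ, r q.1 = some (q.2 + 1) then some h.choose else none

theorem arrivingLabel_eq_some {r : ℕ → Option ℕ} {p x : ℕ} (h : arrivingLabel r = some (p, x)) :
    r p = some (x + 1) := by
  unfold arrivingLabel at h
  split_ifs at h with h'
  have := h'.choose_spec
  simp only [Option.some.injEq] at h
  rwa [h] at this

theorem arrivingLabel_ne_none {r : ℕ → Option ℕ} {p x : ℕ} (h : r p = some (x + 1)) :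
    arrivingLabel r ≠ none := by
  unfold arrivingLabel
  rw [dif_pos ⟨(p, x), h⟩]
  simp

/-- The message that stands for an optional label. -/
def labelMsg : Option ℕ → ℕ
  | none => 0
  | some x => x + 1

theorem labelMsg_eq_succ {o : Option ℕ} {x : ℕ} : labelMsg o = x + 1 ↔ o = some x := by
  cases o <;> simp [labelMsg]

/-! ### Waves -/

/-- `u` and `v` are at distance at most `j`. -/
def Near {V : Type} (G : SimpleGraph V) (j : ℕ) (u v : V) : Prop := ∃ p : G.Walk u v, p.length ≤ j

section Near

variable {V : Type} {G : SimpleGraph V} {i j : ℕ} {u v w : V}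

theorem near_iff_edist_le : Near G j u v ↔ G.edist u v ≤ j := by
  constructor
  · rintro ⟨p, hp⟩
    exact p.edist_le.trans (by exact_mod_cast hp)
  · intro h
    obtain ⟨p, hp⟩ := SimpleGraph.exists_walk_of_edist_ne_top (ne_top_of_le_ne_top (by simp) h)
    exact ⟨p, by rw [← hp] at h; exact_mod_cast h⟩

theorem Near.refl (v : V) : Near G j v v := ⟨.nil, by simp⟩

theorem Near.symm (h : Near G j u v) : Near G j v u := by
  obtain ⟨p, hp⟩ := h
  exact ⟨p.reverse, by simpa using hp⟩

theorem Near.trans (h : Near G i u v) (h' : Near G j v w) : Near G (i + j) u w := by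
  obtain ⟨p, hp⟩ := h
  obtain ⟨q, hq⟩ := h'
  exact ⟨p.append q, by simp; omega⟩

theorem Near.mono (h : Near G i u v) (hij : i ≤ j) : Near G j u v := by
  obtain ⟨p, hp⟩ := h
  exact ⟨p, hp.trans hij⟩

theorem Near.of_adj (h : G.Adj u v) : Near G 1 u v := ⟨.cons h .nil, by simp⟩

theorem near_zero : Near G 0 u v ↔ u = v := by
  constructor
  · rintro ⟨p, hp⟩
    exact SimpleGraph.Walk.eq_of_length_eq_zero (Nat.le_zero.1 hp)
  · rintro rfl; exact .refl _

theorem Near.exists_adj (h : Near G (j + 1) u v) : Near G j u v ∨ ∃ w, G.Adj v w ∧ Near G j u w := by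
  obtain ⟨p, hp⟩ := h.symm
  cases p with
  | nil => exact .inl (.refl _)
  | cons h q => exact .inr ⟨_, h, Near.symm ⟨q, by simpa using hp⟩⟩

end Near

/-- One hop of a wave: a node that has no label yet adopts the label of some neighbor. -/
structure WaveHop {V : Type} (G : SimpleGraph V) (w w' : V → Option ℕ) : Prop where
  keep : ∀ v x, w v = some x → w' v = some x
  adopt : ∀ v x, w v = none → w' v = some x → ∃ u, G.Adj v u ∧ w u = some x
  spread : ∀ u v, G.Adj v u → w u ≠ none → w' v ≠ none

/-- The labels after `j` hops of a wave from the sources `src`: every node within distance `j` of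
the sources has the label of a nearest source. -/
structure WaveSpec {V : Type} (G : SimpleGraph V) (src : V → ℕ → Prop) (j : ℕ)
    (w : V → Option ℕ) : Prop where
  sound : ∀ v x, w v = some x → ∃ u, src u x ∧ Near G j u v
  nearest : ∀ i ≤ j, ∀ u v x, src u x → Near G i u v →
    ∃ u' y, w v = some y ∧ src u' y ∧ Near G i u' v

/-- Labels are never replaced, so nothing changes for distances up to `j`. At distance `j + 1` it
suffices that some label arrives: soundness then provides its source. -/
theorem WaveSpec.hop {V : Type} {G : SimpleGraph V} {src : V → ℕ → Prop} {j : ℕ}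
    {w w' : V → Option ℕ} (h : WaveSpec G src j w) (hw : WaveHop G w w') :
    WaveSpec G src (j + 1) w' := by
  have sound : ∀ v x, w' v = some x → ∃ u, src u x ∧ Near G (j + 1) u v := by
    intro v x hx
    rcases hv : w v with _ | y
    · obtain ⟨u, hu, hux⟩ := hw.adopt v x hv hx
      obtain ⟨s, hs, hsu⟩ := h.sound u x hux
      exact ⟨s, hs, hsu.trans (.of_adj hu.symm)⟩
    · obtain rfl : y = x := by simpa [hw.keep v y hv] using hx
      obtain ⟨s, hs, hsu⟩ := h.sound v y hv
      exact ⟨s, hs, hsu.mono (by omega)⟩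
  refine ⟨sound, fun i hi u v x hu huv => ?_⟩
  by_cases hij : i ≤ j
  · obtain ⟨u', y, hy, hu', hn⟩ := h.nearest i hij u v x hu huv
    exact ⟨u', y, hw.keep v y hy, hu', hn⟩
  · obtain rfl : i = j + 1 := by omega
    have : w' v ≠ none := by
      rcases huv.exists_adj with h' | ⟨t, ht, h'⟩
      · obtain ⟨u', y, hy, -⟩ := h.nearest j le_rfl u v x hu h'
        simp [hw.keep v y hy]
      · obtain ⟨u', y, hy, -⟩ := h.nearest j le_rfl u t x hu h'
        exact hw.spread t v ht (by simp [hy])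
    obtain ⟨y, hy⟩ := Option.ne_none_iff_exists'.1 this
    obtain ⟨u', h1, h2⟩ := sound v y hy
    exact ⟨u', y, hy, h1, h2⟩

/-- The new label and the port it came from, for a node that holds `w` and receives `r`. -/
noncomputable def adopt (w : Option ℕ) (r : ℕ → Option ℕ) : Option (ℕ × ℕ) :=
  if w = none then arrivingLabel r else none

section Adopt

variable {V : Type} {N : Network V} {w : V → Option ℕ} {v : V} {p x : ℕ}

theorem adopt_eq_some (h : adopt (w v) (N.inbox (fun u _ => labelMsg (w u)) v) = some (p, x)) :
    w v = none ∧ ∃ hp : p < N.deg v, w (N.port v ⟨p, hp⟩) = some x := by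
  unfold adopt at h
  split_ifs at h with h0
  obtain ⟨hp, hm⟩ := N.inbox_eq_some (arrivingLabel_eq_some h)
  exact ⟨h0, hp, labelMsg_eq_succ.1 hm⟩

theorem waveHop_adopt :
    WaveHop N.graph w fun v =>
      (w v).or ((adopt (w v) (N.inbox (fun u _ => labelMsg (w u)) v)).map Prod.snd) := by
  refine ⟨fun v x h => by simp [h], fun v x h h' => ?_, fun u v h h' => ?_⟩
  · simp only [h, Option.none_or, Option.map_eq_some_iff] at h'
    obtain ⟨⟨p, y⟩, hp, rfl⟩ := h'
    rw [← h] at hp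
    obtain ⟨-, hp, hy⟩ := adopt_eq_some hp
    exact ⟨_, (N.port v ⟨p, hp⟩).2, hy⟩
  · rcases hv : w v with _ | y
    · obtain ⟨y, hy⟩ := Option.ne_none_iff_exists'.1 h'
      have hadj := h.symm
      obtain ⟨p, hp⟩ := N.exists_inbox_of_adj (fun u _ => labelMsg (w u)) hadj
        ((N.port u).symm ⟨v, hadj⟩) (by simp)
      rw [labelMsg_eq_succ.2 hy] at hp
      simpa [adopt] using arrivingLabel_ne_none hp
    · simp

end Adopt

/-! ### Trees from parent pointers -/

/-- `par` maps every vertex of `S` other than `r` to an adjacent vertex of `S` of smaller rank. -/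
structure IsParentMap {V : Type} (G : SimpleGraph V) (S : Set V) (r : V) (par : V → V)
    (rank : V → ℕ) : Prop where
  root_mem : r ∈ S
  par_mem : ∀ v ∈ S, v ≠ r → par v ∈ S
  adj : ∀ v ∈ S, v ≠ r → G.Adj v (par v)
  rank_lt : ∀ v ∈ S, v ≠ r → rank (par v) < rank v

namespace IsParentMap

variable {V : Type} {G : SimpleGraph V} {S : Set V} {r : V} {par : V → V} {rank : V → ℕ}

/-- The subgraph formed by the edges between the vertices and their parents. -/
def subgraph (h : IsParentMap G S r par rank) : G.Subgraph where
  verts := S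
  Adj u v := (u ∈ S ∧ u ≠ r ∧ par u = v) ∨ (v ∈ S ∧ v ≠ r ∧ par v = u)
  adj_sub := by
    rintro u v (⟨hu, hr, rfl⟩ | ⟨hv, hr, rfl⟩)
    · exact h.adj u hu hr
    · exact (h.adj v hv hr).symm
  edge_vert := by
    rintro u v (⟨hu, hr, rfl⟩ | ⟨hv, hr, rfl⟩)
    · exact hu
    · exact h.par_mem v hv hr
  symm := ⟨fun _ _ => Or.symm⟩

theorem adj_par (h : IsParentMap G S r par rank) (v : h.subgraph.verts) (hv : (v : V) ≠ r) :
    h.subgraph.coe.Adj v ⟨par v, h.par_mem v v.2 hv⟩ :=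
  Or.inl ⟨v.2, hv, rfl⟩

theorem exists_walk_root (h : IsParentMap G S r par rank) (v : h.subgraph.verts) :
    ∃ p : h.subgraph.coe.Walk v ⟨r, h.root_mem⟩, p.length ≤ rank v := by
  induction hn : rank v using Nat.strong_induction_on generalizing v with
  | _ n ih =>
    by_cases hv : (v : V) = r
    · obtain rfl : v = ⟨r, h.root_mem⟩ := Subtype.ext hv
      exact ⟨.nil, by simp⟩
    · have hlt := h.rank_lt v v.2 hv
      obtain ⟨p, hp⟩ := ih _ (hn ▸ hlt) ⟨par v, h.par_mem v v.2 hv⟩ rfl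
      refine ⟨.cons (h.adj_par v hv) p, ?_⟩
      simp only [SimpleGraph.Walk.length_cons]
      simp only at hp
      omega

theorem connected (h : IsParentMap G S r par rank) : h.subgraph.coe.Connected := by
  have : Nonempty h.subgraph.verts := ⟨⟨r, h.root_mem⟩⟩
  refine ⟨fun u v => ?_⟩
  obtain ⟨p, -⟩ := h.exists_walk_root u
  obtain ⟨q, -⟩ := h.exists_walk_root v
  exact ⟨p.append q.reverse⟩

/-- Every edge joins some non-root vertex to its parent, so there are fewer edges than vertices, and
connectedness gives the reverse inequality. -/
theorem isTree [Finite V] (h : IsParentMap G S r par rank) : h.subgraph.coe.IsTree := by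
  have : Finite h.subgraph.verts := Subtype.finite
  rw [SimpleGraph.isTree_iff_connected_and_card]
  refine ⟨h.connected, le_antisymm ?_ h.connected.card_vert_le_card_edgeSet_add_one⟩
  let rt : h.subgraph.verts := ⟨r, h.root_mem⟩
  have hne (v : {v : h.subgraph.verts // v ≠ rt}) : (v.1 : V) ≠ r :=
    fun e => v.2 (Subtype.ext e)
  let f : {v : h.subgraph.verts // v ≠ rt} → h.subgraph.coe.edgeSet := fun v =>
    ⟨s(v.1, ⟨par v.1, h.par_mem v.1 v.1.2 (hne v)⟩), h.adj_par v.1 (hne v)⟩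
  have hf : Function.Surjective f := by
    rintro ⟨e, he⟩
    induction e with
    | _ u v =>
      rcases he with ⟨hu, hr, hp⟩ | ⟨hv, hr, hp⟩
      · refine ⟨⟨u, fun e => hr (congrArg Subtype.val e)⟩, ?_⟩
        simp only [f, hp]
      · refine ⟨⟨v, fun e => hr (congrArg Subtype.val e)⟩, ?_⟩
        simp only [f, hp]
        exact Subtype.ext Sym2.eq_swap
  have h1 := Nat.card_le_card_of_surjective f hf
  have h2 : Nat.card {v : h.subgraph.verts // v ≠ rt} + 1 = Nat.card h.subgraph.verts := by
    classical
    have := Fintype.ofFinite h.subgraph.verts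
    rw [Nat.card_eq_fintype_card, Nat.card_eq_fintype_card, Fintype.card_subtype_compl,
      Fintype.card_subtype_eq]
    have : 0 < Fintype.card h.subgraph.verts := Fintype.card_pos_iff.2 ⟨rt⟩
    omega
  omega

theorem exists_iterate_eq (h : IsParentMap G S r par rank) (v : V) (hv : v ∈ S) :
    ∃ i, par^[i] v = r := by
  induction hn : rank v using Nat.strong_induction_on generalizing v with
  | _ n ih =>
    by_cases hr : v = r
    · exact ⟨0, hr⟩
    · obtain ⟨i, hi⟩ := ih _ (hn ▸ h.rank_lt v hv hr) (par v) (h.par_mem v hv hr) rfl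
      exact ⟨i + 1, hi⟩

/-- A rank may drop by any amount along an edge. The number of parent steps to the root changes by
exactly one, so it is the tree distance, which `isParent_par` has to compare. -/
theorem exists_level (h : IsParentMap G S r par rank) :
    ∃ lev : V → ℕ, lev r = 0 ∧ ∀ v ∈ S, v ≠ r → lev v = lev (par v) + 1 := by
  classical
  refine ⟨fun v => sInf {i | par^[i] v = r}, ?_, fun v hv hr => ?_⟩
  · exact Nat.sInf_eq_zero.2 (.inl rfl)
  · have h1 := h.exists_iterate_eq v hv
    have h2 : ∃ i, par^[i + 1] v = r := h.exists_iterate_eq (par v) (h.par_mem v hv hr)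
    change sInf {i | par^[i] v = r} = sInf {i | par^[i + 1] v = r} + 1
    have e1 : sInf {i | par^[i] v = r} = Nat.find h1 := Nat.sInf_def h1
    have e2 : sInf {i | par^[i + 1] v = r} = Nat.find h2 := Nat.sInf_def h2
    rw [e1, e2]
    exact Nat.find_comp_succ h1 h2 hr

/-- The tree described by parent pointers. -/
def toTree [Finite V] (h : IsParentMap G S r par rank) : RootedSubtree G where
  tree := h.subgraph
  isTree := h.isTree
  root := ⟨r, h.root_mem⟩

theorem isParent_par [Finite V] (h : IsParentMap G S r par rank) (v : h.toTree.tree.verts)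
    (hv : (v : V) ≠ r) : h.toTree.IsParent v ⟨par v, h.par_mem v v.2 hv⟩ := by
  refine ⟨h.adj_par v hv, ?_⟩
  obtain ⟨lev, h0, hs⟩ := h.exists_level
  have hle : ∀ (u w : h.subgraph.verts) (p : h.subgraph.coe.Walk u w), lev u ≤ lev w + p.length := by
    intro u w p
    induction p with
    | nil => simp
    | @cons a b c hab q ih =>
      simp only [SimpleGraph.Walk.length_cons]
      rcases hab with ⟨ha, hr, hp⟩ | ⟨hb, hr, hp⟩
      · have := hs a ha hr
        rw [hp] at this
        omega
      · have := hs b hb hr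
        rw [hp] at this
        omega
  have hge : ∀ n, ∀ u : h.subgraph.verts, lev u = n →
      ∃ p : h.subgraph.coe.Walk u ⟨r, h.root_mem⟩, p.length = n := by
    intro n
    induction n with
    | zero =>
      intro u hu
      by_cases hr : (u : V) = r
      · obtain rfl : u = ⟨r, h.root_mem⟩ := Subtype.ext hr
        exact ⟨.nil, rfl⟩
      · have := hs u u.2 hr
        omega
    | succ n ih =>
      intro u hu
      have hr : (u : V) ≠ r := by
        intro e
        rw [e] at hu
        omega
      have := hs u u.2 hr
      obtain ⟨p, hp⟩ := ih ⟨par u, h.par_mem u u.2 hr⟩ (by simp only; omega)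
      exact ⟨.cons (h.adj_par u hr) p, by simp [hp]⟩
  obtain ⟨p, hp⟩ := hge _ ⟨par v, h.par_mem v v.2 hv⟩ rfl
  obtain ⟨q, hq⟩ := h.connected.exists_walk_length_eq_dist v ⟨r, h.root_mem⟩
  have h1 := hle _ _ q
  have h2 := hs v v.2 hv
  have h3 := SimpleGraph.dist_le p
  simp only [h0] at h1
  simp only at hp
  change h.subgraph.coe.dist _ ⟨r, h.root_mem⟩ < h.subgraph.coe.dist v ⟨r, h.root_mem⟩
  exact h3.trans_lt (by omega)

/-- The subgraph does not depend on the rank, so the depth of one and the same tree can be bounded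
by any rank that suits its pointers. -/
theorem depth_le [Finite V] (h : IsParentMap G S r par rank) {rank' : V → ℕ} {m : ℕ}
    (h' : IsParentMap G S r par rank') (hm : ∀ v ∈ S, rank' v ≤ m) : h.toTree.depth ≤ m := by
  rw [RootedSubtree.depth, SimpleGraph.eccent_le_iff]
  intro v
  obtain ⟨p, hp⟩ := h'.exists_walk_root v
  rw [SimpleGraph.edist_comm]
  exact p.edist_le.trans (by exact_mod_cast hp.trans (hm v v.2))

theorem diameter_le [Finite V] (h : IsParentMap G S r par rank) {m : ℕ}
    (hm : ∀ v ∈ S, rank v ≤ m) : h.toTree.diameter ≤ ((2 * m : ℕ) : ℕ∞) := by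
  refine (SimpleGraph.ediam_le_two_mul_eccent h.toTree.root).trans ?_
  push_cast
  gcongr
  exact h.depth_le h hm

end IsParentMap

/-! ### Tree families from stored pointers -/

namespace Network

variable {V : Type} (N : Network V)

/-- The neighbor to which the pointer of `v` for the label `l` leads. -/
def parentOf (out : V → TreePointers) (l : ℕ) (v : V) : V :=
  match out v l with
  | some (some p) => if h : p < N.deg v then N.port v ⟨p, h⟩ else v
  | _ => v

theorem parentOf_eq {out : V → TreePointers} {l p : ℕ} {v : V} (h : out v l = some (some p))
    (hp : p < N.deg v) : N.parentOf out l v = N.port v ⟨p, hp⟩ := by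
  simp [parentOf, h, hp]

/-- The pointers for the labels in `Λ` lead to the roots, decreasing the rank. -/
structure PointersTo (out : V → TreePointers) (Λ : Set ℕ) (root : Λ → V) (rank : Λ → V → ℕ) :
    Prop where
  root_eq : ∀ l : Λ, out (root l) l = some none
  label_mem : ∀ v l, out v l ≠ none → l ∈ Λ
  eq_root : ∀ (v : V) (l : Λ), out v l = some none → v = root l
  parent : ∀ (v : V) (l : Λ) (p : ℕ), out v l = some (some p) →
    ∃ hp : p < N.deg v, out (N.port v ⟨p, hp⟩) l ≠ none ∧
      rank l (N.port v ⟨p, hp⟩) < rank l v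

namespace PointersTo

variable {N} {out : V → TreePointers} {Λ : Set ℕ} {root : Λ → V} {rank : Λ → V → ℕ}

theorem exists_port (h : N.PointersTo out Λ root rank) (l : Λ) (v : V) (hv : out v l ≠ none)
    (hr : v ≠ root l) : ∃ (p : ℕ) (hp : p < N.deg v), out v l = some (some p) ∧
      N.parentOf out l v = N.port v ⟨p, hp⟩ ∧ out (N.port v ⟨p, hp⟩) l ≠ none ∧
        rank l (N.port v ⟨p, hp⟩) < rank l v := by
  obtain ⟨o, ho⟩ := Option.ne_none_iff_exists'.1 hv
  rcases o with _ | p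
  · exact absurd (h.eq_root v l ho) hr
  · obtain ⟨hp, h1, h2⟩ := h.parent v l p ho
    exact ⟨p, hp, ho, N.parentOf_eq ho hp, h1, h2⟩

theorem isParentMap (h : N.PointersTo out Λ root rank) (l : Λ) :
    IsParentMap N.graph {v | out v l ≠ none} (root l) (N.parentOf out l) (rank l) where
  root_mem := by simp [h.root_eq l]
  par_mem v hv hr := by
    obtain ⟨p, hp, -, he, h1, -⟩ := h.exists_port l v hv hr
    rwa [he]
  adj v hv hr := by
    obtain ⟨p, hp, -, he, -, -⟩ := h.exists_port l v hv hr
    rw [he]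
    exact (N.port v ⟨p, hp⟩).2
  rank_lt v hv hr := by
    obtain ⟨p, hp, -, he, -, h1⟩ := h.exists_port l v hv hr
    rwa [he]

/-- The family of trees described by the pointers. -/
def family [Finite V] (h : N.PointersTo out Λ root rank) : TreeFamily N.graph where
  labels := Λ
  tree l := (h.isParentMap l).toTree

theorem represents [Finite V] (h : N.PointersTo out Λ root rank) : Represents N out h.family where
  mem v l := ⟨fun hv => ⟨h.label_mem v l hv, hv⟩, fun ⟨_, hv⟩ => hv⟩
  root l := h.root_eq l
  parent l v hv := by
    have hr : (v : V) ≠ root l := fun e => hv (Subtype.ext e)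
    obtain ⟨p, hp, ho, he, -, -⟩ := h.exists_port l v v.2 hr
    exact ⟨_, ⟨p, hp⟩, (h.isParentMap l).isParent_par v hr, he.symm, ho⟩

end PointersTo

end Network

/-! ### Growing clusters -/

/-- The new label of a node with label `lab` that was reached by the wave with label `w`. Nodes
whose label is a source keep it. The other nodes that were reached change to the label
of the wave if it accepts them and lose their label otherwise. -/
def relabel (src acc : ℕ → Bool) (lab w : Option ℕ) : Option ℕ :=
  match lab with
  | none => none
  | some x => if src x then some x else
    match w with
    | none => some x
    | some y => if acc y then some y else none

section Growth

variable {V : Type} [Fintype V]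

open Classical in
/-- The nodes with label `y`. -/
noncomputable def members (ℓ : V → Option ℕ) (y : ℕ) : Finset V :=
  Finset.univ.filter fun v => ℓ v = some y

open Classical in
/-- The nodes with a label that is not a source and to which the wave `y` arrived. -/
noncomputable def proposers (src : ℕ → Bool) (ℓ w : V → Option ℕ) (y : ℕ) : Finset V :=
  Finset.univ.filter fun v => w v = some y ∧ ∃ x, ℓ v = some x ∧ src x = false

/-- One step of cluster growing. The nodes near a source propose to join a source near them, and a
source accepts if the number of proposals is at least a `1 / D` fraction of its size. -/
structure GrowStep (near : V → V → Prop) (D : ℕ) (src : ℕ → Bool) (ℓ ℓ' w : V → Option ℕ)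
    (acc : ℕ → Bool) : Prop where
  sound : ∀ v y, w v = some y → ∃ u, ℓ u = some y ∧ src y = true ∧ near u v
  complete : ∀ u v x, ℓ u = some x → src x = true → near u v → w v ≠ none
  acc_iff : ∀ v y, w v = some y →
    (acc y = true ↔ (members ℓ y).card ≤ D * (proposers src ℓ w y).card)
  relabel_eq : ∀ v, ℓ' v = relabel src acc (ℓ v) (w v)

/-- Some node with a label that is not a source is near the cluster `y`. -/
def Threatened (near : V → V → Prop) (src : ℕ → Bool) (ℓ : V → Option ℕ) (y : ℕ) : Prop :=
  ∃ u v x, ℓ u = some y ∧ ℓ v = some x ∧ src x = false ∧ near u v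

open Classical in
/-- The nodes that still have a label. -/
noncomputable def labelled (ℓ : V → Option ℕ) : Finset V :=
  Finset.univ.filter fun v => ℓ v ≠ none

open Classical in
/-- The nodes in source clusters that cannot grow any more. -/
noncomputable def settled (near : V → V → Prop) (src : ℕ → Bool) (ℓ : V → Option ℕ) : Finset V :=
  Finset.univ.filter fun v => ∃ y, ℓ v = some y ∧ src y = true ∧ ¬ Threatened near src ℓ y

namespace GrowStep

variable {near : V → V → Prop} {D : ℕ} {src acc : ℕ → Bool} {ℓ ℓ' w : V → Option ℕ}

theorem keep (h : GrowStep near D src ℓ ℓ' w acc) {v : V} {y : ℕ} (hv : ℓ v = some y)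
    (hy : src y = true) : ℓ' v = some y := by
  simp [h.relabel_eq, relabel, hv, hy]

theorem labelled_of (h : GrowStep near D src ℓ ℓ' w acc) {v : V} (hv : ℓ' v ≠ none) :
    ℓ v ≠ none := by
  intro h0
  simp [h.relabel_eq, relabel, h0] at hv

/-- A label after the step is old, or comes from an accepting wave. -/
theorem cases (h : GrowStep near D src ℓ ℓ' w acc) {v : V} {y : ℕ} (hv : ℓ' v = some y) :
    (ℓ v = some y ∧ (src y = true ∨ w v = none)) ∨
      (acc y = true ∧ w v = some y ∧ ∃ x, ℓ v = some x ∧ src x = false) := by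
  rw [h.relabel_eq, relabel.eq_def] at hv
  split at hv
  · cases hv
  · rename_i x hx
    split_ifs at hv with h1
    · cases hv; exact .inl ⟨hx, .inl h1⟩
    · split at hv
      · rename_i hw
        cases hv; exact .inl ⟨hx, .inr hw⟩
      · rename_i z hw
        split_ifs at hv with h2
        cases hv
        exact .inr ⟨h2, hw, x, hx, by simpa using h1⟩

theorem of_not_src (h : GrowStep near D src ℓ ℓ' w acc) {v : V} {x : ℕ} (hv : ℓ' v = some x)
    (hx : src x = false) : ℓ v = some x ∧ w v = none := by
  rcases h.cases hv with ⟨h1, h2⟩ | ⟨-, h1, -⟩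
  · exact ⟨h1, h2.resolve_left (by simp [hx])⟩
  · obtain ⟨-, -, h2, -⟩ := h.sound v x h1
    simp [hx] at h2

theorem exists_label (h : GrowStep near D src ℓ ℓ' w acc) {v : V} {y : ℕ} (hv : ℓ' v = some y) :
    ∃ u, ℓ u = some y := by
  rcases h.cases hv with ⟨h1, -⟩ | ⟨-, h1, -⟩
  · exact ⟨v, h1⟩
  · obtain ⟨u, hu, -⟩ := h.sound v y h1
    exact ⟨u, hu⟩

theorem threatened_of_proposer (h : GrowStep near D src ℓ ℓ' w acc) {v : V} {x y : ℕ}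
    (hw : w v = some y) (hv : ℓ v = some x) (hx : src x = false) : Threatened near src ℓ y := by
  obtain ⟨u, hu, -, hn⟩ := h.sound v y hw
  exact ⟨u, v, x, hu, hv, hx, hn⟩

/-- A cluster that is not threatened, or does not accept, is the same and is not threatened
afterwards. -/
theorem not_threatened (h : GrowStep near D src ℓ ℓ' w acc) {y : ℕ} (hy : src y = true)
    (hn : ¬ Threatened near src ℓ y ∨ acc y = false) : ¬ Threatened near src ℓ' y := by
  rintro ⟨u, v, x, hu, hv, hx, huv⟩
  obtain ⟨hv', hw⟩ := h.of_not_src hv hx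
  rcases h.cases hu with ⟨h1, -⟩ | ⟨h1, h2, z, h3, h4⟩
  · exact h.complete u v y h1 hy huv hw
  · rcases hn with hn | hn
    · exact hn (h.threatened_of_proposer h2 h3 h4)
    · simp [hn] at h1

theorem card_growth (h : GrowStep near D src ℓ ℓ' w acc) {y : ℕ} (hy : src y = true)
    (ht : Threatened near src ℓ' y) :
    (D + 1) * (members ℓ y).card ≤ D * (members ℓ' y).card := by
  classical
  have hacc : acc y = true := by
    by_contra hc
    exact h.not_threatened hy (.inr (by simpa using hc)) ht
  -- The value `acc y` is tied to the sizes only if the wave `y` reached some node. Without such a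
  -- node the cluster gains no members and could not be threatened any more.
  have hprop : ∃ v, w v = some y := by
    by_contra hc
    push Not at hc
    refine h.not_threatened hy (.inl ?_) ht
    rintro ⟨u, v, x, hu, hv, hx, huv⟩
    obtain ⟨u', v', x', hu', hv', hx', hn'⟩ := ht
    obtain ⟨-, hw'⟩ := h.of_not_src hv' hx'
    rcases h.cases hu' with ⟨h1, -⟩ | ⟨-, h2, -⟩
    · exact h.complete u' v' y h1 hy hn' hw'
    · exact hc u' h2
  obtain ⟨v₀, hv₀⟩ := hprop
  have h1 := (h.acc_iff v₀ y hv₀).1 hacc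
  have hsub : members ℓ y ∪ proposers src ℓ w y ⊆ members ℓ' y := by
    intro v hv
    simp only [members, proposers, Finset.mem_union, Finset.mem_filter, Finset.mem_univ,
      true_and] at hv ⊢
    rcases hv with hv | ⟨hv, x, hx, hs⟩
    · exact h.keep hv hy
    · simp [h.relabel_eq, relabel, hx, hs, hv, hacc]
  have hdisj : Disjoint (members ℓ y) (proposers src ℓ w y) := by
    rw [Finset.disjoint_left]
    intro v hv hv'
    simp only [members, proposers, Finset.mem_filter, Finset.mem_univ, true_and] at hv hv'
    obtain ⟨-, x, hx, hs⟩ := hv'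
    rw [hv] at hx
    cases hx
    simp [hy] at hs
  have h2 := Finset.card_le_card hsub
  rw [Finset.card_union_of_disjoint hdisj] at h2
  nlinarith

/-- Few nodes lose their label, compared with the number of nodes that become settled. -/
theorem potential_le (h : GrowStep near D src ℓ ℓ' w acc) :
    D * (labelled ℓ).card + (settled near src ℓ).card ≤
      D * (labelled ℓ').card + (settled near src ℓ').card := by
  classical
  set K : Finset V := labelled ℓ \ labelled ℓ' with hK
  have hKmem : ∀ v ∈ K, ∃ x y, ℓ v = some x ∧ src x = false ∧ w v = some y ∧ acc y = false := by
    intro v hv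
    simp only [hK, labelled, Finset.mem_sdiff, Finset.mem_filter, Finset.mem_univ, true_and,
      not_not] at hv
    obtain ⟨h1, h2⟩ := hv
    obtain ⟨x, hx⟩ := Option.ne_none_iff_exists'.1 h1
    rw [h.relabel_eq, relabel.eq_def, hx] at h2
    simp only at h2
    split_ifs at h2 with h3
    split at h2
    · cases h2
    · rename_i y hy
      split_ifs at h2 with h4
      exact ⟨x, y, hx, by simpa using h3, hy, by simpa using h4⟩
  have hsub : labelled ℓ' ⊆ labelled ℓ := by
    intro v hv
    simp only [labelled, Finset.mem_filter, Finset.mem_univ, true_and] at hv ⊢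
    exact h.labelled_of hv
  have hcard : K.card + (labelled ℓ').card = (labelled ℓ).card :=
    Finset.card_sdiff_add_card_eq_card hsub
  -- The rejecting labels that cost some node its label. The default `0` plays no role, since every
  -- node of `K` was reached by a wave.
  set Y : Finset ℕ := K.image fun v => (w v).getD 0 with hY
  have hYmem : ∀ y ∈ Y, ∃ v x, ℓ v = some x ∧ src x = false ∧ w v = some y ∧ acc y = false := by
    intro y hy
    obtain ⟨v, hv, rfl⟩ := Finset.mem_image.1 hy
    obtain ⟨x, y, h1, h2, h3, h4⟩ := hKmem v hv
    exact ⟨v, x, h1, h2, by simp [h3], by simpa [h3] using h4⟩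
  have hK1 : K.card = ∑ y ∈ Y, (K.filter fun v => (w v).getD 0 = y).card :=
    Finset.card_eq_sum_card_image _ _
  have hK2 : ∀ y ∈ Y, D * (K.filter fun v => (w v).getD 0 = y).card ≤ (members ℓ y).card := by
    intro y hy
    obtain ⟨v, x, -, -, hw, ha⟩ := hYmem y hy
    have h1 : ¬ _ := mt (h.acc_iff v y hw).2 (by simp [ha])
    have h2 : (K.filter fun v => (w v).getD 0 = y) ⊆ proposers src ℓ w y := by
      intro u hu
      simp only [Finset.mem_filter] at hu
      obtain ⟨x', y', hx1, hx2, h3, -⟩ := hKmem u hu.1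
      have : y' = y := by simpa [h3] using hu.2
      subst this
      simp only [proposers, Finset.mem_filter, Finset.mem_univ, true_and]
      exact ⟨h3, x', hx1, hx2⟩
    have h3 := Nat.mul_le_mul_left D (Finset.card_le_card h2)
    omega
  have hdisj : ∀ y₁ ∈ Y, ∀ y₂ ∈ Y, y₁ ≠ y₂ → Disjoint (members ℓ y₁) (members ℓ y₂) := by
    intro y₁ _ y₂ _ hne
    rw [Finset.disjoint_left]
    intro v h1 h2
    simp only [members, Finset.mem_filter, Finset.mem_univ, true_and] at h1 h2
    rw [h1] at h2
    exact hne (by simpa using h2)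
  have hsrc : ∀ y ∈ Y, src y = true := by
    intro y hy
    obtain ⟨v, x, -, -, hw, -⟩ := hYmem y hy
    obtain ⟨-, -, h1, -⟩ := h.sound v y hw
    exact h1
  -- A rejecting source becomes settled with all its members. They were not settled before, because
  -- a proposer threatened them; so the gain is at least `D * K.card`.
  have hsettled : settled near src ℓ ∪ Y.biUnion (members ℓ) ⊆ settled near src ℓ' := by
    intro v hv
    simp only [Finset.mem_union, settled, Finset.mem_filter, Finset.mem_univ, true_and,
      Finset.mem_biUnion, members] at hv ⊢
    rcases hv with ⟨y, h1, h2, h3⟩ | ⟨y, h1, h2⟩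
    · exact ⟨y, h.keep h1 h2, h2, h.not_threatened h2 (.inl h3)⟩
    · obtain ⟨-, -, -, -, -, ha⟩ := hYmem y h1
      exact ⟨y, h.keep h2 (hsrc y h1), hsrc y h1, h.not_threatened (hsrc y h1) (.inr ha)⟩
  have hdisj' : Disjoint (settled near src ℓ) (Y.biUnion (members ℓ)) := by
    rw [Finset.disjoint_left]
    intro v h1 h2
    simp only [settled, Finset.mem_filter, Finset.mem_univ, true_and, Finset.mem_biUnion,
      members] at h1 h2
    obtain ⟨y, h1, -, h3⟩ := h1
    obtain ⟨z, hz, h2⟩ := h2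
    rw [h1] at h2
    cases h2
    obtain ⟨u, x, h5, h6, h7, -⟩ := hYmem y hz
    exact h3 (h.threatened_of_proposer h7 h5 h6)
  have h1 := Finset.card_le_card hsettled
  rw [Finset.card_union_of_disjoint hdisj', Finset.card_biUnion hdisj] at h1
  have h2 : D * K.card ≤ ∑ y ∈ Y, (members ℓ y).card := by
    rw [hK1, Finset.mul_sum]
    exact Finset.sum_le_sum hK2
  nlinarith

/-- This is the case of the last wave of a class, which extends the trees only. -/
theorem eq_of_forall_src (h : GrowStep near D src ℓ ℓ' w acc) (hsrc : ∀ x, src x = true) : ℓ' = ℓ := by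
  funext v
  rw [h.relabel_eq, relabel.eq_def]
  split
  · rename_i h0; rw [h0]
  · rename_i x hx; simp [hsrc, hx]

end GrowStep

/-- Labels of nodes near each other have the same last `i` bits. -/
def AgreeBits (near : V → V → Prop) (i : ℕ) (ℓ : V → Option ℕ) : Prop :=
  ∀ u v x y, ℓ u = some x → ℓ v = some y → near u v → ∀ j < i, x.testBit j = y.testBit j

/-- A node changes only to the label of a source near it, which already has the same low bits as its
old label. So no surviving node ever changes these bits. -/
theorem GrowStep.agreeBits {near : V → V → Prop} {D : ℕ} {src acc : ℕ → Bool}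
    {ℓ ℓ' w : V → Option ℕ} (h : GrowStep near D src ℓ ℓ' w acc) {i : ℕ}
    (ha : AgreeBits near i ℓ) : AgreeBits near i ℓ' := by
  have key : ∀ v y, ℓ' v = some y → ∃ x, ℓ v = some x ∧ ∀ j < i, x.testBit j = y.testBit j := by
    intro v y hv
    rcases h.cases hv with ⟨h1, -⟩ | ⟨-, h2, x, h3, -⟩
    · exact ⟨y, h1, fun _ _ => rfl⟩
    · obtain ⟨u, hu, -, hn⟩ := h.sound v y h2
      exact ⟨x, h3, fun j hj => (ha u v y x hu h3 hn j hj).symm⟩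
  intro u v x y hu hv huv j hj
  obtain ⟨x', hx', h1⟩ := key u x hu
  obtain ⟨y', hy', h2⟩ := key v y hv
  rw [← h1 j hj, ← h2 j hj]
  exact ha u v x' y' hx' hy' huv j hj

/-- The invariant after `t` steps of growing the clusters whose label has bit `i`, from the
labels `ℓ₀`. -/
structure GrowInv (near : V → V → Prop) (D i : ℕ) (ℓ₀ : V → Option ℕ) (t : ℕ)
    (ℓ : V → Option ℕ) : Prop where
  agree : AgreeBits near i ℓ
  labels : ∀ v x, ℓ v = some x → ∃ u, ℓ₀ u = some x
  potential : D * (labelled ℓ₀).card ≤ D * (labelled ℓ).card + (settled near (·.testBit i) ℓ).card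
  subset : labelled ℓ ⊆ labelled ℓ₀
  growth : ∀ y, y.testBit i = true → Threatened near (·.testBit i) ℓ y →
    (D + 1) ^ t ≤ D ^ t * (members ℓ y).card

theorem growInv_zero {near : V → V → Prop} {D i : ℕ} {ℓ₀ : V → Option ℕ}
    (h : AgreeBits near i ℓ₀) : GrowInv near D i ℓ₀ 0 ℓ₀ where
  agree := h
  labels v x hv := ⟨v, hv⟩
  potential := Nat.le_add_right _ _
  subset := subset_rfl
  growth y _ ht := by
    obtain ⟨u, -, -, hu, -⟩ := ht
    have : 0 < (members ℓ₀ y).card := Finset.card_pos.2 ⟨u, by simp [members, hu]⟩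
    simpa using this

theorem GrowInv.succ {near : V → V → Prop} {D i t : ℕ} {ℓ₀ ℓ ℓ' w : V → Option ℕ}
    {acc : ℕ → Bool} (h : GrowInv near D i ℓ₀ t ℓ)
    (hs : GrowStep near D (·.testBit i) ℓ ℓ' w acc) : GrowInv near D i ℓ₀ (t + 1) ℓ' where
  agree := hs.agreeBits h.agree
  labels v x hv := by
    obtain ⟨u, hu⟩ := hs.exists_label hv
    exact h.labels u x hu
  potential := h.potential.trans hs.potential_le
  subset := by
    refine subset_trans (fun v hv => ?_) h.subset
    simp only [labelled, Finset.mem_filter, Finset.mem_univ, true_and] at hv ⊢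
    exact hs.labelled_of hv
  growth y hy ht := by
    have h1 : Threatened near (·.testBit i) ℓ y := by
      by_contra hc
      exact hs.not_threatened hy (.inl hc) ht
    have h2 := h.growth y hy h1
    have h3 := hs.card_growth hy ht
    calc (D + 1) ^ (t + 1) = (D + 1) * (D + 1) ^ t := by ring
      _ ≤ (D + 1) * (D ^ t * (members ℓ y).card) := Nat.mul_le_mul_left _ h2
      _ = D ^ t * ((D + 1) * (members ℓ y).card) := by ring
      _ ≤ D ^ t * (D * (members ℓ' y).card) := Nat.mul_le_mul_left _ h3
      _ = D ^ (t + 1) * (members ℓ' y).card := by ring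

/-- A cluster still threatened after `t` steps would have more members than there are nodes. Hence
no label with bit `i` is left near a label without it. -/
theorem GrowInv.agree_succ {near : V → V → Prop} (hsymm : ∀ u v, near u v → near v u) {D i t : ℕ}
    {ℓ₀ ℓ : V → Option ℕ} (h : GrowInv near D i ℓ₀ t ℓ)
    (hD : D ^ t * Fintype.card V < (D + 1) ^ t) : AgreeBits near (i + 1) ℓ := by
  have hnt : ∀ y, y.testBit i = true → ¬ Threatened near (·.testBit i) ℓ y := by
    intro y hy ht
    have h1 := h.growth y hy ht
    have h2 : (members ℓ y).card ≤ Fintype.card V := Finset.card_le_univ _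
    have h3 := Nat.mul_le_mul_left (D ^ t) h2
    omega
  intro u v x y hu hv huv j hj
  rcases Nat.lt_succ_iff_lt_or_eq.1 hj with hj | rfl
  · exact h.agree u v x y hu hv huv j hj
  · rcases hx : x.testBit j with _ | _ <;> rcases hy : y.testBit j with _ | _
    · rfl
    · exact absurd ⟨v, u, x, hv, hu, hx, hsymm _ _ huv⟩ (hnt y hy)
    · exact absurd ⟨u, v, y, hu, hv, hy, huv⟩ (hnt x hx)
    · rfl

/-- The invariant after the bits below `i` have been processed, from the labels `ℓ₀`. -/
structure PhaseInv (near : V → V → Prop) (D : ℕ) (ℓ₀ : V → Option ℕ) (i : ℕ)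
    (ℓ : V → Option ℕ) : Prop where
  agree : AgreeBits near i ℓ
  labels : ∀ v x, ℓ v = some x → ∃ u, ℓ₀ u = some x
  subset : labelled ℓ ⊆ labelled ℓ₀
  card_le : D * (labelled ℓ₀).card ≤ D * (labelled ℓ).card + i * (labelled ℓ₀).card

theorem phaseInv_zero {near : V → V → Prop} {D : ℕ} (ℓ₀ : V → Option ℕ) :
    PhaseInv near D ℓ₀ 0 ℓ₀ where
  agree := by intro _ _ _ _ _ _ _ j hj; omega
  labels v x hv := ⟨v, hv⟩
  subset := subset_rfl
  card_le := Nat.le_add_right _ _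

theorem PhaseInv.succ {near : V → V → Prop} (hsymm : ∀ u v, near u v → near v u) {D i t : ℕ}
    {ℓ₀ ℓ ℓ' : V → Option ℕ} (h : PhaseInv near D ℓ₀ i ℓ) (hg : GrowInv near D i ℓ t ℓ')
    (hD : D ^ t * Fintype.card V < (D + 1) ^ t) : PhaseInv near D ℓ₀ (i + 1) ℓ' where
  agree := hg.agree_succ hsymm hD
  labels v x hv := by
    obtain ⟨u, hu⟩ := hg.labels v x hv
    exact h.labels u x hu
  subset := hg.subset.trans h.subset
  card_le := by
    -- By the potential, `D` times the loss for this bit is at most the number of settled nodes, and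
    -- these are among the initially labelled ones.
    have h1 : (settled near (·.testBit i) ℓ').card ≤ (labelled ℓ₀).card := by
      refine Finset.card_le_card (subset_trans (fun v hv => ?_) (hg.subset.trans h.subset))
      simp only [labelled, settled, Finset.mem_filter, Finset.mem_univ, true_and] at hv ⊢
      obtain ⟨y, hy, -⟩ := hv
      simp [hy]
    have h2 := h.card_le
    have h3 := hg.potential
    nlinarith

theorem PhaseInv.eq_of_near {near : V → V → Prop} {D B : ℕ} {ℓ₀ ℓ : V → Option ℕ}
    (h : PhaseInv near D ℓ₀ B ℓ) (hB : ∀ v x, ℓ₀ v = some x → x < 2 ^ B) {u v : V} {x y : ℕ}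
    (hu : ℓ u = some x) (hv : ℓ v = some y) (huv : near u v) : x = y := by
  obtain ⟨u', hu'⟩ := h.labels u x hu
  obtain ⟨v', hv'⟩ := h.labels v y hv
  apply Nat.eq_of_testBit_eq
  intro j
  by_cases hj : j < B
  · exact h.agree u v x y hu hv huv j hj
  · have hp : 2 ^ B ≤ 2 ^ j := Nat.pow_le_pow_right (by norm_num) (by omega)
    rw [Nat.testBit_lt_two_pow ((hB u' x hu').trans_le hp),
      Nat.testBit_lt_two_pow ((hB v' y hv').trans_le hp)]

/-- Each of the `B` bits costs at most a `1 / (2 * B)` fraction of the initial nodes. -/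
theorem PhaseInv.half_le {near : V → V → Prop} {B : ℕ} (hB : 0 < B) {ℓ₀ ℓ : V → Option ℕ}
    (h : PhaseInv near (2 * B) ℓ₀ B ℓ) : (labelled ℓ₀).card ≤ 2 * (labelled ℓ).card := by
  have h1 := h.card_le
  have h2 : B * (labelled ℓ₀).card ≤ B * (2 * (labelled ℓ).card) := by nlinarith
  exact Nat.le_of_mul_le_mul_left h2 hB

end Growth

/-- Growing by a factor `1 + 1 / D` for `D * L` steps exceeds `2 ^ L`. -/
theorem pow_mul_two_pow_le (D L : ℕ) (hD : 0 < D) : D ^ (D * L) * 2 ^ L ≤ (D + 1) ^ (D * L) := by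
  have h : 2 * D ^ D ≤ (D + 1) ^ D := by
    -- The last two terms of the binomial expansion, each equal to `D ^ D`.
    have h1 : D ^ D + D * D ^ (D - 1) ≤ (D + 1) ^ D := by
      rw [add_pow, ← Finset.sum_filter_add_sum_filter_not _ (fun i => D - 1 ≤ i)]
      refine le_trans ?_ (Nat.le_add_right _ _)
      have : ((Finset.range (D + 1)).filter fun i => D - 1 ≤ i) = {D - 1, D} := by
        ext i; simp; omega
      rw [this, Finset.sum_pair (by omega)]
      have hc : D.choose (D - 1) = D := by
        rw [Nat.choose_symm_of_eq_add (b := 1) (by omega)]; simp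
      simp [hc]
      nlinarith
    have h2 : D * D ^ (D - 1) = D ^ D := by
      rw [← pow_succ']; congr 1; omega
    omega
  calc D ^ (D * L) * 2 ^ L = (2 * D ^ D) ^ L := by rw [mul_pow, pow_mul]; ring
    _ ≤ ((D + 1) ^ D) ^ L := Nat.pow_le_pow_left h L
    _ = (D + 1) ^ (D * L) := by rw [pow_mul]

/-! ### The state of the cover algorithm -/

/-- The local state. For every label `x`, `tree x` is `none` outside the tree of `x`, and otherwise
the time at which the node was added to the tree and its parent port. In the hop of a wave at time
`t` the node sent `sent t` and adopted `got t`. -/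
structure CoverState where
  id : ℕ
  deg : ℕ
  uncovered : Bool
  label : Option ℕ
  wave : Option ℕ
  tree : ℕ → Option (ℕ × Option ℕ)
  got : ℕ → Option ℕ
  sent : ℕ → Option ℕ
  acc : ℕ → ℕ × ℕ
  dec : ℕ → Bool

namespace CoverState

/-- Start a wave from the nodes whose label is a source. -/
def startWave (src : ℕ → Bool) (s : CoverState) : CoverState :=
  { s with wave := s.label.filter src }

/-- The update of a node in a hop at time `t` in which it adopts `a`. -/
def afterHop (t : ℕ) (s : CoverState) (a : Option (ℕ × ℕ)) : CoverState :=
  { s with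
    wave := s.wave.or (a.map Prod.snd)
    got := Function.update s.got t (a.map Prod.snd)
    sent := Function.update s.sent t s.wave
    -- A node that adopts the label of a tree containing it keeps its old parent. The shift to `t +
    -- 1` reserves time `0` for the roots.
    tree := fun x => (s.tree x).or ((a.filter fun q => q.2 == x).map fun q => (t + 1, some q.1)) }

/-- The hop of a wave at time `t`. -/
noncomputable def hop (t : ℕ) : Instr CoverState (ℕ × ℕ) where
  send s _ := (labelMsg s.wave, 0)
  step s r := s.afterHop t (adopt s.wave fun p => (r p).map Prod.fst)

/-- Prepare counting the proposals to a label and the nodes with this label. -/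
def startCount (src : ℕ → Bool) (s : CoverState) : CoverState :=
  { s with acc := fun x =>
      (if s.wave = some x ∧ s.label.any (fun y => !src y) then 1 else 0,
        if s.label = some x then 1 else 0) }

/-- The message through port `q` when the nodes added at time `t + 1` report to their parents. -/
def report (t : ℕ) (s : CoverState) (q : ℕ) : ℕ × ℕ :=
  match s.got t with
  | some x => if s.tree x = some (t + 1, some q) then s.acc x else 0
  | none => 0

/-- The nodes added at time `t + 1` report to their parents. -/
def collect (t : ℕ) : Instr CoverState (ℕ × ℕ) where
  send s q := s.report t q
  step s r :=
    { s with acc := fun x =>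
        if s.sent t = some x then s.acc x + ∑ p ∈ Finset.range s.deg, (r p).getD 0
        else s.acc x }

/-- A label accepts if the proposals are at least a `1 / D` fraction of its size. -/
def judge (D : ℕ) (s : CoverState) : CoverState :=
  { s with dec := fun x => decide ((s.acc x).2 ≤ D * (s.acc x).1) }

/-- The nodes added at time `t + 1` learn the decision from their parents. -/
def spread (t : ℕ) : Instr CoverState (ℕ × ℕ) where
  send s _ := (if s.sent t |>.any s.dec then 1 else 0, 0)
  step s r :=
    { s with dec := fun x =>
        match s.tree x with
        | some (b, some p) => if b = t + 1 then decide (r p = some (1, 0)) else s.dec x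
        | _ => s.dec x }

/-- Change the labels according to the decisions. -/
def update (src : ℕ → Bool) (s : CoverState) : CoverState :=
  { s with label := relabel src s.dec s.label s.wave }

/-- One step of cluster growing with waves of `h` hops, from time `τ` on. -/
noncomputable def grow (D h : ℕ) (src : ℕ → Bool) (τ : ℕ) : List (Instr CoverState (ℕ × ℕ)) :=
  [Instr.localStep (startWave src)] ++ ((List.range h).flatMap fun j => [hop (τ + j)]) ++
  [Instr.localStep (startCount src)] ++
  -- All times since the beginning are replayed, because a tree contains edges from earlier waves:
  -- backwards here, so that children report before their parents, and forwards in `spread`.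
  ((List.range (τ + h)).flatMap fun i => [collect (τ + h - 1 - i)]) ++
  [Instr.localStep (judge D)] ++ ((List.range (τ + h)).flatMap fun t => [spread t]) ++
  [Instr.localStep (update src)]

theorem length_grow (D h : ℕ) (src : ℕ → Bool) (τ : ℕ) :
    (grow D h src τ).length = 3 * h + 2 * τ + 4 := by
  simp [grow]; ring

end CoverState

open CoverState

/-- The trees stored at time `τ` are consistent. -/
structure TreeInv {V : Type} (N : Network V) (τ : ℕ) (c : V → CoverState) : Prop where
  id_eq : ∀ v, (c v).id = N.id v
  deg_eq : ∀ v, (c v).deg = N.deg v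
  root : ∀ v, (c v).tree (N.id v) = some (0, none)
  eq_root : ∀ v x b, (c v).tree x = some (b, none) → x = N.id v
  parent : ∀ v x b p, (c v).tree x = some (b, some p) →
    ∃ (hp : p < N.deg v) (t b' : ℕ) (q : Option ℕ), b = t + 1 ∧ t < τ ∧ (c v).got t = some x ∧
      (c (N.port v ⟨p, hp⟩)).sent t = some x ∧
      (c (N.port v ⟨p, hp⟩)).tree x = some (b', q) ∧ b' ≤ t
  label_mem : ∀ v x, (c v).label = some x → (c v).tree x ≠ none

namespace TreeInv

variable {V : Type} {N : Network V} {τ : ℕ} {c : V → CoverState}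

theorem root_time (h : TreeInv N τ c) {v : V} {x b : ℕ} (hv : (c v).tree x = some (b, none)) :
    x = N.id v ∧ b = 0 := by
  have h1 := h.eq_root v x b hv
  subst h1
  rw [h.root v] at hv
  simp at hv
  exact ⟨rfl, hv.symm⟩

theorem time_le (h : TreeInv N τ c) {v : V} {x b : ℕ} {q : Option ℕ}
    (hv : (c v).tree x = some (b, q)) : b ≤ τ := by
  rcases q with _ | p
  · rw [(h.root_time hv).2]; omega
  · obtain ⟨_, t, _, _, rfl, ht, -⟩ := h.parent v x b p hv
    omega

/-- The parents have ever smaller times, so they lead to a root. Every label in circulation is thus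
an identifier and fits into a message. -/
theorem exists_root (h : TreeInv N τ c) {v : V} {x : ℕ} (hv : (c v).tree x ≠ none) :
    ∃ r, N.id r = x := by
  obtain ⟨⟨b, q⟩, hb⟩ := Option.ne_none_iff_exists'.1 hv
  induction b using Nat.strong_induction_on generalizing v q with
  | _ b ih =>
    rcases q with _ | p
    · exact ⟨v, (h.eq_root v x b hb).symm⟩
    · obtain ⟨hp, t, b', q, rfl, -, -, -, h1, h2⟩ := h.parent v x b p hb
      exact ih b' (by omega) (by simp [h1]) q h1

theorem congr (h : TreeInv N τ c) {c' : V → CoverState} (h1 : ∀ v, (c' v).id = (c v).id)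
    (h2 : ∀ v, (c' v).deg = (c v).deg) (h3 : ∀ v, (c' v).tree = (c v).tree)
    (h4 : ∀ v, (c' v).got = (c v).got) (h5 : ∀ v, (c' v).sent = (c v).sent)
    (h6 : ∀ v x, (c' v).label = some x → (c v).tree x ≠ none) : TreeInv N τ c' where
  id_eq v := (h1 v).trans (h.id_eq v)
  deg_eq v := (h2 v).trans (h.deg_eq v)
  root v := by rw [h3, h.root]
  eq_root v x b := by rw [h3]; exact h.eq_root v x b
  parent v x b p := by simp only [h3, h4, h5]; exact h.parent v x b p
  label_mem v x hx := by rw [h3]; exact h6 v x hx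

end TreeInv

theorem Network.inbox_map {V μ ν : Type} (N : Network V) (f : μ → ν) (snd : V → ℕ → μ) (v : V) :
    (fun p => (N.inbox snd v p).map f) = N.inbox (fun u q => f (snd u q)) v := by
  funext p
  unfold Network.inbox
  split_ifs <;> rfl

/-- The invariant after `j` hops of a wave started at time `τ` in the configuration `c₀`. -/
structure WaveInv {V : Type} (N : Network V) (src : ℕ → Bool) (c₀ : V → CoverState) (τ j : ℕ)
    (c : V → CoverState) : Prop where
  tree : TreeInv N (τ + j) c
  label_eq : ∀ v, (c v).label = (c₀ v).label
  uncovered_eq : ∀ v, (c v).uncovered = (c₀ v).uncovered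
  mono : ∀ v x, (c₀ v).tree x ≠ none → (c v).tree x ≠ none
  new : ∀ v x, (c v).tree x ≠ none → (c₀ v).tree x ≠ none ∨ (c v).wave = some x
  wave_mem : ∀ v x, (c v).wave = some x → (c v).tree x ≠ none
  spec : WaveSpec N.graph (fun u x => (c₀ u).label = some x ∧ src x = true) j fun v => (c v).wave

section Wave

variable {V : Type} {N : Network V} {src : ℕ → Bool} {c₀ c : V → CoverState} {τ j : ℕ}

theorem waveInv_zero (h : TreeInv N τ c₀) :
    WaveInv N src c₀ τ 0 fun v => (c₀ v).startWave src where
  tree := h.congr (fun _ => rfl) (fun _ => rfl) (fun _ => rfl) (fun _ => rfl) (fun _ => rfl)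
    h.label_mem
  label_eq _ := rfl
  uncovered_eq _ := rfl
  mono _ _ := id
  new _ _ := Or.inl
  wave_mem v x hx := by
    simp only [startWave, Option.filter_eq_some_iff] at hx
    exact h.label_mem v x hx.1
  spec := by
    refine ⟨fun v x hx => ?_, fun i hi u v x hu huv => ?_⟩
    · simp only [startWave, Option.filter_eq_some_iff] at hx
      exact ⟨v, hx, .refl v⟩
    · obtain rfl : i = 0 := by omega
      obtain rfl := near_zero.1 huv
      refine ⟨u, x, ?_, hu, .refl u⟩
      simp only [startWave, Option.filter_eq_some_iff]
      exact hu

theorem runInstr_hop (t : ℕ) (v : V) :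
    N.runInstr (hop t) c v = (c v).afterHop t
      (adopt (c v).wave (N.inbox (fun u _ => labelMsg (c u).wave) v)) := by
  simp only [Network.runInstr, hop, Network.inbox_map]

theorem afterHop_tree_of_ne_none {s : CoverState} {t x : ℕ} {a : Option (ℕ × ℕ)}
    (h : s.tree x ≠ none) : (s.afterHop t a).tree x = s.tree x := by
  obtain ⟨y, hy⟩ := Option.ne_none_iff_exists'.1 h
  simp [afterHop, hy]

theorem afterHop_tree_eq {s : CoverState} {t x b : ℕ} {q : Option ℕ} {a : Option (ℕ × ℕ)}
    (h : (s.afterHop t a).tree x = some (b, q)) :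
    s.tree x = some (b, q) ∨ ∃ p, a = some (p, x) ∧ b = t + 1 ∧ q = some p := by
  rcases hx : s.tree x with _ | y
  · right
    simp only [afterHop, hx, Option.none_or, Option.map_eq_some_iff, Option.filter_eq_some_iff] at h
    obtain ⟨⟨p, z⟩, ⟨h1, h2⟩, h3⟩ := h
    simp only [beq_iff_eq] at h2
    subst h2
    simp only [Prod.mk.injEq] at h3
    exact ⟨p, h1, h3.1.symm, h3.2.symm⟩
  · left
    rw [afterHop_tree_of_ne_none (by simp [hx]), hx] at h
    exact h

/-- The time `τ + j` is fresh, so the records of `got` and `sent` to which older tree edges refer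
are not overwritten. A new edge leads to a neighbor that held the label before this hop and is
therefore in the tree since time `τ + j` at the latest. -/
theorem WaveInv.hop (h : WaveInv N src c₀ τ j c) :
    WaveInv N src c₀ τ (j + 1) (N.runInstr (hop (τ + j)) c) := by
  set a : V → Option (ℕ × ℕ) := fun v =>
    adopt (c v).wave (N.inbox (fun u _ => labelMsg (c u).wave) v) with ha
  have hrun : N.runInstr (CoverState.hop (τ + j)) c = fun v => (c v).afterHop (τ + j) (a v) :=
    funext fun v => runInstr_hop _ v
  rw [hrun]
  have hadopt : ∀ v p x, a v = some (p, x) →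
      (c v).wave = none ∧ ∃ hp : p < N.deg v, (c (N.port v ⟨p, hp⟩)).wave = some x :=
    fun v p x hv => adopt_eq_some (w := fun v => (c v).wave) hv
  have hkeep : ∀ v x, (c v).tree x ≠ none → ((c v).afterHop (τ + j) (a v)).tree x ≠ none :=
    fun v x hx => by rwa [afterHop_tree_of_ne_none hx]
  refine ⟨⟨fun v => h.tree.id_eq v, fun v => h.tree.deg_eq v, fun v => ?_, fun v x b hb => ?_,
    fun v x b p hb => ?_, fun v x hx => hkeep v x (h.tree.label_mem v x hx)⟩,
    fun v => h.label_eq v, fun v => h.uncovered_eq v, fun v x hx => hkeep v x (h.mono v x hx),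
    fun v x hx => ?_, fun v x hx => ?_, ?_⟩
  · rw [afterHop_tree_of_ne_none (by simp [h.tree.root]), h.tree.root]
  · rcases afterHop_tree_eq hb with h1 | ⟨p, -, -, h1⟩
    · exact h.tree.eq_root v x b h1
    · cases h1
  · rcases afterHop_tree_eq hb with h1 | ⟨p', h1, h2, h3⟩
    · obtain ⟨hp, t, b', q, h2, h3, h4, h5, h6, h7⟩ := h.tree.parent v x b p h1
      refine ⟨hp, t, b', q, h2, by omega, ?_, ?_, ?_, h7⟩
      · simp only [afterHop]
        rwa [Function.update_of_ne (by omega)]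
      · simp only [afterHop]
        rwa [Function.update_of_ne (by omega)]
      · rwa [afterHop_tree_of_ne_none (by simp [h6])]
    · cases h3
      obtain ⟨-, hp, hw⟩ := hadopt v p x h1
      obtain ⟨⟨b', q⟩, hb'⟩ := Option.ne_none_iff_exists'.1 (h.wave_mem _ _ hw)
      refine ⟨hp, τ + j, b', q, h2, by omega, ?_, ?_, ?_, h.tree.time_le hb'⟩
      · simp [afterHop, h1]
      · simp [afterHop, hw]
      · rwa [afterHop_tree_of_ne_none (by simp [hb'])]
  · obtain ⟨⟨b, q⟩, hb⟩ := Option.ne_none_iff_exists'.1 hx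
    rcases afterHop_tree_eq hb with h1 | ⟨p, h1, -, -⟩
    · exact (h.new v x (by simp [h1])).imp_right fun h2 => by simp [afterHop, h2]
    · right
      simp [afterHop, (hadopt v p x h1).1, h1]
  · rcases hw : (c v).wave with _ | y
    · simp only [afterHop, hw, Option.none_or, Option.map_eq_some_iff] at hx
      obtain ⟨⟨p, z⟩, h1, rfl⟩ := hx
      rcases hz : (c v).tree z with _ | y
      · simp [afterHop, hz, h1]
      · exact hkeep v z (by simp [hz])
    · obtain rfl : y = x := by simpa [afterHop, hw] using hx
      exact hkeep v y (h.wave_mem v y hw)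
  · exact h.spec.hop waveHop_adopt

end Wave

/-! ### Counting over the trees -/

theorem Network.sum_inbox {V α : Type} [Fintype V] [AddCommMonoid α] (N : Network V)
    (snd : V → ℕ → α) (v : V) :
    ∑ p ∈ Finset.range (N.deg v), (N.inbox snd v p).getD 0 =
      ∑ u : V, open Classical in
        if h : N.graph.Adj u v then snd u ((N.port u).symm ⟨v, h⟩ : Fin _) else 0 := by
  classical
  rw [Finset.sum_range]
  let g : N.graph.neighborSet v → α := fun u => snd u ((N.port u).symm ⟨v, u.2.symm⟩ : Fin _)
  have h1 : ∀ p : Fin (N.deg v), (N.inbox snd v p).getD 0 = g (N.port v p) := by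
    intro p
    simp [Network.inbox, g]
  refine (Fintype.sum_equiv (N.port v) _ g h1).trans ?_
  symm
  refine (Finset.sum_subset (Finset.subset_univ
    (Finset.univ.filter fun u => u ∈ N.graph.neighborSet v)) ?_).symm.trans ?_
  · intro u _ hu
    rw [dif_neg]
    intro h
    exact hu (by simpa using h.symm)
  · rw [← Finset.sum_subtype_eq_sum_filter, Finset.subtype_univ]
    refine Finset.sum_congr rfl fun u _ => ?_
    rw [dif_pos (show N.graph.Adj u v from u.2.symm)]

/-- A configuration with other counters and decisions. -/
def withAux {V : Type} (c : V → CoverState) (a : V → ℕ → ℕ × ℕ) (d : V → ℕ → Bool) (v : V) :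
    CoverState :=
  { c v with acc := a v, dec := d v }

/-- The node is in the tree of `x` since time `t`. -/
def BornBy (s : CoverState) (x t : ℕ) : Prop := ∃ b q, s.tree x = some (b, q) ∧ b ≤ t

/-- `v` is the parent of `u` in the tree of `x`, to which `u` was added at time `t + 1`. -/
def ParentAt {V : Type} (N : Network V) (c : V → CoverState) (t x : ℕ) (u v : V) : Prop :=
  ∃ (q : ℕ) (hq : q < N.deg u), (c u).tree x = some (t + 1, some q) ∧ (N.port u ⟨q, hq⟩ : V) = v

section Count

variable {V : Type} {N : Network V} {τ : ℕ} {c : V → CoverState}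

theorem TreeInv.parentAt (h : TreeInv N τ c) {t x : ℕ} {u v : V} (hp : ParentAt N c t x u v) :
    (c u).got t = some x ∧ (c v).sent t = some x ∧ BornBy (c v) x t := by
  obtain ⟨q, hq, h1, rfl⟩ := hp
  obtain ⟨hq', t', b', q', h2, -, h3, h4, h5, h6⟩ := h.parent u x _ q h1
  obtain rfl : t = t' := by omega
  exact ⟨h3, h4, b', q', h5, h6⟩

theorem TreeInv.existsUnique_parentAt (h : TreeInv N τ c) {t x : ℕ} {u : V} {q : Option ℕ}
    (hu : (c u).tree x = some (t + 1, q)) : ∃ v, ∀ v', ParentAt N c t x u v' ↔ v' = v := by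
  rcases q with _ | q
  · have := (h.root_time hu).2
    omega
  · obtain ⟨hq, -⟩ := h.parent u x _ q hu
    refine ⟨N.port u ⟨q, hq⟩, fun v' => ⟨?_, ?_⟩⟩
    · rintro ⟨q', hq', h1, rfl⟩
      rw [hu] at h1
      obtain rfl : q = q' := by simpa using h1
      rfl
    · rintro rfl
      exact ⟨q, hq, hu, rfl⟩

open Classical in
-- At time `t` the node `v` sent no label but `x`, so whoever chose `v` as its parent at that time
-- did so in the tree of `x`. The messages need not name the tree.
theorem TreeInv.report_eq (h : TreeInv N τ c) {a : V → ℕ → ℕ × ℕ} {d : V → ℕ → Bool} {t x : ℕ}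
    {u v : V} (hs : (c v).sent t = some x) (hadj : N.graph.Adj u v) :
    (withAux c a d u).report t ((N.port u).symm ⟨v, hadj⟩ : Fin _) =
      if ParentAt N c t x u v then a u x else 0 := by
  have hback := fun q => N.backPort_eq_iff hadj q
  split_ifs with hp
  · have h1 := (h.parentAt hp).1
    obtain ⟨q, hq, h2, h3⟩ := hp
    have h4 := (hback q).2 ⟨hq, h3⟩
    simp [report, withAux, h1, h4, h2]
  · rcases hg : (c u).got t with _ | y
    · simp [report, withAux, hg]
    · simp only [report, withAux, hg]
      refine if_neg ?_
      intro h1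
      obtain ⟨hq, he⟩ := (hback _).1 rfl
      have hp' : ParentAt N c t y u v := ⟨_, hq, h1, he⟩
      have h2 := (h.parentAt hp').2.1
      rw [hs] at h2
      cases h2
      exact hp hp'

open Classical in
theorem runInstr_collect [Fintype V] (h : TreeInv N τ c) (a : V → ℕ → ℕ × ℕ) (d : V → ℕ → Bool) (t : ℕ) :
    N.runInstr (collect t) (withAux c a d) = withAux c
      (fun v x => a v x + ∑ u, if ParentAt N c t x u v then a u x else 0) d := by
  funext v
  simp only [Network.runInstr, collect, withAux, CoverState.mk.injEq, true_and, and_true]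
  funext x
  split_ifs with hs
  · congr 1
    rw [h.deg_eq, N.sum_inbox]
    refine Finset.sum_congr rfl fun u _ => ?_
    by_cases hadj : N.graph.Adj u v
    · rw [dif_pos hadj]
      exact h.report_eq hs hadj
    · rw [dif_neg hadj, if_neg]
      rintro ⟨q, hq, -, rfl⟩
      exact hadj (N.port u ⟨q, hq⟩).2
  · rw [Finset.sum_eq_zero, add_zero]
    intro u _
    rw [if_neg]
    exact fun hp => hs (h.parentAt hp).2.1

open Classical in
-- A node added at time `t + 1` has exactly one parent, which was in the tree by time `t`. Its
-- counter moves there without changing the total. Reported counters are not erased; their owners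
-- just drop out of the sum.
theorem TreeInv.sum_collect [Fintype V] (h : TreeInv N τ c) (a : V → ℕ × ℕ) (t x : ℕ) :
    (∑ v, if BornBy (c v) x t then a v + ∑ u, if ParentAt N c t x u v then a u else 0 else 0) =
      ∑ v, if BornBy (c v) x (t + 1) then a v else 0 := by
  have h1 : ∀ v, (if BornBy (c v) x t then
      a v + ∑ u, if ParentAt N c t x u v then a u else 0 else 0) =
      (if BornBy (c v) x t then a v else 0) + ∑ u, if ParentAt N c t x u v then a u else 0 := by
    intro v
    split_ifs with hb
    · rfl
    · rw [Finset.sum_eq_zero, add_zero]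
      intro u _
      rw [if_neg]
      exact fun hp => hb (h.parentAt hp).2.2
  rw [Finset.sum_congr rfl fun v _ => h1 v, Finset.sum_add_distrib, Finset.sum_comm,
    ← Finset.sum_add_distrib]
  refine Finset.sum_congr rfl fun u _ => ?_
  by_cases hx : ∃ q, (c u).tree x = some (t + 1, q)
  · obtain ⟨q, hq⟩ := hx
    obtain ⟨v, hv⟩ := h.existsUnique_parentAt hq
    have h2 : ¬ BornBy (c u) x t := by
      rintro ⟨b, q', h3, h4⟩
      rw [hq] at h3
      simp at h3
      omega
    have h3 : BornBy (c u) x (t + 1) := ⟨_, _, hq, le_rfl⟩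
    simp [h2, h3, hv]
  · have h2 : BornBy (c u) x (t + 1) ↔ BornBy (c u) x t := by
      constructor
      · rintro ⟨b, q, h3, h4⟩
        refine ⟨b, q, h3, ?_⟩
        by_contra h5
        obtain rfl : b = t + 1 := by omega
        exact hx ⟨q, h3⟩
      · rintro ⟨b, q, h3, h4⟩
        exact ⟨b, q, h3, by omega⟩
    rw [Finset.sum_eq_zero, add_zero]
    · simp [h2]
    · intro v _
      rw [if_neg]
      rintro ⟨q, -, h3, -⟩
      exact hx ⟨_, h3⟩

theorem TreeInv.bornBy_iff (h : TreeInv N τ c) (v : V) (x : ℕ) :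
    BornBy (c v) x τ ↔ (c v).tree x ≠ none := by
  constructor
  · rintro ⟨b, q, h1, -⟩
    simp [h1]
  · intro h1
    obtain ⟨⟨b, q⟩, hb⟩ := Option.ne_none_iff_exists'.1 h1
    exact ⟨b, q, hb, h.time_le hb⟩

theorem TreeInv.bornBy_zero_iff (h : TreeInv N τ c) (v : V) (x : ℕ) :
    BornBy (c v) x 0 ↔ x = N.id v := by
  constructor
  · rintro ⟨b, q, h1, h2⟩
    rcases q with _ | p
    · exact (h.root_time h1).1
    · obtain ⟨-, t, -, -, h3, -⟩ := h.parent v x b p h1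
      omega
  · rintro rfl
    exact ⟨0, none, h.root v, le_rfl⟩

/-- The messages: pairs of numbers below `m`. -/
def pairMsgs (m : ℕ) : Finset (ℕ × ℕ) := Finset.range m ×ˢ Finset.range m

theorem zero_mem_pairMsgs {m : ℕ} (hm : 0 < m) : (0 : ℕ × ℕ) ∈ (pairMsgs m : Set (ℕ × ℕ)) := by
  simpa [pairMsgs] using hm

open Classical in
/-- The counters of the nodes added up to time `t` have the sum `total`. -/
def CountInv [Fintype V] (c : V → CoverState) (d : V → ℕ → Bool) (total : ℕ → ℕ × ℕ) (t : ℕ)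
    (c' : V → CoverState) : Prop :=
  ∃ a, c' = withAux c a d ∧ ∀ x, (∑ v, if BornBy (c v) x t then a v x else 0) = total x

theorem triple_collect [Fintype V] (h : TreeInv N τ c) {m : ℕ} {total : ℕ → ℕ × ℕ}
    (hm : ∀ x, total x ∈ pairMsgs m) (d : V → ℕ → Bool) (t : ℕ) :
    N.Triple (pairMsgs m : Set (ℕ × ℕ)) (CountInv c d total (t + 1)) [collect t]
      (CountInv c d total t) := by
  classical
  refine Network.Triple.single ?_ ?_
  · rintro _ ⟨a, rfl, ha⟩ v q
    have h0 : (0 : ℕ × ℕ) ∈ (pairMsgs m : Set (ℕ × ℕ)) := by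
      apply zero_mem_pairMsgs
      have := hm 0
      simp only [pairMsgs, Finset.mem_product, Finset.mem_range] at this
      omega
    simp only [collect, report, withAux]
    split
    · rename_i x hx
      split_ifs with hq
      · have h1 : BornBy (c v) x (t + 1) := ⟨_, _, hq, le_rfl⟩
        -- A partial sum over a subtree is bounded by the total, as all counters are nonnegative; so
        -- the message is in range.
        have h2 : a v x ≤ total x := by
          rw [← ha x]
          have := Finset.single_le_sum (f := fun v => if BornBy (c v) x (t + 1) then a v x else 0)
            (fun _ _ => zero_le) (Finset.mem_univ v)
          simpa [h1] using this
        have h3 := hm x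
        simp only [pairMsgs, Finset.mem_product, Finset.mem_range, Finset.mem_coe] at h3 ⊢
        exact ⟨h2.1.trans_lt h3.1, h2.2.trans_lt h3.2⟩
      · exact h0
    · exact h0
  · rintro _ ⟨a, rfl, ha⟩
    refine ⟨_, runInstr_collect h a d t, fun x => ?_⟩
    rw [← ha x]
    exact h.sum_collect (fun v => a v x) t x

theorem triple_collect_all [Fintype V] (h : TreeInv N τ c) {m : ℕ} {total : ℕ → ℕ × ℕ}
    (hm : ∀ x, total x ∈ pairMsgs m) (d : V → ℕ → Bool) :
    N.Triple (pairMsgs m : Set (ℕ × ℕ)) (CountInv c d total τ)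
      ((List.range τ).flatMap fun i => [collect (τ - 1 - i)]) (CountInv c d total 0) := by
  have := Network.Triple.range (N := N) (M := (pairMsgs m : Set (ℕ × ℕ)))
    (Inv := fun i => CountInv c d total (τ - i)) (f := fun i => [collect (τ - 1 - i)]) τ
    (fun i hi => by
      have := triple_collect h hm d (τ - 1 - i)
      have e1 : τ - i = τ - 1 - i + 1 := by omega
      have e2 : τ - (i + 1) = τ - 1 - i := by omega
      simp only [e2]
      rw [e1]
      exact this)
  simpa using this

/-- The decisions of the nodes added up to time `t` are `truth`. -/
def DecisionInv (c : V → CoverState) (a : V → ℕ → ℕ × ℕ) (truth : ℕ → Bool) (t : ℕ)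
    (c' : V → CoverState) : Prop :=
  ∃ d, c' = withAux c a d ∧ ∀ v x, BornBy (c v) x t → d v x = truth x

/-- A parent is in the tree by time `t` and already knows the decision. One bit suffices, since the
label that the parent sent at time `t` is the one under which the child was added. -/
theorem triple_spread (h : TreeInv N τ c) {m : ℕ} (hm : 1 < m) {truth : ℕ → Bool}
    (a : V → ℕ → ℕ × ℕ) (t : ℕ) :
    N.Triple (pairMsgs m : Set (ℕ × ℕ)) (DecisionInv c a truth t) [spread t]
      (DecisionInv c a truth (t + 1)) := by
  refine Network.Triple.single ?_ ?_
  · rintro _ ⟨d, rfl, hd⟩ v q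
    simp only [spread, pairMsgs, Finset.coe_product, Set.mem_prod, Finset.mem_coe,
      Finset.mem_range]
    exact ⟨by split_ifs <;> omega, by omega⟩
  · rintro _ ⟨d, rfl, hd⟩
    refine ⟨fun v => (N.runInstr (spread t) (withAux c a d) v).dec, rfl, fun v x hb => ?_⟩
    obtain ⟨b, q, h1, h2⟩ := hb
    simp only [Network.runInstr, spread, withAux, h1]
    rcases q with _ | p
    · have := (h.root_time h1).2
      exact hd v x ⟨b, none, h1, by omega⟩
    · change (if b = t + 1 then _ else _) = _
      split_ifs with hbt
      · subst hbt
        obtain ⟨hp, t', b', q', h3, -, h4, h5, h6, h7⟩ := h.parent v x _ p h1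
        obtain rfl : t = t' := by omega
        have h8 := hd _ x ⟨b', q', h6, h7⟩
        simp only [Network.inbox, dif_pos hp, h5, Option.any_some, h8]
        cases truth x <;> simp
      · exact hd v x ⟨b, some p, h1, by omega⟩

end Count

theorem Network.Triple.of_eq {V σ μ : Type} {N : Network V} {M : Set μ} {Q R : (V → σ) → Prop}
    {l : List (Instr σ μ)} (h : ∀ c, Q c → N.Triple M (· = c) l R) : N.Triple M Q l R :=
  fun c hc => h c hc c rfl

/-! ### One growing step on the network -/

/-- The result of one step of cluster growing from the configuration `c₀` at time `τ`. -/
structure GrowPost {V : Type} [Fintype V] (N : Network V) (D h : ℕ) (src : ℕ → Bool) (τ : ℕ)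
    (c₀ c : V → CoverState) : Prop where
  tree : TreeInv N (τ + h) c
  uncovered_eq : ∀ v, (c v).uncovered = (c₀ v).uncovered
  mono : ∀ v x, (c₀ v).tree x ≠ none → (c v).tree x ≠ none
  card_le : ∀ v, {x | (c v).tree x ≠ none}.encard ≤ {x | (c₀ v).tree x ≠ none}.encard + 1
  step : ∃ w acc, GrowStep (Near N.graph h) D src (fun v => (c₀ v).label) (fun v => (c v).label)
    w acc
  cover : ∀ i ≤ h, ∀ u v x, (c₀ u).label = some x → src x = true → Near N.graph i u v →
    ∃ u' y, (c₀ u').label = some y ∧ Near N.graph i u' v ∧ (c v).tree y ≠ none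

section Grow

variable {V : Type} {N : Network V} {m D h : ℕ} {src : ℕ → Bool} {τ : ℕ}
  {c₀ : V → CoverState}

theorem triple_wave (hm : ∀ v, N.id v + 1 < m) (h0 : TreeInv N τ c₀) (hpos : 0 < m) :
    N.Triple (pairMsgs m : Set (ℕ × ℕ)) (· = c₀)
      ([Instr.localStep (startWave src)] ++ ((List.range h).flatMap fun j => [hop (τ + j)]))
      (WaveInv N src c₀ τ h) := by
  refine Network.Triple.append (Q := WaveInv N src c₀ τ 0) ?_ ?_
  · refine Network.Triple.localStep (zero_mem_pairMsgs hpos) ?_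
    rintro _ rfl
    exact waveInv_zero h0
  · refine Network.Triple.range h fun j _ => Network.Triple.single ?_ fun c hc => hc.hop
    intro c hc v p
    simp only [hop, pairMsgs, Finset.coe_product, Set.mem_prod, Finset.mem_coe, Finset.mem_range]
    refine ⟨?_, hpos⟩
    rcases hw : (c v).wave with _ | x
    · exact hpos
    · obtain ⟨r, rfl⟩ := hc.tree.exists_root (hc.wave_mem v x hw)
      exact hm r

/-- The numbers of proposals and of members. -/
noncomputable def tally [Fintype V] (src : ℕ → Bool) (c : V → CoverState) (x : ℕ) : ℕ × ℕ :=
  ((proposers src (fun v => (c v).label) (fun v => (c v).wave) x).card,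
    (members (fun v => (c v).label) x).card)

/-- Proposers to `x` and members of `x` all lie in the tree of `x`, so restricting the sum to the
tree loses nothing. -/
theorem WaveInv.countInv [Fintype V] {c₁ : V → CoverState} (h1 : WaveInv N src c₀ τ h c₁) :
    CountInv c₁ (fun v => (c₁ v).dec) (tally src c₁) (τ + h)
      (fun v => (c₁ v).startCount src) := by
  classical
  refine ⟨fun v => ((c₁ v).startCount src).acc, rfl, fun x => ?_⟩
  have h2 : ∀ v, (if BornBy (c₁ v) x (τ + h) then ((c₁ v).startCount src).acc x else 0) =
      ((c₁ v).startCount src).acc x := by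
    intro v
    split_ifs with hb
    · rfl
    · rw [h1.tree.bornBy_iff, not_not] at hb
      have e1 : (c₁ v).wave ≠ some x := fun e => h1.wave_mem v x e hb
      have e2 : (c₁ v).label ≠ some x := fun e => h1.tree.label_mem v x e hb
      simp [startCount, e1, e2]
      rfl
  rw [Finset.sum_congr rfl fun v _ => h2 v]
  simp only [startCount, tally, proposers, members, Finset.card_filter]
  ext
  · rw [Prod.fst_sum]
    refine Finset.sum_congr rfl fun v _ => ?_
    simp [Option.any_eq_true]
  · rw [Prod.snd_sum]

theorem triple_decide [Fintype V] (hm : Fintype.card V < m) {c₁ : V → CoverState}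
    (h1 : WaveInv N src c₀ τ h c₁) :
    N.Triple (pairMsgs m : Set (ℕ × ℕ)) (· = c₁)
      ([Instr.localStep (startCount src)] ++
        ((List.range (τ + h)).flatMap fun i => [collect (τ + h - 1 - i)]) ++
        [Instr.localStep (judge D)])
      (fun c => ∃ a, DecisionInv c₁ a
        (fun x => decide ((tally src c₁ x).2 ≤ D * (tally src c₁ x).1)) 0 c) := by
  have hpos : 0 < m := by omega
  have htally : ∀ x, tally src c₁ x ∈ pairMsgs m := by
    intro x
    simp only [tally, pairMsgs, Finset.mem_product, Finset.mem_range]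
    exact ⟨(Finset.card_le_univ _).trans_lt hm, (Finset.card_le_univ _).trans_lt hm⟩
  refine Network.Triple.append (Network.Triple.append ?_
    (triple_collect_all h1.tree htally fun v => (c₁ v).dec)) ?_
  · refine Network.Triple.localStep (zero_mem_pairMsgs hpos) ?_
    rintro _ rfl
    exact h1.countInv
  · refine Network.Triple.localStep (zero_mem_pairMsgs hpos) ?_
    rintro _ ⟨a, rfl, ha⟩
    refine ⟨a, fun v x => decide ((a v x).2 ≤ D * (a v x).1), rfl, fun v x hb => ?_⟩
    -- Time `0` leaves only the root, the node with identifier `x`; its counter is the whole tally.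
    rw [h1.tree.bornBy_zero_iff] at hb
    subst hb
    have h2 := ha (N.id v)
    simp only [h1.tree.bornBy_zero_iff] at h2
    rw [Finset.sum_eq_single v (fun u _ hu => if_neg fun e => hu (N.id_injective e).symm)
      (fun hv => absurd (Finset.mem_univ v) hv), if_pos rfl] at h2
    simp only [h2]

theorem triple_update [Fintype V] (hm : 1 < m) {c₁ : V → CoverState} (h1 : WaveInv N src c₀ τ h c₁)
    (a : V → ℕ → ℕ × ℕ) :
    N.Triple (pairMsgs m : Set (ℕ × ℕ)) (DecisionInv c₁ a
        (fun x => decide ((tally src c₁ x).2 ≤ D * (tally src c₁ x).1)) 0)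
      (((List.range (τ + h)).flatMap fun t => [spread t]) ++ [Instr.localStep (update src)])
      (GrowPost N D h src τ c₀) := by
  refine Network.Triple.append (Network.Triple.range _ fun t _ => triple_spread h1.tree hm a t) ?_
  refine Network.Triple.localStep (zero_mem_pairMsgs (by omega)) ?_
  rintro _ ⟨d, rfl, hd⟩
  have hlab : (fun v => (c₁ v).label) = fun v => (c₀ v).label := funext h1.label_eq
  have hdw : ∀ v y, (c₁ v).wave = some y → d v y =
      decide ((tally src c₁ y).2 ≤ D * (tally src c₁ y).1) := fun v y hw =>
    hd v y ((h1.tree.bornBy_iff v y).2 (h1.wave_mem v y hw))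
  have hstep : GrowStep (Near N.graph h) D src (fun v => (c₀ v).label)
      (fun v => ((withAux c₁ a d v).update src).label) (fun v => (c₁ v).wave)
      (fun x => decide ((tally src c₁ x).2 ≤ D * (tally src c₁ x).1)) := by
    refine ⟨fun v y hw => ?_, fun u v x hu hx huv => ?_, fun v y _ => ?_, fun v => ?_⟩
    · obtain ⟨u, ⟨h2, h3⟩, h4⟩ := h1.spec.sound v y hw
      exact ⟨u, h2, h3, h4⟩
    · obtain ⟨-, y, hy, -⟩ := h1.spec.nearest h le_rfl u v x ⟨hu, hx⟩ huv
      rw [hy]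
      simp
    · simp only [tally, hlab, decide_eq_true_eq]
    · simp only [update, withAux, ← h1.label_eq]
      rcases hw : (c₁ v).wave with _ | y
      · simp only [relabel]
      · simp only [relabel, hdw v y hw]
  refine ⟨h1.tree.congr (fun _ => rfl) (fun _ => rfl) (fun _ => rfl) (fun _ => rfl)
    (fun _ => rfl) ?_, h1.uncovered_eq, h1.mono, ?_, ⟨_, _, hstep⟩, ?_⟩
  · intro v x hx
    rcases hstep.cases hx with ⟨h2, -⟩ | ⟨-, h2, -⟩
    · exact h1.tree.label_mem v x (by rw [h1.label_eq]; exact h2)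
    · exact h1.wave_mem v x h2
  · intro v
    -- A node holds at most one wave label, so one wave adds it to at most one tree; the sparsity
    -- bound rests on this.
    have hone : {x | (c₁ v).wave = some x}.encard ≤ 1 := by
      rw [Set.encard_le_one_iff]
      intro x y hx hy
      change _ = _ at hx hy
      rw [hx] at hy
      simpa using hy
    calc _ ≤ ({x | (c₀ v).tree x ≠ none} ∪ {x | (c₁ v).wave = some x}).encard :=
          Set.encard_le_encard fun x hx => h1.new v x hx
      _ ≤ _ := Set.encard_union_le _ _
      _ ≤ _ := add_le_add_right hone _
  · intro i hi u v x hu hx huv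
    obtain ⟨u', y, hy, ⟨h2, -⟩, h3⟩ := h1.spec.nearest i hi u v x ⟨hu, hx⟩ huv
    exact ⟨u', y, h2, h3, h1.wave_mem v y hy⟩

theorem triple_grow [Fintype V] (hid : ∀ v, N.id v + 1 < m) (hcard : Fintype.card V < m) (hm : 1 < m)
    (h0 : TreeInv N τ c₀) :
    N.Triple (pairMsgs m : Set (ℕ × ℕ)) (· = c₀) (grow D h src τ) (GrowPost N D h src τ c₀) := by
  have e : grow D h src τ =
      ([Instr.localStep (startWave src)] ++ ((List.range h).flatMap fun j => [hop (τ + j)])) ++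
      (([Instr.localStep (startCount src)] ++
        ((List.range (τ + h)).flatMap fun i => [collect (τ + h - 1 - i)]) ++
        [Instr.localStep (judge D)]) ++
      (((List.range (τ + h)).flatMap fun t => [spread t]) ++
        [Instr.localStep (update src)])) := by
    simp only [grow, List.append_assoc]
  rw [e]
  refine (triple_wave hid h0 (by omega)).append (Network.Triple.of_eq fun c₁ h1 => ?_)
  refine (triple_decide hcard h1).append (Network.Triple.of_eq ?_)
  rintro c ⟨a, hc⟩
  exact (triple_update hm h1 a).mono (by rintro _ rfl; exact hc) fun _ => id

end Grow

/-! ### The complete cover program -/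

namespace CoverState

/-- Every node that is not covered yet becomes a cluster. -/
def startClass (s : CoverState) : CoverState :=
  { s with label := if s.uncovered then some s.id else none }

/-- The nodes that kept a label are covered. -/
def endClass (s : CoverState) : CoverState :=
  { s with uncovered := s.uncovered && s.label.isNone }

/-- The `R` growing steps for every one of the `B` bits of the labels. -/
noncomputable def growBits (B R h τ : ℕ) : List (Instr CoverState (ℕ × ℕ)) :=
  (List.range B).flatMap fun i => (List.range R).flatMap fun t =>
    grow (2 * B) h (·.testBit i) (τ + (i * R + t) * h)

/-- Build well separated clusters among the nodes that are not covered yet, and cover them. -/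
noncomputable def coverClass (B R h τ : ℕ) : List (Instr CoverState (ℕ × ℕ)) :=
  [Instr.localStep startClass] ++ growBits B R h τ ++
    -- With every label a source, nobody proposes and no label changes; the wave serves to put the
    -- neighborhoods of the clusters into their trees.
    grow (2 * B) h (fun _ => true) (τ + B * R * h) ++ [Instr.localStep endClass]

/-- Build `L` classes of clusters. -/
noncomputable def coverProgram (L B R h : ℕ) : List (Instr CoverState (ℕ × ℕ)) :=
  (List.range L).flatMap fun j => coverClass B R h (j * (B * R + 1) * h)

/-- The initial state. -/
def initial (id deg : ℕ) : CoverState where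
  id := id
  deg := deg
  uncovered := true
  label := none
  wave := none
  tree x := if x = id then some (0, none) else none
  got _ := none
  sent _ := none
  acc _ := 0
  dec _ := false

/-- The pointers stored in a state. -/
def pointers (s : CoverState) : TreePointers := fun x => (s.tree x).map Prod.snd

end CoverState

theorem length_flatMap_range_le {α : Type} {f : ℕ → List α} {n b : ℕ}
    (h : ∀ i < n, (f i).length ≤ b) : ((List.range n).flatMap f).length ≤ n * b := by
  induction n with
  | zero => simp
  | succ n ih =>
    rw [List.range_succ, List.flatMap_append, List.length_append]
    have h1 := ih fun i hi => h i (by omega)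
    have h2 := h n (by omega)
    simp only [List.flatMap_cons, List.flatMap_nil, List.append_nil]
    nlinarith

/-- With `Q` waves of `2 * k` hops all times are at most `2 * k * Q`. A growing step replays all of
them and takes `O(k * Q)` rounds, and there are `Q` such steps. -/
theorem length_coverProgram_le (L B R k : ℕ) (hk : 1 ≤ k) :
    (coverProgram L B R (2 * k)).length ≤ k * (16 * (L * (B * R + 1)) ^ 2) := by
  set Q := L * (B * R + 1) with hQ
  have hτ : ∀ j < L, ∀ s ≤ B * R, j * (B * R + 1) * (2 * k) + s * (2 * k) ≤ Q * (2 * k) := by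
    intro j hj s hs
    rw [← add_mul]
    refine Nat.mul_le_mul_right _ ?_
    calc j * (B * R + 1) + s ≤ (j + 1) * (B * R + 1) := by nlinarith
      _ ≤ Q := Nat.mul_le_mul_right _ hj
  have hgrow : ∀ src τ, τ ≤ Q * (2 * k) →
      (grow (2 * B) (2 * k) src τ).length ≤ 6 * k + 4 * (Q * k) + 4 := by
    intro src τ h
    rw [length_grow]
    nlinarith
  have hclass : ∀ j < L, (coverClass B R (2 * k) (j * (B * R + 1) * (2 * k))).length ≤
      (B * R + 1) * (6 * k + 4 * (Q * k) + 4) + 2 := by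
    intro j hj
    have h1 : (growBits B R (2 * k) (j * (B * R + 1) * (2 * k))).length ≤
        B * (R * (6 * k + 4 * (Q * k) + 4)) := by
      refine length_flatMap_range_le fun i hi => length_flatMap_range_le fun t ht => ?_
      refine hgrow _ _ (hτ j hj _ ?_)
      calc i * R + t ≤ (i + 1) * R := by nlinarith
        _ ≤ B * R := Nat.mul_le_mul_right _ hi
    have h2 := hgrow (fun _ => true) _ (hτ j hj (B * R) le_rfl)
    simp only [coverClass, List.length_append, List.length_singleton]
    nlinarith
  have h := length_flatMap_range_le hclass
  change (coverProgram L B R (2 * k)).length ≤ _ at h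
  refine h.trans ?_
  have e : L * ((B * R + 1) * (6 * k + 4 * (Q * k) + 4) + 2) =
      Q * (6 * k + 4 * (Q * k) + 4) + 2 * L := by rw [hQ]; ring
  have hL : L ≤ Q := Nat.le_mul_of_pos_right _ (by omega)
  have hQQ : Q ≤ Q ^ 2 := Nat.le_self_pow (by norm_num) Q
  rw [e]
  have h3 : Q ≤ Q * k := Nat.le_mul_of_pos_right _ hk
  have h4 : Q * k ≤ Q ^ 2 * k := Nat.mul_le_mul_right _ hQQ
  have e' : Q * (6 * k + 4 * (Q * k) + 4) = 6 * (Q * k) + 4 * (Q ^ 2 * k) + 4 * Q := by ring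
  have e'' : k * (16 * Q ^ 2) = 16 * (Q ^ 2 * k) := by ring
  omega

/-- `c` is a later configuration than `c₀`, in the same class, at time `τ` and after `q` waves. -/
structure Later {V : Type} (N : Network V) (c₀ : V → CoverState) (τ q : ℕ) (c : V → CoverState) :
    Prop where
  tree : TreeInv N τ c
  uncovered_eq : ∀ v, (c v).uncovered = (c₀ v).uncovered
  mono : ∀ v x, (c₀ v).tree x ≠ none → (c v).tree x ≠ none
  card_le : ∀ v, {x | (c v).tree x ≠ none}.encard ≤ {x | (c₀ v).tree x ≠ none}.encard + q

theorem TreeInv.pointersTo {V : Type} {N : Network V} {τ : ℕ} {c₀ : V → CoverState}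
    (h0 : TreeInv N τ c₀) :
    N.PointersTo (fun v => (c₀ v).pointers) (Set.range N.id) (fun l => l.2.choose)
      (fun l v => (((c₀ v).tree l).map Prod.fst).getD 0) where
  root_eq l := by
    have key : ∀ (r : V) (x : ℕ), N.id r = x → (c₀ r).pointers x = some none := by
      rintro r _ rfl
      simp [pointers, h0.root]
    exact key _ _ l.2.choose_spec
  label_mem v l hv := by
    have : (c₀ v).tree l ≠ none := by
      intro e
      simp [pointers, e] at hv
    exact h0.exists_root this
  eq_root v l hv := by
    simp only [pointers, Option.map_eq_some_iff] at hv
    obtain ⟨⟨b, q⟩, h1, rfl⟩ := hv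
    exact N.id_injective ((h0.eq_root v l b h1).symm.trans l.2.choose_spec.symm)
  parent v l p hv := by
    simp only [pointers, Option.map_eq_some_iff] at hv
    obtain ⟨⟨b, q⟩, h1, rfl⟩ := hv
    obtain ⟨hp, t, b', q, h2, -, -, -, h3, h4⟩ := h0.parent v l b p h1
    refine ⟨hp, by simp [pointers, h3], ?_⟩
    simp only [h3, h1, Option.map_some, Option.getD_some]
    omega

section Class

variable {V : Type} [Fintype V] {N : Network V} {m B R h τ : ℕ} {c₀ : V → CoverState}

theorem Later.grow {D q : ℕ} {src : ℕ → Bool} {c c' : V → CoverState} (h1 : Later N c₀ τ q c)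
    (h2 : GrowPost N D h src τ c c') : Later N c₀ (τ + h) (q + 1) c' where
  tree := h2.tree
  uncovered_eq v := (h2.uncovered_eq v).trans (h1.uncovered_eq v)
  mono v x hx := h2.mono v x (h1.mono v x hx)
  card_le v := by
    refine (h2.card_le v).trans ((add_le_add_left (h1.card_le v) 1).trans_eq ?_)
    push_cast
    ring

theorem triple_phase (hid : ∀ v, N.id v + 1 < m) (hcard : Fintype.card V < m) (hm : 1 < m)
    {D i q : ℕ} {c₁ : V → CoverState} (h1 : Later N c₀ τ q c₁)
    (ha : AgreeBits (Near N.graph h) i fun v => (c₁ v).label) :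
    N.Triple (pairMsgs m : Set (ℕ × ℕ)) (· = c₁)
      ((List.range R).flatMap fun t => CoverState.grow D h (·.testBit i) (τ + t * h))
      (fun c => Later N c₀ (τ + R * h) (q + R) c ∧
        GrowInv (Near N.graph h) D i (fun v => (c₁ v).label) R fun v => (c v).label) := by
  refine Network.Triple.mono (Network.Triple.range
    (Inv := fun t c => Later N c₀ (τ + t * h) (q + t) c ∧
        GrowInv (Near N.graph h) D i (fun v => (c₁ v).label) t fun v => (c v).label) R
    fun t _ => Network.Triple.of_eq fun c hc => ?_) ?_ fun _ hc => hc
  · obtain ⟨h2, h3⟩ := hc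
    refine (triple_grow hid hcard hm h2.tree).mono (fun _ => id) fun c' hc' => ?_
    obtain ⟨w, acc, hstep⟩ := hc'.step
    refine ⟨?_, h3.succ hstep⟩
    have := h2.grow hc'
    rwa [add_assoc, ← Nat.succ_mul] at this
  · rintro _ rfl
    exact ⟨by simpa using h1, growInv_zero ha⟩

theorem triple_growBits (hid : ∀ v, N.id v + 1 < m) (hcard : Fintype.card V < m) (hm : 1 < m)
    (hR : (2 * B) ^ R * Fintype.card V < (2 * B + 1) ^ R) (h0 : TreeInv N τ c₀) :
    N.Triple (pairMsgs m : Set (ℕ × ℕ)) (· = c₀) (growBits B R h τ)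
      (fun c => Later N c₀ (τ + B * R * h) (B * R) c ∧
        PhaseInv (Near N.graph h) (2 * B) (fun v => (c₀ v).label) B fun v => (c v).label) := by
  refine Network.Triple.mono (Network.Triple.range
    (Inv := fun i c => Later N c₀ (τ + i * R * h) (i * R) c ∧
        PhaseInv (Near N.graph h) (2 * B) (fun v => (c₀ v).label) i fun v => (c v).label) B
    fun i _ => Network.Triple.of_eq fun c hc => ?_) ?_ fun _ hc => hc
  · obtain ⟨h2, h3⟩ := hc
    have h4 := triple_phase (R := R) (D := 2 * B) hid hcard hm h2 h3.agree
    have e : ∀ t, τ + (i * R + t) * h = τ + i * R * h + t * h := fun t => by ring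
    simp only [e]
    refine h4.mono (fun _ => id) fun c' hc' => ⟨?_, h3.succ (fun _ _ => Near.symm) hc'.2 hR⟩
    have := hc'.1
    rwa [show τ + i * R * h + R * h = τ + (i + 1) * R * h by ring,
      show i * R + R = (i + 1) * R by ring] at this
  · rintro _ rfl
    refine ⟨⟨by simpa using h0, fun _ => rfl, fun _ _ => id, fun v => by simp⟩, phaseInv_zero _⟩

/-- The nodes that are not covered yet. -/
noncomputable def uncoveredNodes (c : V → CoverState) : Finset V :=
  Finset.univ.filter fun v => (c v).uncovered = true

/-- The invariant of the cover algorithm after `j` classes with `q` waves of `h` hops each. -/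
structure CoverInv (N : Network V) (k q h j : ℕ) (c : V → CoverState) : Prop where
  tree : TreeInv N (j * q * h) c
  card_le : ∀ v, {x | (c v).tree x ≠ none}.encard ≤ ((1 + j * q : ℕ) : ℕ∞)
  uncovered_le : 2 ^ j * (uncoveredNodes c).card ≤ Fintype.card V
  covered : ∀ v, (c v).uncovered = false →
    ∃ y, ∀ u, Near N.graph k v u → (c u).tree y ≠ none

theorem coverInv_zero (k q : ℕ) :
    CoverInv N k q h 0 fun v => CoverState.initial (N.id v) (N.deg v) where
  tree := {
    id_eq := fun _ => rfl
    deg_eq := fun _ => rfl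
    root := fun v => by simp [CoverState.initial]
    eq_root := fun v x b hb => by
      simp only [CoverState.initial] at hb
      split_ifs at hb with hx
      exact hx
    parent := fun v x b p hb => by
      simp only [CoverState.initial] at hb
      split_ifs at hb with hx
      simp at hb
    label_mem := fun v x hx => by simp [CoverState.initial] at hx }
  card_le v := by
    simp only [CoverState.initial]
    refine (Set.encard_le_encard (t := {N.id v}) fun x hx => ?_).trans (by simp)
    by_contra hne
    exact hx (if_neg hne)
  uncovered_le := by
    simpa using Finset.card_le_univ _
  covered v hv := by simp [CoverState.initial] at hv

theorem triple_coverClass {k j : ℕ} (hid : ∀ v, N.id v + 1 < m) (hcard : Fintype.card V < m)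
    (hm : 1 < m) (hR : (2 * B) ^ R * Fintype.card V < (2 * B + 1) ^ R) (hB : 0 < B)
    (hidB : ∀ v, N.id v < 2 ^ B) :
    N.Triple (pairMsgs m : Set (ℕ × ℕ)) (CoverInv N k (B * R + 1) (2 * k) j)
      (coverClass B R (2 * k) (j * (B * R + 1) * (2 * k)))
      (CoverInv N k (B * R + 1) (2 * k) (j + 1)) := by
  classical
  refine Network.Triple.of_eq fun c₀ h0 => ?_
  have hzero := zero_mem_pairMsgs (m := m) (by omega)
  have hs : TreeInv N (j * (B * R + 1) * (2 * k)) fun v => (c₀ v).startClass := by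
    refine h0.tree.congr (fun _ => rfl) (fun _ => rfl) (fun _ => rfl) (fun _ => rfl)
      (fun _ => rfl) fun v x hx => ?_
    simp only [startClass] at hx
    split_ifs at hx
    simp only [Option.some.injEq] at hx
    rw [← hx, h0.tree.id_eq, h0.tree.root]
    simp
  have hlabel : ∀ v x, (c₀ v).startClass.label = some x → x < 2 ^ B := by
    intro v x hx
    obtain ⟨r, rfl⟩ := hs.exists_root (hs.label_mem v x hx)
    exact hidB r
  have hlabelled : labelled (fun v => (c₀ v).startClass.label) = uncoveredNodes c₀ := by
    ext v
    simp [labelled, uncoveredNodes, startClass]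
  unfold coverClass
  rw [List.append_assoc, List.append_assoc]
  refine Network.Triple.append (Q := (· = fun v => (c₀ v).startClass))
    (Network.Triple.localStep hzero ?_) ((triple_growBits hid hcard hm hR hs).append
      (Network.Triple.of_eq fun c₁ h1 => (triple_grow hid hcard hm h1.1.tree).append
        (Network.Triple.localStep hzero fun c h2 => ?_)))
  · rintro _ rfl
    rfl
  obtain ⟨hl₁, hp⟩ := h1
  have hl := hl₁.grow h2
  obtain ⟨w, acc, hstep⟩ := h2.step
  have heq : ∀ v, (c v).label = (c₁ v).label := congrFun (hstep.eq_of_forall_src fun _ => rfl)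
  have hhalf := hp.half_le hB
  rw [hlabelled] at hhalf
  have hsub : labelled (fun v => (c₁ v).label) ⊆ uncoveredNodes c₀ := hlabelled ▸ hp.subset
  refine ⟨?_, fun v => ?_, ?_, fun v hv => ?_⟩
  · have ht := hl.tree
    rw [show j * (B * R + 1) * (2 * k) + B * R * (2 * k) + 2 * k =
      (j + 1) * (B * R + 1) * (2 * k) by ring] at ht
    exact ht.congr (fun _ => rfl) (fun _ => rfl) (fun _ => rfl) (fun _ => rfl) (fun _ => rfl)
      ht.label_mem
  · refine (hl.card_le v).trans ((add_le_add_left (h0.card_le v) _).trans_eq ?_)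
    push_cast
    ring
  · have hset : uncoveredNodes (fun v => (c v).endClass) =
        uncoveredNodes c₀ \ labelled (fun v => (c₁ v).label) := by
      ext v
      have hu : (c v).uncovered = (c₀ v).uncovered := hl.uncovered_eq v
      simp [labelled, uncoveredNodes, endClass, hu, heq]
    have h3 := Finset.card_sdiff_add_card_eq_card hsub
    rw [← hset] at h3
    calc 2 ^ (j + 1) * (uncoveredNodes fun v => (c v).endClass).card
        = 2 ^ j * (2 * (uncoveredNodes fun v => (c v).endClass).card) := by ring
      _ ≤ 2 ^ j * (uncoveredNodes c₀).card := Nat.mul_le_mul_left _ (by omega)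
      _ ≤ _ := h0.uncovered_le
  · have hu : (c v).uncovered = (c₀ v).uncovered := hl.uncovered_eq v
    simp only [endClass, Bool.and_eq_false_iff, Option.isNone_eq_false_iff,
      Option.isSome_iff_exists] at hv
    rcases hv with hv | ⟨x, hx⟩
    · obtain ⟨y, hy⟩ := h0.covered v (hu ▸ hv)
      exact ⟨y, fun u hu => hl.mono u y (hy u hu)⟩
    · rw [heq] at hx
      refine ⟨x, fun u hvu => ?_⟩
      -- The node `u` has the label of a nearest labelled node `u'`, within distance `k` because `v`
      -- is. So `u'` is within `2 * k` of `v`, and the two labels agree.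
      obtain ⟨u', y, hu', hn, ht⟩ := h2.cover k (by omega) v u x hx rfl hvu
      have hnear : Near N.graph (2 * k) v u' := (hvu.trans hn.symm).mono (by omega)
      obtain rfl : x = y := hp.eq_of_near hlabel hx hu' hnear
      exact ht

theorem triple_coverProgram {k : ℕ} (L : ℕ) (hid : ∀ v, N.id v + 1 < m)
    (hcard : Fintype.card V < m) (hm : 1 < m)
    (hR : (2 * B) ^ R * Fintype.card V < (2 * B + 1) ^ R) (hB : 0 < B)
    (hidB : ∀ v, N.id v < 2 ^ B) :
    N.Triple (pairMsgs m : Set (ℕ × ℕ)) (CoverInv N k (B * R + 1) (2 * k) 0)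
      (coverProgram L B R (2 * k)) (CoverInv N k (B * R + 1) (2 * k) L) :=
  Network.Triple.range L fun _ _ => triple_coverClass hid hcard hm hR hB hidB

/-- The stored trees form a neighborhood cover. -/
theorem CoverInv.exists_cover {k q L s : ℕ} (hc : CoverInv N k q (2 * k) L c₀)
    (hs : 1 + L * q ≤ s) (hd : 2 * (L * q * (2 * k)) ≤ k * s)
    (hcov : ∀ v, ∃ y, ∀ u, Near N.graph k v u → (c₀ u).tree y ≠ none) :
    ∃ F : TreeFamily N.graph, Represents N (fun v => (c₀ v).pointers) F ∧
      IsNeighborhoodCover N.graph s k (k * s) F := by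
  have hp := hc.tree.pointersTo
  have hmem : ∀ (v : V) (l : ℕ), (c₀ v).pointers l ≠ none ↔ (c₀ v).tree l ≠ none := by
    intro v l
    simp [pointers]
  refine ⟨hp.family, hp.represents, fun l => ?_, fun v => ?_, fun v => ?_⟩
  · refine ((hp.isParentMap l).diameter_le (m := L * q * (2 * k)) fun v hv => ?_).trans
      (by exact_mod_cast hd)
    obtain ⟨⟨b, p⟩, hb⟩ := Option.ne_none_iff_exists'.1 ((hmem v l).1 hv)
    simpa [hb] using hc.tree.time_le hb
  · obtain ⟨y, hy⟩ := hcov v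
    have hyv := hy v (.refl v)
    refine ⟨⟨y, hc.tree.exists_root hyv⟩, fun u hu => ?_⟩
    exact (hmem u y).2 (hy u (near_iff_edist_le.2 hu))
  · have hinj : Function.Injective (Subtype.val : hp.family.labels → ℕ) := Subtype.val_injective
    rw [← hinj.encard_image]
    refine (Set.encard_le_encard ?_).trans ((hc.card_le v).trans (by exact_mod_cast hs))
    rintro _ ⟨l, hl, rfl⟩
    exact (hmem v l).1 hl

end Class

/-! ### Covers from scratch -/

/-- The number of waves of the cover algorithm for identifiers of `a log n` bits. -/
def coverWaves (a n : ℕ) : ℕ :=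
  (if n ≤ 1 then 0 else logBits n) *
    ((a * logBits n + 1) * (2 * (a * logBits n + 1) * logBits n) + 1)

/-- The sparsity of the cover. -/
def coverFactor (a n : ℕ) : ℕ := max 1 (16 * coverWaves a n ^ 2)

theorem lt_two_pow_logBits (n : ℕ) : n < 2 ^ logBits n :=
  Nat.lt_pow_succ_log_self (by norm_num) n

theorem one_le_logBits (n : ℕ) : 1 ≤ logBits n := Nat.le_add_left 1 _

/-- Up to constants depending on `a`, there are `log n` classes with `log n` bits each and `(log n)
^ 2` steps per bit, hence `(log n) ^ 4` waves. Squaring gives a polylogarithmic bound. -/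
theorem coverFactor_le_logBits (a n : ℕ) :
    coverFactor a n ≤ 144 * (a + 1) ^ 4 * logBits n ^ 8 := by
  have hL := one_le_logBits n
  set L := logBits n
  have hB : a * L + 1 ≤ (a + 1) * L := by nlinarith
  have h1 : (a * L + 1) * (2 * (a * L + 1) * L) + 1 ≤ 3 * (a + 1) ^ 2 * L ^ 3 := by
    have h2 : (a * L + 1) * (2 * (a * L + 1) * L) ≤ ((a + 1) * L) * (2 * ((a + 1) * L) * L) := by
      gcongr
    have h3 : 1 ≤ (a + 1) ^ 2 * L ^ 3 := Nat.one_le_iff_ne_zero.2 (by positivity)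
    nlinarith
  have h4 : coverWaves a n ≤ 3 * (a + 1) ^ 2 * L ^ 4 := by
    calc coverWaves a n ≤ L * (3 * (a + 1) ^ 2 * L ^ 3) := by
          refine Nat.mul_le_mul ?_ h1
          split_ifs
          · exact Nat.zero_le _
          · exact le_rfl
      _ = _ := by ring
  refine max_le (Nat.one_le_iff_ne_zero.2 (by positivity)) ?_
  calc 16 * coverWaves a n ^ 2 ≤ 16 * (3 * (a + 1) ^ 2 * L ^ 4) ^ 2 := by gcongr
    _ = _ := by ring

/-- A power of `log n` is `2 ^ O(√(log n))`. -/
theorem coverFactor_le (a n : ℕ) (hn : 1 ≤ n) :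
    (coverFactor a n : ℝ) ≤
      (2 : ℝ) ^ ((((144 * (a + 1) ^ 4 * 2 ^ 8 : ℕ) : ℝ) + 16) * √(Real.logb 2 n)) := by
  rcases eq_or_lt_of_le hn with rfl | hn
  -- For `n = 1` the claimed bound is exactly `1`; this is why `coverWaves` has no classes when `n ≤
  -- 1`.
  · simp [coverFactor, coverWaves]
  set ℓ := Real.logb 2 n with hℓ
  set A : ℕ := 144 * (a + 1) ^ 4 * 2 ^ 8 with hA
  have hn2 : (2 : ℝ) ≤ n := by exact_mod_cast hn
  have hℓ1 : 1 ≤ ℓ := by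
    rw [hℓ, Real.le_logb_iff_rpow_le (by norm_num) (by linarith)]
    simpa using hn2
  have hs1 : 1 ≤ √ℓ := Real.one_le_sqrt.2 hℓ1
  have hx : ∀ x : ℝ, 0 ≤ x → x ≤ 2 ^ x := by
    intro x hx0
    rcases le_total 1 x with h1 | h1
    · have := one_add_mul_self_le_rpow_one_add (s := 1) (by norm_num) h1
      norm_num at this
      linarith
    · exact h1.trans (Real.one_le_rpow (by norm_num) hx0)
  -- The eighth power of this bound is the source of the `16` in the exponent.
  have hℓ2 : ℓ ≤ (2 : ℝ) ^ (2 * √ℓ) := by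
    have h1 := hx (√ℓ) (by positivity)
    calc ℓ = √ℓ * √ℓ := (Real.mul_self_sqrt (by linarith)).symm
      _ ≤ 2 ^ √ℓ * 2 ^ √ℓ := by gcongr
      _ = _ := by rw [← Real.rpow_add (by norm_num)]; ring_nf
  have hL : (logBits n : ℝ) ≤ 2 * ℓ := by
    have h1 : ((Nat.log 2 n : ℕ) : ℝ) ≤ ℓ := by
      have := Real.natLog_le_logb n 2
      exact_mod_cast this
    simp only [logBits]
    push_cast
    linarith
  have h1 : (coverFactor a n : ℝ) ≤ 144 * (a + 1) ^ 4 * (logBits n : ℝ) ^ 8 := by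
    exact_mod_cast coverFactor_le_logBits a n
  have hA2 : (A : ℝ) ≤ 2 ^ ((A : ℝ) * √ℓ) := by
    refine (hx A (by positivity)).trans (Real.rpow_le_rpow_of_exponent_le (by norm_num) ?_)
    exact le_mul_of_one_le_right (by positivity) hs1
  calc (coverFactor a n : ℝ) ≤ 144 * (a + 1) ^ 4 * (2 * ℓ) ^ 8 := by
        refine h1.trans ?_
        gcongr
    _ = A * ℓ ^ 8 := by rw [hA]; push_cast; ring
    _ ≤ 2 ^ ((A : ℝ) * √ℓ) * (2 ^ (2 * √ℓ)) ^ 8 := by gcongr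
    _ = _ := by
      rw [← Real.rpow_natCast, ← Real.rpow_mul (by norm_num), ← Real.rpow_add (by norm_num)]
      congr 1
      push_cast
      ring

/-- The bound on the numbers in the messages. -/
def coverMsgBound (a n : ℕ) : ℕ := 2 ^ (a * logBits n + 1) + n + 2

theorem card_pairMsgs_le (a n : ℕ) :
    (pairMsgs (coverMsgBound a n)).card ≤ 2 ^ (2 * (a + 3) * logBits n) := by
  have hL := one_le_logBits n
  have hn := lt_two_pow_logBits n
  set L := logBits n with hLdef
  have h1 : 2 ^ (a * L + 1) ≤ 2 ^ ((a + 1) * L) := Nat.pow_le_pow_right (by norm_num) (by nlinarith)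
  have h2 : 2 ^ L ≤ 2 ^ ((a + 1) * L) := Nat.pow_le_pow_right (by norm_num) (by nlinarith)
  have h3 : 2 ^ 1 ≤ 2 ^ L := Nat.pow_le_pow_right (by norm_num) hL
  have h4 : coverMsgBound a n ≤ 2 ^ ((a + 3) * L) := by
    calc coverMsgBound a n ≤ 2 ^ ((a + 1) * L) * 2 ^ 2 := by
          simp only [coverMsgBound, ← hLdef]
          omega
      _ ≤ 2 ^ ((a + 1) * L) * 2 ^ (2 * L) :=
          Nat.mul_le_mul_left _ (Nat.pow_le_pow_right (by norm_num) (by omega))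
      _ = _ := by rw [← pow_add]; ring_nf
  calc (pairMsgs (coverMsgBound a n)).card = coverMsgBound a n * coverMsgBound a n := by
        simp [pairMsgs]
    _ ≤ 2 ^ ((a + 3) * L) * 2 ^ ((a + 3) * L) := Nat.mul_le_mul h4 h4
    _ = _ := by rw [← pow_add]; ring_nf

/-- The cover algorithm for identifiers of `a log n` bits. -/
noncomputable def coverAlgorithm (a n k : ℕ) : DistAlgorithm Unit TreePointers :=
  Instr.toAlgorithm (pairMsgs (coverMsgBound a n))
    ⟨0, zero_mem_pairMsgs (by simp [coverMsgBound])⟩ (fun id deg _ => initial id deg)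
    (coverProgram (if n ≤ 1 then 0 else logBits n) (a * logBits n + 1)
      (2 * (a * logBits n + 1) * logBits n) (2 * k)) pointers

theorem coverAlgorithm_rounds_le (a n k : ℕ) (hk : 1 ≤ k) :
    (coverAlgorithm a n k).rounds ≤ k * coverFactor a n :=
  (length_coverProgram_le _ _ _ k hk).trans (Nat.mul_le_mul_left _ (le_max_right _ _))

theorem coverAlgorithm_correct (a n k : ℕ) {V : Type} [Fintype V] (hV : Fintype.card V = n)
    (N : Network V) (hid : ∀ v, N.id v < 2 ^ (a * logBits n)) :
    ∃ F : TreeFamily N.graph, Represents N ((coverAlgorithm a n k).result N fun _ => ()) F ∧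
      IsNeighborhoodCover N.graph (coverFactor a n) k (k * coverFactor a n) F := by
  have hidB : ∀ v, N.id v < 2 ^ (a * logBits n + 1) := fun v =>
    (hid v).trans (Nat.pow_lt_pow_right (by norm_num) (by omega))
  have hpow := Nat.two_pow_pos (a * logBits n)
  -- With `D = 2 * B`, the `D * logBits n` steps per bit amount to growth by at least `2 ^ logBits
  -- n`, which exceeds `n`.
  have hR : (2 * (a * logBits n + 1)) ^ (2 * (a * logBits n + 1) * logBits n) * Fintype.card V <
      (2 * (a * logBits n + 1) + 1) ^ (2 * (a * logBits n + 1) * logBits n) := by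
    refine lt_of_lt_of_le ?_ (pow_mul_two_pow_le _ _ (by omega))
    rw [hV]
    exact Nat.mul_lt_mul_of_pos_left (lt_two_pow_logBits n) (by positivity)
  obtain ⟨hsafe, hinv⟩ := triple_coverProgram (k := k) (m := coverMsgBound a n)
    (if n ≤ 1 then 0 else logBits n)
    (fun v => by have := hidB v; simp only [coverMsgBound]; omega)
    (by rw [hV]; simp only [coverMsgBound]; omega)
    (by simp only [coverMsgBound]; omega) hR (by omega) hidB _ (coverInv_zero (N := N) k _)
  have hres : (coverAlgorithm a n k).result N (fun _ => ()) = _ :=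
    Network.toAlgorithm_result (N := N) (fun _ => ()) hsafe
  rw [hres]
  have hQ : ∀ Q : ℕ, 1 + Q ≤ max 1 (16 * Q ^ 2) ∧ 4 * Q ≤ max 1 (16 * Q ^ 2) := by
    intro Q
    rcases Nat.eq_zero_or_pos Q with rfl | hQ
    · simp
    · have : Q ≤ Q ^ 2 := Nat.le_self_pow (by norm_num) Q
      constructor <;> refine le_trans ?_ (le_max_right _ _) <;> omega
  refine hinv.exists_cover (hQ _).1 ?_ fun v => ?_
  · have := Nat.mul_le_mul_left k (hQ (coverWaves a n)).2
    refine le_trans (le_of_eq ?_) this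
    simp only [coverWaves]
    ring
  · by_cases hn : n ≤ 1
    · have : Subsingleton V := Fintype.card_le_one_iff_subsingleton.1 (hV ▸ hn)
      refine ⟨N.id v, fun u _ => ?_⟩
      rw [Subsingleton.elim u v, hinv.tree.root]
      simp
    · refine hinv.covered v ?_
      by_contra hv
      have h1 : 0 < (uncoveredNodes _).card := Finset.card_pos.2 ⟨v, Finset.mem_filter.2
        ⟨Finset.mem_univ v, by simpa using hv⟩⟩
      -- After `logBits n` halvings, even one uncovered node would be too many.
      have h2 := hinv.uncovered_le
      rw [hV, if_neg hn] at h2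
      rw [if_neg hn] at h1
      have h3 := lt_two_pow_logBits n
      nlinarith

/-! ### The trees of a weak-diameter decomposition -/

namespace RootedSubtree

variable {V : Type} {G : SimpleGraph V} (T : RootedSubtree G)

open Classical in
/-- The distance to the root in the tree. -/
noncomputable def level (v : V) : ℕ :=
  if h : v ∈ T.tree.verts then T.tree.coe.dist ⟨v, h⟩ T.root else 0

theorem level_eq (v : T.tree.verts) : T.level v = T.tree.coe.dist v T.root := by
  simp [level]

theorem level_of_isParent {v w : T.tree.verts} (h : T.IsParent v w) :
    T.level v = T.level w + 1 := by
  obtain ⟨hadj, hlt⟩ := h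
  rw [T.level_eq, T.level_eq]
  have h1 := T.isTree.connected.dist_triangle (u := v) (v := w) (w := T.root)
  rw [SimpleGraph.dist_eq_one_iff_adj.2 hadj] at h1
  omega

theorem level_eq_zero {v : T.tree.verts} : T.level v = 0 ↔ v = T.root := by
  rw [T.level_eq, T.isTree.connected.dist_eq_zero_iff]

/-- A shortest path to the root passes through each parent, and a tree has only one path between two
vertices. -/
theorem IsParent.unique {T : RootedSubtree G} {v w w' : T.tree.verts} (h : T.IsParent v w)
    (h' : T.IsParent v w') : w = w' := by
  have key : ∀ w, T.IsParent v w → ∃ p : T.tree.coe.Walk v T.root, p.IsPath ∧ p.snd = w := by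
    intro w h
    obtain ⟨q, hq⟩ := T.isTree.connected.exists_walk_length_eq_dist w T.root
    refine ⟨.cons h.1 q, SimpleGraph.Walk.isPath_of_length_eq_dist _ ?_, by simp⟩
    have := T.level_of_isParent h
    rw [T.level_eq, T.level_eq] at this
    simp [hq, this]
  obtain ⟨p, hp, rfl⟩ := key w h
  obtain ⟨p', hp', rfl⟩ := key w' h'
  have := (T.isTree.isAcyclic.subsingleton_path v T.root).elim ⟨p, hp⟩ ⟨p', hp'⟩
  simp only [Subtype.mk.injEq] at this
  rw [this]

theorem isParent_or_of_adj {u v : T.tree.verts} (h : T.tree.coe.Adj u v) :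
    T.IsParent u v ∨ T.IsParent v u := by
  have := T.isTree.dist_ne_of_adj T.root h
  rw [SimpleGraph.dist_comm, SimpleGraph.dist_comm (v := v)] at this
  rcases lt_or_gt_of_ne this with h1 | h1
  · exact .inr ⟨h.symm, h1⟩
  · exact .inl ⟨h, h1⟩

theorem level_le {r : ℕ} (h : T.depth ≤ r) (v : V) (hv : v ∈ T.tree.verts) : T.level v ≤ r := by
  have h1 : T.tree.coe.edist T.root ⟨v, hv⟩ ≤ r := (SimpleGraph.edist_le_eccent).trans h
  have h2 := (T.isTree.connected ⟨v, hv⟩ T.root).coe_dist_eq_edist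
  rw [SimpleGraph.edist_comm] at h1
  rw [T.level_eq ⟨v, hv⟩]
  rw [← h2] at h1
  exact_mod_cast h1

end RootedSubtree

namespace Represents

variable {V : Type} {N : Network V} {ptr : V → TreePointers} {F : TreeFamily N.graph}

theorem parentOf_spec (hR : Represents N ptr F) (l : F.labels) (v : (F.tree l).tree.verts)
    (hv : v ≠ (F.tree l).root) : ∃ (w : (F.tree l).tree.verts) (p : ℕ) (hp : p < N.deg v),
      (F.tree l).IsParent v w ∧ ptr v l = some (some p) ∧ (N.port v ⟨p, hp⟩ : V) = w ∧
        N.parentOf ptr l v = w := by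
  obtain ⟨w, p, h1, h2, h3⟩ := hR.parent l v hv
  exact ⟨w, p, p.2, h1, h3, h2, by rw [N.parentOf_eq h3 p.2]; exact h2⟩

theorem parentOf_root (hR : Represents N ptr F) (l : F.labels) :
    N.parentOf ptr l (F.tree l).root = (F.tree l).root := by
  simp [Network.parentOf, hR.root l]

theorem parentOf_mem (hR : Represents N ptr F) (l : F.labels) {v : V}
    (hv : v ∈ (F.tree l).tree.verts) : N.parentOf ptr l v ∈ (F.tree l).tree.verts := by
  by_cases h : (⟨v, hv⟩ : (F.tree l).tree.verts) = (F.tree l).root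
  · have h' : v = (F.tree l).root := congrArg Subtype.val h
    rw [h', hR.parentOf_root l]
    exact (F.tree l).root.2
  · obtain ⟨w, -, -, -, -, -, h1⟩ := hR.parentOf_spec l ⟨v, hv⟩ h
    rw [h1]
    exact w.2

theorem iterate_mem (hR : Represents N ptr F) (l : F.labels) {v : V}
    (hv : v ∈ (F.tree l).tree.verts) (i : ℕ) :
    (N.parentOf ptr l)^[i] v ∈ (F.tree l).tree.verts := by
  induction i generalizing v with
  | zero => exact hv
  | succ i ih => exact ih (hR.parentOf_mem l hv)

theorem level_parentOf (hR : Represents N ptr F) (l : F.labels) {v : V}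
    (hv : v ∈ (F.tree l).tree.verts) :
    (F.tree l).level (N.parentOf ptr l v) = (F.tree l).level v - 1 := by
  by_cases h : (⟨v, hv⟩ : (F.tree l).tree.verts) = (F.tree l).root
  · have h' : v = (F.tree l).root := congrArg Subtype.val h
    rw [h', hR.parentOf_root l, (F.tree l).level_eq_zero.2 rfl]
  · obtain ⟨w, -, -, h1, -, -, h2⟩ := hR.parentOf_spec l ⟨v, hv⟩ h
    have := (F.tree l).level_of_isParent h1
    simp only at this
    rw [h2, this]
    omega

theorem level_iterate (hR : Represents N ptr F) (l : F.labels) {v : V}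
    (hv : v ∈ (F.tree l).tree.verts) (i : ℕ) :
    (F.tree l).level ((N.parentOf ptr l)^[i] v) = (F.tree l).level v - i := by
  induction i generalizing v with
  | zero => rfl
  | succ i ih =>
    rw [Function.iterate_succ_apply, ih (hR.parentOf_mem l hv), hR.level_parentOf l hv]
    omega

theorem iterate_level (hR : Represents N ptr F) (l : F.labels) {v : V}
    (hv : v ∈ (F.tree l).tree.verts) :
    (N.parentOf ptr l)^[(F.tree l).level v] v = (F.tree l).root := by
  have h1 := hR.level_iterate l hv ((F.tree l).level v)
  rw [Nat.sub_self] at h1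
  exact congrArg Subtype.val
    ((F.tree l).level_eq_zero (v := ⟨_, hR.iterate_mem l hv _⟩) |>.1 h1)

theorem iterate_of_level_le (hR : Represents N ptr F) (l : F.labels) {v : V}
    (hv : v ∈ (F.tree l).tree.verts) {i : ℕ} (hi : (F.tree l).level v ≤ i) :
    (N.parentOf ptr l)^[i] v = (F.tree l).root := by
  obtain ⟨j, rfl⟩ := Nat.exists_eq_add_of_le' hi
  rw [Function.iterate_add_apply, hR.iterate_level l hv]
  exact Function.iterate_fixed (hR.parentOf_root l) j

theorem eq_parentOf_of_adj (hR : Represents N ptr F) (l : F.labels) {u v : (F.tree l).tree.verts}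
    (h : (F.tree l).tree.coe.Adj u v) :
    N.parentOf ptr l u = v ∨ N.parentOf ptr l v = u := by
  have key : ∀ u v : (F.tree l).tree.verts, (F.tree l).IsParent u v →
      N.parentOf ptr l u = v := by
    intro u v h
    have hu : u ≠ (F.tree l).root := by
      rintro rfl
      have := (F.tree l).level_of_isParent h
      rw [(F.tree l).level_eq_zero.2 rfl] at this
      omega
    obtain ⟨w, -, -, h1, -, -, h2⟩ := hR.parentOf_spec l u hu
    rw [h2, h1.unique h]
  exact ((F.tree l).isParent_or_of_adj h).imp (key u v) (key v u)

/-- The path from a vertex towards the root. -/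
theorem exists_path_up (hR : Represents N ptr F) (l : F.labels) (n : ℕ) {u : V}
    (hu : u ∈ (F.tree l).tree.verts) (hn : n ≤ (F.tree l).level u) :
    ∃ (z : (F.tree l).tree.verts) (p : (F.tree l).tree.coe.Walk ⟨u, hu⟩ z),
      (z : V) = (N.parentOf ptr l)^[n] u ∧ p.length = n ∧ p.IsPath ∧ ∀ w ∈ p.support, ∃ i ≤ n, (w : V) = (N.parentOf ptr l)^[i] u := by
  induction n generalizing u with
  | zero =>
    refine ⟨_, .nil, rfl, rfl, .nil, fun w hw => ⟨0, le_rfl, ?_⟩⟩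
    exact congrArg Subtype.val (SimpleGraph.Walk.mem_support_nil_iff.1 hw)
  | succ n ih =>
    have hr : (⟨u, hu⟩ : (F.tree l).tree.verts) ≠ (F.tree l).root := by
      intro e
      rw [← (F.tree l).level_eq_zero] at e
      simp only at e
      omega
    obtain ⟨w, -, -, h1, -, -, h2⟩ := hR.parentOf_spec l ⟨u, hu⟩ hr
    have hl := hR.level_parentOf l hu
    obtain ⟨z, p, hz, hp1, hp2, hp3⟩ := ih (hR.parentOf_mem l hu) (by omega)
    have hadj : (F.tree l).tree.coe.Adj ⟨u, hu⟩ ⟨_, hR.parentOf_mem l hu⟩ := by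
      have : w = ⟨_, hR.parentOf_mem l hu⟩ := Subtype.ext h2.symm
      rw [← this]
      exact h1.1
    refine ⟨z, .cons hadj p, hz, by simp [hp1], ?_, fun x hx => ?_⟩
    · rw [SimpleGraph.Walk.cons_isPath_iff]
      refine ⟨hp2, fun hmem => ?_⟩
      obtain ⟨i, -, hi⟩ := hp3 _ hmem
      have h3 := hR.level_iterate l (hR.parentOf_mem l hu) i
      rw [← hi] at h3
      simp only at h3
      omega
    · rw [SimpleGraph.Walk.support_cons, List.mem_cons] at hx
      rcases hx with rfl | hx
      · exact ⟨0, by omega, rfl⟩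
      · obtain ⟨i, hi, he⟩ := hp3 x hx
        exact ⟨i + 1, by omega, he⟩

theorem near_iterate (hR : Represents N ptr F) (l : F.labels) {u : V}
    (hu : u ∈ (F.tree l).tree.verts) (n : ℕ) : Near N.graph n u ((N.parentOf ptr l)^[n] u) := by
  induction n generalizing u with
  | zero => exact .refl u
  | succ n ih =>
    rw [Function.iterate_succ_apply, add_comm]
    refine Near.trans (i := 1) ?_ (ih (hR.parentOf_mem l hu))
    by_cases h : (⟨u, hu⟩ : (F.tree l).tree.verts) = (F.tree l).root
    · have h' : u = (F.tree l).root := congrArg Subtype.val h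
      rw [h', hR.parentOf_root l]
      exact .refl _
    · obtain ⟨w, p, hp, -, -, h1, h2⟩ := hR.parentOf_spec l ⟨u, hu⟩ h
      rw [h2, ← h1]
      exact .of_adj (N.port u ⟨p, hp⟩).2

end Represents

/-- The ancestors, along the pointers for the label `l`, of the vertices of the cluster `l`. -/
def Marked {V : Type} (N : Network V) (cluster : V → ℕ) (ptr : V → TreePointers) (l : ℕ) (v : V) :
    Prop :=
  ∃ u i, cluster u = l ∧ (N.parentOf ptr l)^[i] u = v

/-- The vertices at distance at most `i` from the cluster `l`. -/
def Reach {V : Type} (N : Network V) (cluster : V → ℕ) (i l : ℕ) (v : V) : Prop :=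
  ∃ u, cluster u = l ∧ Near N.graph i u v

section Decomposition

variable {V : Type} {N : Network V} {c d k : ℕ} {color cluster : V → ℕ} {F : TreeFamily N.graph}
  {ptr : V → TreePointers}

theorem Reach.mono {i j l : ℕ} {v : V} (h : Reach N cluster i l v) (hij : i ≤ j) :
    Reach N cluster j l v := by
  obtain ⟨u, hu, hn⟩ := h
  exact ⟨u, hu, hn.mono hij⟩

theorem Marked.parentOf {l : ℕ} {v : V} (h : Marked N cluster ptr l v) :
    Marked N cluster ptr l (N.parentOf ptr l v) := by
  obtain ⟨u, i, hu, rfl⟩ := h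
  exact ⟨u, i + 1, hu, Function.iterate_succ_apply' ..⟩

theorem marked_self (v : V) : Marked N cluster ptr (cluster v) v := ⟨v, 0, rfl, rfl⟩

theorem IsWeakDecomposition.label_mem
    (hW : IsWeakDecomposition N.graph c d (2 * k) color cluster F)
    (v : V) : cluster v ∈ F.labels := by
  rw [hW.labels_eq]
  exact ⟨v, rfl⟩

theorem IsWeakDecomposition.depth_le
    (hW : IsWeakDecomposition N.graph c d (2 * k) color cluster F)
    (l : F.labels) : (F.tree l).depth ≤ d :=
  SimpleGraph.eccent_le_ediam.trans (hW.diameter_le l)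

/-- Two clusters within distance `k` of a common vertex are within `2 * k` of each other, which
separation forbids for distinct clusters of one color. -/
theorem IsWeakDecomposition.eq_of_reach
    (hW : IsWeakDecomposition N.graph c d (2 * k) color cluster F)
    {x y : ℕ} {u u' v : V} (hu : cluster u = x)
    (hu' : cluster u' = y) (hc : color u = color u') (h : Reach N cluster k x v)
    (h' : Reach N cluster k y v) : x = y := by
  by_contra hne
  obtain ⟨s, hs, hn⟩ := h
  obtain ⟨s', hs', hn'⟩ := h'
  have h1 : color s = color s' := by
    rw [hW.color_eq s u (hs.trans hu.symm), hW.color_eq s' u' (hs'.trans hu'.symm), hc]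
  have h2 := hW.separated s s' h1 (by rwa [hs, hs'])
  have h3 := near_iff_edist_le.1 ((hn.trans hn'.symm).mono (show k + k ≤ 2 * k by omega))
  exact absurd h2 (not_lt.2 h3)

theorem Marked.mem (hW : IsWeakDecomposition N.graph c d (2 * k) color cluster F)
    (hR : Represents N ptr F) {l : F.labels} {v : V} (h : Marked N cluster ptr l v) :
    v ∈ (F.tree l).tree.verts := by
  obtain ⟨u, i, hu, rfl⟩ := h
  exact hR.iterate_mem l (hW.spans l u hu) i

theorem Marked.ptr_ne_none (hW : IsWeakDecomposition N.graph c d (2 * k) color cluster F)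
    (hR : Represents N ptr F) {l : F.labels} {v : V} (h : Marked N cluster ptr l v) :
    ptr v l ≠ none :=
  (hR.mem v l).2 ⟨l.2, Marked.mem hW hR h⟩

/-- The root is a fixed point of `parentOf`, so steps beyond the level of `u` can be dropped. This
is why `d` rounds of climbing mark everything. -/
theorem Marked.exists_le (hW : IsWeakDecomposition N.graph c d (2 * k) color cluster F)
    (hR : Represents N ptr F) {l : F.labels} {v : V} (h : Marked N cluster ptr l v) :
    ∃ u i, cluster u = l ∧ i ≤ d ∧ (N.parentOf ptr l)^[i] u = v := by
  obtain ⟨u, i, hu, rfl⟩ := h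
  have hmem := hW.spans l u hu
  have hl := (F.tree l).level_le (hW.depth_le l) u hmem
  by_cases hi : i ≤ (F.tree l).level u
  · exact ⟨u, i, hu, by omega, rfl⟩
  · exact ⟨u, (F.tree l).level u, hu, hl, by
      rw [hR.iterate_level l hmem, hR.iterate_of_level_le l hmem (by omega)]⟩

/-- A vertex of the tree between two vertices of the cluster is close to the cluster. -/
theorem Marked.reach (hW : IsWeakDecomposition N.graph c d (2 * k) color cluster F)
    (hR : Represents N ptr F) {l : F.labels} {v : V} (h : Marked N cluster ptr l v) :
    Reach N cluster k l v := by
  classical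
  have hv := Marked.mem hW hR h
  have hex : ∃ i u, cluster u = l ∧ (N.parentOf ptr l)^[i] u = v := by
    obtain ⟨u, i, h1, h2⟩ := h
    exact ⟨i, u, h1, h2⟩
  have hex' : ∃ s, cluster ((N.parentOf ptr l)^[s] v) = l :=
    ⟨_, by rw [hR.iterate_level l hv]; exact hW.root_mem l⟩
  -- Here `t` and `s` count the steps from the nearest cluster vertex below `v` and to the nearest
  -- one above. By minimality no other cluster vertex lies between, so `hop` gives `s + t ≤ 2 * k`
  -- and one of them is at most `k`.
  obtain ⟨t, ⟨u, hu, htv⟩, htmin⟩ : ∃ t, (∃ u, cluster u = l ∧ (N.parentOf ptr l)^[t] u = v) ∧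
      ∀ t' < t, ∀ u, cluster u = l → (N.parentOf ptr l)^[t'] u ≠ v :=
    ⟨Nat.find hex, Nat.find_spec hex, fun t' ht' u h1 h2 => Nat.find_min hex ht' ⟨u, h1, h2⟩⟩
  obtain ⟨s, hs, hsmin⟩ : ∃ s, cluster ((N.parentOf ptr l)^[s] v) = l ∧
      ∀ s' < s, cluster ((N.parentOf ptr l)^[s'] v) ≠ l :=
    ⟨Nat.find hex', Nat.find_spec hex', fun s' hs' => Nat.find_min hex' hs'⟩
  have hum := hW.spans l u hu
  have ht : t ≤ (F.tree l).level u := by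
    by_contra hlt
    refine htmin ((F.tree l).level u) (by omega) u hu ?_
    rw [hR.iterate_level l hum, ← htv, hR.iterate_of_level_le l hum (by omega)]
  have hlv : (F.tree l).level v = (F.tree l).level u - t := by
    rw [← htv, hR.level_iterate l hum]
  have hsl : s ≤ (F.tree l).level v := by
    by_contra hlt
    refine hsmin ((F.tree l).level v) (by omega) ?_
    rw [hR.iterate_level l hv]
    exact hW.root_mem l
  have hadd : ∀ i, (N.parentOf ptr l)^[i + t] u = (N.parentOf ptr l)^[i] v := by
    intro i
    rw [Function.iterate_add_apply, htv]
  obtain ⟨z, p, hz, hp1, hp2, hp3⟩ := hR.exists_path_up l (s + t) hum (by omega)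
  have hlen := hW.hop l _ z hu (by rw [hz, hadd, hs]) p hp2 (by
    intro w hw hwl
    obtain ⟨i, hi, he⟩ := hp3 w hw
    rcases Nat.eq_zero_or_pos i with rfl | hi0
    · exact .inl (Subtype.ext he)
    · right
      have hit : t ≤ i := by
        by_contra hlt
        refine htmin (t - i) (by omega) w hwl ?_
        rw [he, ← Function.iterate_add_apply, Nat.sub_add_cancel (by omega), htv]
      rcases eq_or_lt_of_le hi with rfl | hlt
      · exact Subtype.ext (he.trans hz.symm)
      · exfalso
        refine hsmin (i - t) (by omega) ?_
        rw [← hadd, Nat.sub_add_cancel hit, ← he, hwl])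
  rw [hp1] at hlen
  rcases le_total t k with h1 | h1
  · refine ⟨u, hu, Near.mono ?_ h1⟩
    rw [← htv]
    exact hR.near_iterate l hum t
  · exact ⟨_, hs, (hR.near_iterate l hv s).symm.mono (by omega)⟩

end Decomposition

/-! ### The cover obtained from a decomposition -/

/-- The pointers `out` describe the trees of the clusters, pruned to the marked vertices, together
with shortest paths to the clusters from the other vertices at distance at most `k`. -/
structure ExpandSpec {V : Type} (N : Network V) (k : ℕ) (cluster : V → ℕ)
    (ptr out : V → TreePointers) : Prop where
  marked : ∀ v x, Marked N cluster ptr x v → out v x = ptr v x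
  reach : ∀ v x, ¬ Marked N cluster ptr x v → Reach N cluster k x v →
    ∃ (p : ℕ) (hp : p < N.deg v) (i : ℕ), out v x = some (some p) ∧
      Reach N cluster i x (N.port v ⟨p, hp⟩) ∧ ¬ Reach N cluster i x v
  eq_none : ∀ v x, ¬ Reach N cluster k x v → out v x = none

/-- The distance to the cluster `x`. -/
noncomputable def reachDist {V : Type} (N : Network V) (cluster : V → ℕ) (x : ℕ) (v : V) : ℕ :=
  sInf {i | Reach N cluster i x v}

open Classical in
/-- A bound on the depth of a vertex in the cover if the trees of the decomposition have depth at
most `r`. -/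
noncomputable def expandRank {V : Type} (N : Network V) (cluster : V → ℕ) (ptr : V → TreePointers)
    (F : TreeFamily N.graph) (r : ℕ) (l : F.labels) (v : V) : ℕ :=
  if Marked N cluster ptr l v then (F.tree l).level v else r + reachDist N cluster l v

/-- Iterating `f` until `P` holds. -/
theorem exists_iterate_until {α : Type} (P : α → Prop) (f : α → α) (h : ∀ a, ∃ i, P (f^[i] a)) :
    ∃ g : α → α, (∀ a, P a → g a = a) ∧ (∀ a, P (g a)) ∧ ∀ a, ¬ P a → g a = g (f a) := by
  classical
  refine ⟨fun a => f^[Nat.find (h a)] a, fun a ha => ?_, fun a => Nat.find_spec (h a),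
    fun a ha => ?_⟩
  · have : Nat.find (h a) = 0 := (Nat.find_eq_zero _).2 ha
    simp [this]
  · have : Nat.find (h a) = Nat.find (h (f a)) + 1 := Nat.find_comp_succ (h a) (h (f a)) ha
    simp only
    rw [this, Function.iterate_succ_apply]

section Expand

variable {V : Type} {N : Network V} {c d k : ℕ} {color cluster : V → ℕ} {F : TreeFamily N.graph}
  {ptr out : V → TreePointers}

theorem reach_reachDist {i x : ℕ} {v : V} (h : Reach N cluster i x v) :
    Reach N cluster (reachDist N cluster x v) x v :=
  Nat.sInf_mem (s := {i | Reach N cluster i x v}) ⟨i, h⟩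

theorem reachDist_le {i x : ℕ} {v : V} (h : Reach N cluster i x v) :
    reachDist N cluster x v ≤ i :=
  Nat.sInf_le h

theorem lt_reachDist {i j x : ℕ} {v : V} (h : Reach N cluster j x v)
    (h' : ¬ Reach N cluster i x v) : i < reachDist N cluster x v := by
  by_contra hlt
  exact h' ((reach_reachDist h).mono (not_lt.1 hlt))

theorem ExpandSpec.ne_none_iff (hE : ExpandSpec N k cluster ptr out)
    (hW : IsWeakDecomposition N.graph c d (2 * k) color cluster F) (hR : Represents N ptr F)
    (l : F.labels) (v : V) : out v l ≠ none ↔ Reach N cluster k l v := by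
  constructor
  · intro h
    by_contra hn
    exact h (hE.eq_none v l hn)
  · intro h
    by_cases hm : Marked N cluster ptr l v
    · rw [hE.marked v l hm]
      exact Marked.ptr_ne_none hW hR hm
    · obtain ⟨p, -, -, h1, -⟩ := hE.reach v l hm h
      simp [h1]

theorem marked_root (hW : IsWeakDecomposition N.graph c d (2 * k) color cluster F) (l : F.labels) :
    Marked N cluster ptr l (F.tree l).root :=
  ⟨_, 0, hW.root_mem l, rfl⟩

/-- Pointers of marked vertices go up in the old tree, all others approach the cluster. The offset
`r` ranks unmarked vertices above all marked ones, so the rank also drops where a branch enters the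
pruned tree. -/
theorem ExpandSpec.pointersTo (hE : ExpandSpec N k cluster ptr out)
    (hW : IsWeakDecomposition N.graph c d (2 * k) color cluster F) (hR : Represents N ptr F)
    {r : ℕ} (hr : ∀ l, (F.tree l).depth ≤ r) :
    N.PointersTo out F.labels (fun l => (F.tree l).root) (expandRank N cluster ptr F r) where
  root_eq l := by
    rw [hE.marked _ _ (marked_root hW l), hR.root l]
  label_mem v l hv := by
    by_contra hl
    refine hv (hE.eq_none v l ?_)
    rintro ⟨u, rfl, -⟩
    exact hl (hW.label_mem u)
  eq_root v l hv := by
    by_cases hm : Marked N cluster ptr l v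
    · rw [hE.marked v l hm] at hv
      by_contra hne
      obtain ⟨w, p, -, -, h1, -⟩ := hR.parentOf_spec l ⟨v, Marked.mem hW hR hm⟩
        fun e => hne (congrArg Subtype.val e)
      simp only at h1
      simp [h1] at hv
    · obtain ⟨p, -, -, h1, -⟩ := hE.reach v l hm
        ((hE.ne_none_iff hW hR l v).1 (by simp [hv]))
      simp [h1] at hv
  parent v l p hv := by
    by_cases hm : Marked N cluster ptr l v
    · rw [hE.marked v l hm] at hv
      have hmem := Marked.mem hW hR hm
      have hne : (⟨v, hmem⟩ : (F.tree l).tree.verts) ≠ (F.tree l).root := by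
        intro e
        have h1 := hR.root l
        rw [← e] at h1
        simp [h1] at hv
      obtain ⟨w, p', hp, h1, h2, h3, h4⟩ := hR.parentOf_spec l ⟨v, hmem⟩ hne
      simp only [hv, Option.some.injEq] at h2
      subst h2
      have hm' : Marked N cluster ptr l (N.port v ⟨p, hp⟩) := by
        have := hm.parentOf
        rwa [h4, ← h3] at this
      refine ⟨hp, ?_, ?_⟩
      · rw [hE.marked _ _ hm']
        exact Marked.ptr_ne_none hW hR hm'
      · have h5 := (F.tree l).level_of_isParent h1
        rw [expandRank, expandRank, if_pos hm, if_pos hm']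
        simp only at h5 h3
        rw [h5, h3]
        omega
    · have hk := (hE.ne_none_iff hW hR l v).1 (by simp [hv])
      obtain ⟨p', hp, i, h1, h2, h3⟩ := hE.reach v l hm hk
      rw [hv] at h1
      obtain rfl : p = p' := by simpa using h1
      have h4 := lt_reachDist hk h3
      have h5 := reachDist_le hk
      refine ⟨hp, (hE.ne_none_iff hW hR l _).2 (h2.mono (by omega)), ?_⟩
      rw [expandRank, expandRank, if_neg hm]
      split_ifs with hm'
      · have := (F.tree l).level_le (hr l) _ (Marked.mem hW hR hm')
        omega
      · have := reachDist_le h2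
        omega

theorem ExpandSpec.expandRank_le (hE : ExpandSpec N k cluster ptr out)
    (hW : IsWeakDecomposition N.graph c d (2 * k) color cluster F) (hR : Represents N ptr F)
    {r : ℕ} (hr : ∀ l, (F.tree l).depth ≤ r) (l : F.labels) (v : V) (hv : out v l ≠ none) :
    expandRank N cluster ptr F r l v ≤ r + k := by
  unfold expandRank
  split_ifs with hm
  · have := (F.tree l).level_le (hr l) _ (Marked.mem hW hR hm)
    omega
  · have := reachDist_le ((hE.ne_none_iff hW hR l v).1 hv)
    omega

/-- Every pointer of an unmarked vertex decreases the distance to the cluster, and at distance zero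
the vertex is in the cluster and hence marked. -/
theorem ExpandSpec.exists_marked_near (hE : ExpandSpec N k cluster ptr out)
    (hW : IsWeakDecomposition N.graph c d (2 * k) color cluster F) (hR : Represents N ptr F)
    {rank : F.labels → V → ℕ}
    (hP : N.PointersTo out F.labels (fun l => (F.tree l).root) rank) (l : F.labels)
    (v : (hP.isParentMap l).subgraph.verts) :
    ∃ w : (hP.isParentMap l).subgraph.verts, Marked N cluster ptr l w ∧
      Near (hP.isParentMap l).subgraph.coe k v w := by
  suffices h : ∀ n, ∀ v : (hP.isParentMap l).subgraph.verts, reachDist N cluster l v ≤ n →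
      ∃ w : (hP.isParentMap l).subgraph.verts, Marked N cluster ptr l w ∧
        Near (hP.isParentMap l).subgraph.coe n v w from
    h k v (reachDist_le ((hE.ne_none_iff hW hR l v).1 v.2))
  intro n
  induction n with
  | zero =>
    intro v hv
    obtain ⟨u, hu, hn⟩ := (reach_reachDist ((hE.ne_none_iff hW hR l v).1 v.2)).mono hv
    refine ⟨v, ⟨u, 0, hu, near_zero.1 hn⟩, .refl v⟩
  | succ n ih =>
    intro v hv
    by_cases hm : Marked N cluster ptr l v
    · exact ⟨v, hm, .refl v⟩
    · have hk := (hE.ne_none_iff hW hR l v).1 v.2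
      obtain ⟨p, hp, i, h1, h2, h3⟩ := hE.reach v l hm hk
      have h4 := lt_reachDist hk h3
      have hvr : (v : V) ≠ (F.tree l).root := by
        intro e
        have := marked_root (ptr := ptr) hW l
        rw [← e] at this
        exact hm this
      have hpar : N.parentOf out l v = N.port v ⟨p, hp⟩ := N.parentOf_eq h1 hp
      have hmem := (hP.isParentMap l).par_mem v v.2 hvr
      have hdist : reachDist N cluster l (N.parentOf out l v) ≤ n := by
        rw [hpar]
        exact (reachDist_le h2).trans (by omega)
      obtain ⟨w, hw, hn⟩ := ih ⟨_, hmem⟩ hdist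
      refine ⟨w, hw, ?_⟩
      rw [add_comm]
      exact (Near.of_adj ((hP.isParentMap l).adj_par v hvr)).trans hn

/-- Contracting the vertices that are not marked to their nearest marked ancestors does not
increase the distances. -/
theorem ExpandSpec.near_of_marked (hE : ExpandSpec N k cluster ptr out)
    (hW : IsWeakDecomposition N.graph c d (2 * k) color cluster F) (hR : Represents N ptr F)
    {rank : F.labels → V → ℕ}
    (hP : N.PointersTo out F.labels (fun l => (F.tree l).root) rank) (l : F.labels)
    (v w : (hP.isParentMap l).subgraph.verts) (hv : Marked N cluster ptr l v)
    (hw : Marked N cluster ptr l w) : Near (hP.isParentMap l).subgraph.coe d v w := by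
  let f : (F.tree l).tree.verts → (F.tree l).tree.verts :=
    fun a => ⟨N.parentOf ptr l a, hR.parentOf_mem l a.2⟩
  have hf : ∀ i (a : (F.tree l).tree.verts), ((f^[i] a : _) : V) = (N.parentOf ptr l)^[i] a := by
    intro i
    induction i with
    | zero => intro a; rfl
    | succ i ih => intro a; exact ih (f a)
  -- The first marked ancestor, which exists because the root is marked. An edge of the old tree is
  -- either collapsed by `g` or sent to an edge of the new one.
  obtain ⟨g, hg1, hg2, hg3⟩ := exists_iterate_until
    (fun a : (F.tree l).tree.verts => Marked N cluster ptr l a) f fun a =>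
      ⟨(F.tree l).level a, by rw [hf, hR.iterate_level l a.2]; exact marked_root hW l⟩
  have hout : ∀ a, out (g a) l ≠ none := fun a =>
    (hE.ne_none_iff hW hR l _).2 (Marked.reach hW hR (hg2 a))
  let g' : (F.tree l).tree.verts → (hP.isParentMap l).subgraph.verts := fun a => ⟨g a, hout a⟩
  have hstep : ∀ a, Near (hP.isParentMap l).subgraph.coe 1 (g' a) (g' (f a)) := by
    intro a
    by_cases hm : Marked N cluster ptr l a
    · by_cases hr : (a : V) = (F.tree l).root
      · have hfa : f a = a := Subtype.ext (by
          change N.parentOf ptr l a = a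
          rw [hr, hR.parentOf_root l])
        rw [hfa]
        exact .refl _
      · have hga : g a = a := hg1 a hm
        have hgf : g (f a) = f a := hg1 (f a) hm.parentOf
        refine .of_adj (Or.inl ⟨hout a, ?_, ?_⟩)
        · change (g a : V) ≠ _
          rwa [hga]
        · change N.parentOf out l (g a) = g (f a)
          rw [hga, hgf]
          simp only [Network.parentOf, hE.marked _ _ hm, f]
    · have : g' a = g' (f a) := Subtype.ext (by
        change (g a : V) = g (f a)
        rw [hg3 a hm])
      rw [this]
      exact .refl _
  have hwalk : ∀ (a b : (F.tree l).tree.verts) (p : (F.tree l).tree.coe.Walk a b),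
      Near (hP.isParentMap l).subgraph.coe p.length (g' a) (g' b) := by
    intro a b p
    induction p with
    | nil => exact .refl _
    | @cons a b e hab q ih =>
      rw [SimpleGraph.Walk.length_cons, add_comm]
      refine Near.trans ?_ ih
      rcases hR.eq_parentOf_of_adj l hab with h1 | h1
      · have : f a = b := Subtype.ext h1
        exact this ▸ hstep a
      · have : f b = a := Subtype.ext h1
        exact this ▸ (hstep b).symm
  have hd : (F.tree l).tree.coe.edist ⟨v, Marked.mem hW hR hv⟩ ⟨w, Marked.mem hW hR hw⟩ ≤ d :=
    SimpleGraph.edist_le_ediam.trans (hW.diameter_le l)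
  obtain ⟨p, hp⟩ := near_iff_edist_le.2 hd
  have h1 := (hwalk _ _ p).mono hp
  have e1 : g' ⟨v, Marked.mem hW hR hv⟩ = v :=
    Subtype.ext (by
      change (g ⟨v, _⟩ : V) = v
      rw [hg1 ⟨v, Marked.mem hW hR hv⟩ hv])
  have e2 : g' ⟨w, Marked.mem hW hR hw⟩ = w :=
    Subtype.ext (by
      change (g ⟨w, _⟩ : V) = w
      rw [hg1 ⟨w, Marked.mem hW hR hw⟩ hw])
  rwa [e1, e2] at h1

theorem ExpandSpec.exists_cover [Finite V] (hE : ExpandSpec N k cluster ptr out)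
    (hW : IsWeakDecomposition N.graph c d (2 * k) color cluster F) (hR : Represents N ptr F) :
    ∃ F' : TreeFamily N.graph, Represents N out F' ∧
      IsNeighborhoodCover N.graph c k (d + 2 * k) F' ∧
      (∀ l : F'.labels, (F'.tree l).depth ≤ ((d + k : ℕ) : ℕ∞)) ∧
      ∀ r : ℕ, (∀ l : F.labels, (F.tree l).depth ≤ r) →
        ∀ l : F'.labels, (F'.tree l).depth ≤ ((r + k : ℕ) : ℕ∞) := by
  have hP := hE.pointersTo hW hR hW.depth_le
  have hdepth : ∀ r : ℕ, (∀ l : F.labels, (F.tree l).depth ≤ r) →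
      ∀ l : F.labels, (hP.isParentMap l).toTree.depth ≤ ((r + k : ℕ) : ℕ∞) := fun r hr l =>
    (hP.isParentMap l).depth_le ((hE.pointersTo hW hR hr).isParentMap l)
      fun v hv => hE.expandRank_le hW hR hr l v hv
  refine ⟨hP.family, hP.represents, ⟨fun l => ?_, fun v => ?_, fun v => ?_⟩,
    hdepth d hW.depth_le, hdepth⟩
  · refine SimpleGraph.ediam_le_of_edist_le fun u v => ?_
    obtain ⟨u', hu', hn⟩ := hE.exists_marked_near hW hR hP l u
    obtain ⟨v', hv', hn'⟩ := hE.exists_marked_near hW hR hP l v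
    have h1 := hE.near_of_marked hW hR hP l u' v' hu' hv'
    exact near_iff_edist_le.1 (((hn.trans h1).trans hn'.symm).mono (by omega))
  · refine ⟨⟨cluster v, hW.label_mem v⟩, fun u hu => ?_⟩
    exact (hE.ne_none_iff hW hR ⟨cluster v, hW.label_mem v⟩ u).2
      ⟨v, rfl, near_iff_edist_le.2 hu⟩
  · have hlab : ∀ l : F.labels, ∃ u, cluster u = l := fun l => by
      have : ∀ x ∈ F.labels, ∃ u, cluster u = x := by
        rw [hW.labels_eq]
        exact fun _ => id
      exact this l l.2
    choose rep hrep using hlab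
    -- Only one cluster of each color is within distance `k` of `v`, so the trees at `v` inject into
    -- the `c` colors.
    have hinj : Set.InjOn (fun l : F.labels => color (rep l)) {l | out v l ≠ none} := by
      intro l hl l' hl' he
      exact Subtype.ext (hW.eq_of_reach (hrep l) (hrep l') he
        ((hE.ne_none_iff hW hR l v).1 hl) ((hE.ne_none_iff hW hR l' v).1 hl'))
    have hmaps : Set.MapsTo (fun l : F.labels => color (rep l)) {l | out v l ≠ none}
        (Finset.range c : Set ℕ) := fun l _ => by simpa using hW.color_lt (rep l)
    refine (Set.encard_le_encard_of_injOn hmaps hinj).trans ?_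
    rw [Set.encard_coe_eq_coe_finsetCard, Finset.card_range]

end Expand

/-! ### The algorithm that expands the clusters of a decomposition -/

/-- The local state. For the current color, `wave` is the label of the cluster that reached the
node, and `mark` is the label of a cluster with a vertex below the node in its tree. -/
structure ExpandState where
  input : DecompositionInput
  wave : Option ℕ
  mark : Option ℕ
  out : TreePointers

namespace ExpandState

/-- Start with the clusters of color `j`. -/
def start (j : ℕ) (s : ExpandState) : ExpandState :=
  { s with
    wave := if s.input.color = j then some s.input.cluster else none
    mark := if s.input.color = j then some s.input.cluster else none }

/-- One hop of the wave from the clusters. -/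
noncomputable def hop : Instr ExpandState ℕ where
  send s _ := labelMsg s.wave
  step s r :=
    { s with
      wave := s.wave.or ((adopt s.wave r).map Prod.snd)
      out := fun x => (((adopt s.wave r).filter fun q => q.2 == x).map fun q => some q.1).or
        (s.out x) }

/-- The message of a marked node to its parent. -/
def climbMsg (s : ExpandState) (q : ℕ) : ℕ :=
  match s.mark with
  | some x => if s.input.pointers x = some (some q) then x + 1 else 0
  | none => 0

/-- The marked nodes mark their parents. -/
noncomputable def climb : Instr ExpandState ℕ where
  send s q := s.climbMsg q
  step s r := { s with mark := s.mark.or ((adopt s.mark r).map Prod.snd) }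

/-- The marked nodes keep their parents. -/
def finish (s : ExpandState) : ExpandState :=
  { s with out := fun x => if s.mark = some x then s.input.pointers x else s.out x }

/-- The program for the clusters of color `j`. -/
noncomputable def expandColor (k d j : ℕ) : List (Instr ExpandState ℕ) :=
  [Instr.localStep (start j)] ++ ((List.range k).flatMap fun _ => [hop]) ++
    ((List.range d).flatMap fun _ => [climb]) ++ [Instr.localStep finish]

/-- The whole program. -/
noncomputable def expandProgram (k c d : ℕ) : List (Instr ExpandState ℕ) :=
  (List.range c).flatMap fun j => expandColor k d j

end ExpandState

open ExpandState in
-- A color takes `k + d + 2` rounds; `k ≥ 1` absorbs the two local steps into the constant `3`.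
theorem length_expandProgram_le (k c d : ℕ) (hk : 1 ≤ k) :
    (expandProgram k c d).length ≤ 3 * (c * (d + k)) := by
  refine (length_flatMap_range_le (b := 3 * (d + k)) fun j _ => ?_).trans (by nlinarith)
  simp only [expandColor, List.length_append, List.length_singleton, List.length_flatMap,
    List.map_const', List.length_range, List.sum_replicate, smul_eq_mul, mul_one]
  omega

/-! ### Correctness of the expansion program -/

section Program

variable {V : Type} {N : Network V} {c d k m : ℕ} {color cluster : V → ℕ} {F : TreeFamily N.graph}
  {ptr : V → TreePointers}

/-- The pointers `out` for the label `x` are final. -/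
structure ExpandAt (N : Network V) (k : ℕ) (cluster : V → ℕ) (ptr : V → TreePointers) (x : ℕ)
    (out : V → TreePointers) : Prop where
  marked : ∀ v, Marked N cluster ptr x v → out v x = ptr v x
  reach : ∀ v, ¬ Marked N cluster ptr x v → Reach N cluster k x v →
    ∃ (p : ℕ) (hp : p < N.deg v) (i : ℕ), out v x = some (some p) ∧
      Reach N cluster i x (N.port v ⟨p, hp⟩) ∧ ¬ Reach N cluster i x v
  eq_none : ∀ v, ¬ Reach N cluster k x v → out v x = none

/-- The invariant after the colors below `j`. -/
structure ExpandInv (N : Network V) (k : ℕ) (color cluster : V → ℕ) (ptr : V → TreePointers)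
    (j : ℕ) (s : V → ExpandState) : Prop where
  input_eq : ∀ v, (s v).input = ⟨color v, cluster v, ptr v⟩
  done : ∀ u, color u < j → ExpandAt N k cluster ptr (cluster u) fun v => (s v).out
  todo : ∀ x, (∀ u, cluster u = x → j ≤ color u) → ∀ v, (s v).out x = none

/-- `x` is the label of a cluster of color `j`. -/
def HasColor (color cluster : V → ℕ) (j x : ℕ) : Prop := ∃ u, cluster u = x ∧ color u = j

/-- The invariant after `i` hops for the color `j`, from the configuration `s₀`. -/
structure HopInv (N : Network V) (color cluster : V → ℕ) (j : ℕ) (s₀ : V → ExpandState) (i : ℕ)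
    (s : V → ExpandState) : Prop where
  input_eq : ∀ v, (s v).input = (s₀ v).input
  mark_eq : ∀ v, (s v).mark = if color v = j then some (cluster v) else none
  spec : WaveSpec N.graph (fun u x => cluster u = x ∧ color u = j) i fun v => (s v).wave
  other : ∀ x, ¬ HasColor color cluster j x → ∀ v, (s v).out x = (s₀ v).out x
  parent : ∀ v x, (s v).wave = some x → cluster v = x ∨
    ∃ (p : ℕ) (hp : p < N.deg v) (i' : ℕ), (s v).out x = some (some p) ∧
      Reach N cluster i' x (N.port v ⟨p, hp⟩) ∧ ¬ Reach N cluster i' x v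
  eq_none : ∀ v x, HasColor color cluster j x → (s v).wave ≠ some x → (s v).out x = none

theorem hopInv_zero {j : ℕ} {s₀ : V → ExpandState} (h : ExpandInv N k color cluster ptr j s₀)
    (hc : ∀ u v, cluster u = cluster v → color u = color v) :
    HopInv N color cluster j s₀ 0 fun v => (s₀ v).start j where
  input_eq _ := rfl
  mark_eq v := by simp [ExpandState.start, h.input_eq]
  spec := by
    refine ⟨fun v x hx => ?_, fun i hi u v x hu huv => ?_⟩
    · simp only [ExpandState.start, h.input_eq] at hx
      split_ifs at hx with hj
      exact ⟨v, ⟨by simpa using hx, hj⟩, .refl v⟩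
    · obtain rfl : i = 0 := by omega
      obtain rfl := near_zero.1 huv
      refine ⟨u, x, ?_, hu, .refl u⟩
      simp [ExpandState.start, h.input_eq, hu.1, hu.2]
  other _ _ _ := rfl
  parent v x hx := by
    simp only [ExpandState.start, h.input_eq] at hx
    split_ifs at hx with hj
    exact .inl (by simpa using hx)
  eq_none v x hx _ := by
    obtain ⟨u, rfl, rfl⟩ := hx
    exact h.todo (cluster u) (fun u' hu' => (hc u' u hu').ge) v

/-- A node that adopts a label now had none after `i` hops and is farther than `i` from all clusters
of the color, while its chosen neighbor is within `i`. The new pointer thus leads strictly closer.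
-/
theorem HopInv.hop {j i : ℕ} {s₀ s : V → ExpandState} (h : HopInv N color cluster j s₀ i s)
    (hc : ∀ u v, cluster u = cluster v → color u = color v) :
    HopInv N color cluster j s₀ (i + 1) (N.runInstr ExpandState.hop s) := by
  set a : V → Option (ℕ × ℕ) := fun v =>
    adopt (s v).wave (N.inbox (fun u _ => labelMsg (s u).wave) v) with ha
  have hadopt : ∀ v p x, a v = some (p, x) →
      (s v).wave = none ∧ ∃ hp : p < N.deg v, (s (N.port v ⟨p, hp⟩)).wave = some x :=
    fun v p x hv => adopt_eq_some (w := fun v => (s v).wave) hv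
  have hwave : ∀ v, (N.runInstr ExpandState.hop s v).wave =
      (s v).wave.or ((a v).map Prod.snd) := fun _ => rfl
  have hout : ∀ v x, (N.runInstr ExpandState.hop s v).out x =
      (((a v).filter fun q => q.2 == x).map fun q => some q.1).or ((s v).out x) := fun _ _ => rfl
  have hkeep : ∀ v x, (∀ p, a v ≠ some (p, x)) →
      (N.runInstr ExpandState.hop s v).out x = (s v).out x := by
    intro v x hx
    rw [hout]
    have : ((a v).filter fun q => q.2 == x) = none := by
      rw [Option.filter_eq_none_iff]
      rintro ⟨p, y⟩ hq hy
      simp only [beq_iff_eq] at hy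
      subst hy
      exact hx p hq
    simp [this]
  have hspec : WaveSpec N.graph (fun u x => cluster u = x ∧ color u = j) (i + 1)
      fun v => (N.runInstr ExpandState.hop s v).wave := h.spec.hop waveHop_adopt
  refine ⟨fun v => h.input_eq v, fun v => h.mark_eq v, hspec, fun x hx v => ?_, fun v x hx => ?_,
    fun v x hx hne => ?_⟩
  · rw [← h.other x hx v]
    refine hkeep v x fun p hp => hx ?_
    obtain ⟨-, _, hw⟩ := hadopt v p x hp
    obtain ⟨u, hu, -⟩ := h.spec.sound _ x hw
    exact ⟨u, hu⟩
  · rw [hwave] at hx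
    rcases hw : (s v).wave with _ | y
    · simp only [hw, Option.none_or, Option.map_eq_some_iff] at hx
      obtain ⟨⟨p, z⟩, hz, rfl⟩ := hx
      obtain ⟨-, hp, hwu⟩ := hadopt v p z hz
      obtain ⟨u, ⟨hu, hcu⟩, hn⟩ := h.spec.sound _ z hwu
      refine .inr ⟨p, hp, i, by simp [hout, hz], ⟨u, hu, hn⟩, ?_⟩
      rintro ⟨u', hu', hn'⟩
      have hcu' : color u' = j := (hc u' u (hu'.trans hu.symm)).trans hcu
      obtain ⟨_, y, hy, -⟩ := h.spec.nearest i le_rfl u' v z ⟨hu', hcu'⟩ hn'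
      simp [hw] at hy
    · obtain rfl : y = x := by simpa [hw] using hx
      have : ∀ p, a v ≠ some (p, y) := fun p hp => by
        have := (hadopt v p y hp).1
        simp [hw] at this
      rw [hkeep v y this]
      exact h.parent v y hw
  · have hw : (s v).wave ≠ some x := fun e => hne (by simp [hwave, e])
    rw [hkeep v x, h.eq_none v x hx hw]
    intro p hp
    exact hne (by simp [hwave, (hadopt v p x hp).1, hp])

/-- The invariant after `t` rounds of marking for the color `j`, from the configuration `s₀`. -/
structure ClimbInv (N : Network V) (color cluster : V → ℕ) (ptr : V → TreePointers) (j : ℕ)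
    (s₀ : V → ExpandState) (t : ℕ) (s : V → ExpandState) : Prop where
  input_eq : ∀ v, (s v).input = (s₀ v).input
  out_eq : ∀ v, (s v).out = (s₀ v).out
  sound : ∀ v x, (s v).mark = some x → HasColor color cluster j x ∧ Marked N cluster ptr x v
  complete : ∀ i ≤ t, ∀ u, color u = j →
    (s ((N.parentOf ptr (cluster u))^[i] u)).mark ≠ none

/-- Marked nodes of the same color have the same label. -/
theorem eq_of_marked (hW : IsWeakDecomposition N.graph c d (2 * k) color cluster F)
    (hR : Represents N ptr F) {j x y : ℕ} {v : V} (hx : HasColor color cluster j x)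
    (hy : HasColor color cluster j y) (h : Marked N cluster ptr x v)
    (h' : Marked N cluster ptr y v) : x = y := by
  obtain ⟨u, rfl, hu⟩ := hx
  obtain ⟨u', rfl, hu'⟩ := hy
  exact hW.eq_of_reach rfl rfl (hu.trans hu'.symm)
    (Marked.reach hW hR (l := ⟨_, hW.label_mem u⟩) h)
    (Marked.reach hW hR (l := ⟨_, hW.label_mem u'⟩) h')

/-- By `eq_of_marked`, all marks of one color that can occur at a vertex are equal. So one mark per
node suffices, and completeness may just claim that some mark is present. -/
theorem ClimbInv.climb (hW : IsWeakDecomposition N.graph c d (2 * k) color cluster F)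
    (hR : Represents N ptr F) {j t : ℕ} {s₀ s : V → ExpandState}
    (hin : ∀ v, (s₀ v).input = ⟨color v, cluster v, ptr v⟩)
    (h : ClimbInv N color cluster ptr j s₀ t s) :
    ClimbInv N color cluster ptr j s₀ (t + 1) (N.runInstr ExpandState.climb s) := by
  set r : V → ℕ → Option ℕ := fun v => N.inbox (fun u => (s u).climbMsg) v with hr
  have hmark : ∀ v, (N.runInstr ExpandState.climb s v).mark =
      (s v).mark.or ((adopt (s v).mark (r v)).map Prod.snd) := fun _ => rfl
  have hptr : ∀ v, (s v).input.pointers = ptr v := fun v => by rw [h.input_eq, hin]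
  have hkeep : ∀ v x, (s v).mark = some x → (N.runInstr ExpandState.climb s v).mark = some x :=
    fun v x hx => by simp [hmark, hx]
  refine ⟨fun v => h.input_eq v, fun v => h.out_eq v, fun v x hx => ?_, fun i hi u hu => ?_⟩
  · rcases hm : (s v).mark with _ | y
    · rw [hmark, hm, Option.none_or, Option.map_eq_some_iff] at hx
      obtain ⟨⟨p, z⟩, hz, rfl⟩ := hx
      simp only [adopt, if_true] at hz
      obtain ⟨hp, hmsg⟩ := N.inbox_eq_some (arrivingLabel_eq_some hz)
      rw [ExpandState.climbMsg.eq_def] at hmsg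
      split at hmsg
      · rename_i y hy
        split_ifs at hmsg with hq
        obtain rfl : y = z := by omega
        obtain ⟨h1, h2⟩ := h.sound _ y hy
        refine ⟨h1, ?_⟩
        rw [hptr] at hq
        have h3 := h2.parentOf
        rw [N.parentOf_eq hq (Fin.is_lt _)] at h3
        simpa using h3
      · omega
    · obtain rfl : y = x := by simpa [hkeep v y hm] using hx
      exact h.sound v y hm
  · rcases Nat.lt_or_ge t i with hti | hti
    · obtain rfl : i = t + 1 := by omega
      rw [Function.iterate_succ_apply']
      set w := (N.parentOf ptr (cluster u))^[t] u with hwdef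
      have hw : (s w).mark ≠ none := h.complete t le_rfl u hu
      obtain ⟨y, hy⟩ := Option.ne_none_iff_exists'.1 hw
      obtain ⟨h1, h2⟩ := h.sound w y hy
      have hmw : Marked N cluster ptr (cluster u) w := ⟨u, t, rfl, rfl⟩
      obtain rfl : y = cluster u := eq_of_marked hW hR h1 ⟨u, rfl, hu⟩ h2 hmw
      let l : F.labels := ⟨cluster u, hW.label_mem u⟩
      have hmem : w ∈ (F.tree l).tree.verts := Marked.mem hW hR (l := l) hmw
      by_cases hroot : (⟨w, hmem⟩ : (F.tree l).tree.verts) = (F.tree l).root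
      · have h3 : w = (F.tree l).root := congrArg Subtype.val hroot
        have h4 : N.parentOf ptr (cluster u) w = w := by
          rw [h3]
          exact hR.parentOf_root l
        rw [h4, hkeep w _ hy]
        simp
      · obtain ⟨z, q, hq, -, h3, h4, h5⟩ := hR.parentOf_spec l ⟨w, hmem⟩ hroot
        change ptr w (cluster u) = _ at h3
        change N.parentOf ptr (cluster u) w = _ at h5
        rw [h5]
        rcases hz : (s z).mark with _ | y
        · have hadj : N.graph.Adj w z := h4 ▸ (N.port w ⟨q, hq⟩).2
          obtain ⟨p, hp⟩ := N.exists_inbox_of_adj (fun u => (s u).climbMsg) hadj ⟨q, hq⟩ h4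
          have hmsg : (s w).climbMsg q = cluster u + 1 := by
            simp [ExpandState.climbMsg, hy, hptr, h3]
          simp only [hmsg] at hp
          have := arrivingLabel_ne_none hp
          rw [hmark, hz]
          simpa [adopt] using this
        · rw [hkeep z y hz]
          simp
    · obtain ⟨y, hy⟩ := Option.ne_none_iff_exists'.1 (h.complete i hti u hu)
      rw [hkeep _ y hy]
      simp

theorem HopInv.climbInv {j i : ℕ} {s₀ s : V → ExpandState} (h : HopInv N color cluster j s₀ i s) :
    ClimbInv N color cluster ptr j s 0 s where
  input_eq _ := rfl
  out_eq _ := rfl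
  sound v x hx := by
    rw [h.mark_eq] at hx
    split_ifs at hx with hj
    obtain rfl : cluster v = x := by simpa using hx
    exact ⟨⟨v, rfl, hj⟩, marked_self v⟩
  complete i hi u hu := by
    obtain rfl : i = 0 := by omega
    simp [h.mark_eq, hu]

theorem ExpandInv.succ (hW : IsWeakDecomposition N.graph c d (2 * k) color cluster F)
    (hR : Represents N ptr F) {j : ℕ} {s₀ s₁ s : V → ExpandState}
    (h0 : ExpandInv N k color cluster ptr j s₀) (h1 : HopInv N color cluster j s₀ k s₁)
    (h2 : ClimbInv N color cluster ptr j s₁ d s) :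
    ExpandInv N k color cluster ptr (j + 1) fun v => (s v).finish := by
  have hin : ∀ v, (s v).input = ⟨color v, cluster v, ptr v⟩ := fun v => by
    rw [h2.input_eq, h1.input_eq, h0.input_eq]
  have hout : ∀ v x, (s v).finish.out x = if (s v).mark = some x then ptr v x else (s₁ v).out x := by
    intro v x
    simp only [ExpandState.finish, hin, h2.out_eq]
  have hother : ∀ x, ¬ HasColor color cluster j x → ∀ v, (s v).finish.out x = (s₀ v).out x := by
    intro x hx v
    rw [hout, if_neg fun e => hx (h2.sound v x e).1, h1.other x hx]
  refine ⟨hin, fun u hu => ?_, fun x hx v => ?_⟩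
  · rcases Nat.lt_succ_iff_lt_or_eq.1 hu with hu | hu
    · have hx : ¬ HasColor color cluster j (cluster u) := by
        rintro ⟨u', h3, h4⟩
        rw [hW.color_eq u' u h3] at h4
        omega
      obtain ⟨h3, h4, h5⟩ := h0.done u hu
      refine ⟨fun v hv => ?_, fun v hv hv' => ?_, fun v hv => ?_⟩
      · rw [hother _ hx, h3 v hv]
      · rw [hother _ hx]
        exact h4 v hv hv'
      · rw [hother _ hx, h5 v hv]
    · have hcol : HasColor color cluster j (cluster u) := ⟨u, rfl, hu⟩
      refine ⟨fun v hv => ?_, fun v hv hv' => ?_, fun v hv => ?_⟩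
      · obtain ⟨u', i, h3, h4, h5⟩ :=
          Marked.exists_le hW hR (l := ⟨cluster u, hW.label_mem u⟩) hv
        simp only at h3 h5
        have h6 := h2.complete i h4 u' ((hW.color_eq u' u h3).trans hu)
        rw [h3, h5] at h6
        obtain ⟨y, hy⟩ := Option.ne_none_iff_exists'.1 h6
        obtain ⟨h7, h8⟩ := h2.sound v y hy
        obtain rfl : y = cluster u := eq_of_marked hW hR h7 hcol h8 hv
        rw [hout, if_pos hy]
      · rw [hout, if_neg fun e => hv (h2.sound v _ e).2]
        obtain ⟨u₁, hu₁, hn⟩ := hv'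
        obtain ⟨u₂, y, h3, ⟨h4, h5⟩, h6⟩ := h1.spec.nearest k le_rfl u₁ v (cluster u)
          ⟨hu₁, (hW.color_eq u₁ u hu₁).trans hu⟩ hn
        -- The wave brought the label of some nearest cluster of the color, but only one such
        -- cluster is within distance `k`. The case that `v` belongs to it is excluded below because
        -- its vertices are marked.
        obtain rfl : y = cluster u := hW.eq_of_reach h4 rfl (h5.trans hu.symm) ⟨u₂, h4, h6⟩
          ⟨u₁, hu₁, hn⟩
        rcases h1.parent v _ h3 with h7 | h7
        · exact absurd (h7 ▸ marked_self v) hv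
        · exact h7
      · rw [hout, if_neg, h1.eq_none v _ hcol]
        · intro e
          obtain ⟨u', ⟨h3, -⟩, h4⟩ := h1.spec.sound v _ e
          exact hv ⟨u', h3, h4⟩
        · intro e
          exact hv (Marked.reach hW hR (l := ⟨cluster u, hW.label_mem u⟩) (h2.sound v _ e).2)
  · have hx' : ¬ HasColor color cluster j x := by
      rintro ⟨u, h3, h4⟩
      have := hx u h3
      omega
    rw [hother x hx']
    exact h0.todo x (fun u hu => (Nat.le_succ j).trans (hx u hu)) v

theorem triple_expandColor (hW : IsWeakDecomposition N.graph c d (2 * k) color cluster F)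
    (hR : Represents N ptr F) (hm : ∀ v, cluster v + 1 < m) (hpos : 0 < m) (j : ℕ) :
    N.Triple (Finset.range m : Set ℕ) (ExpandInv N k color cluster ptr j)
      (ExpandState.expandColor k d j) (ExpandInv N k color cluster ptr (j + 1)) := by
  have hzero : (0 : ℕ) ∈ (Finset.range m : Set ℕ) := by simpa using hpos
  refine Network.Triple.of_eq fun s₀ h0 => ?_
  unfold ExpandState.expandColor
  rw [List.append_assoc]
  refine Network.Triple.append (Q := HopInv N color cluster j s₀ k) ?_
    (Network.Triple.of_eq fun s₁ h1 => ?_)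
  · refine Network.Triple.append (Q := HopInv N color cluster j s₀ 0)
      (Network.Triple.localStep hzero ?_) (Network.Triple.range k fun i _ =>
        Network.Triple.single (fun s hs v p => ?_) fun s hs => hs.hop hW.color_eq)
    · rintro _ rfl
      exact hopInv_zero h0 hW.color_eq
    · simp only [ExpandState.hop, Finset.coe_range, Set.mem_Iio]
      rcases hw : (s v).wave with _ | x
      · exact hpos
      · obtain ⟨u, ⟨rfl, -⟩, -⟩ := hs.spec.sound v x hw
        exact hm u
  · have hin : ∀ v, (s₁ v).input = ⟨color v, cluster v, ptr v⟩ := fun v => by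
      rw [h1.input_eq, h0.input_eq]
    refine Network.Triple.append (Q := ClimbInv N color cluster ptr j s₁ d) ?_
      (Network.Triple.localStep hzero fun s hs => h0.succ hW hR h1 hs)
    refine (Network.Triple.range (Inv := ClimbInv N color cluster ptr j s₁) d fun t _ =>
      Network.Triple.single (fun s hs v p => ?_) fun s hs => hs.climb hW hR hin).mono
        (by rintro _ rfl; exact h1.climbInv) fun _ => id
    simp only [ExpandState.climb, ExpandState.climbMsg, Finset.coe_range, Set.mem_Iio]
    split
    · rename_i x hx
      split_ifs
      · obtain ⟨⟨u, rfl, -⟩, -⟩ := hs.sound v x hx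
        exact hm u
      · exact hpos
    · exact hpos

theorem ExpandInv.expandSpec {s : V → ExpandState} (h : ExpandInv N k color cluster ptr c s)
    (hc : ∀ v, color v < c) : ExpandSpec N k cluster ptr fun v => (s v).out where
  marked := by
    rintro v x ⟨u, i, rfl, hi⟩
    exact (h.done u (hc u)).marked v ⟨u, i, rfl, hi⟩
  reach := by
    rintro v x hm ⟨u, rfl, hn⟩
    exact (h.done u (hc u)).reach v hm ⟨u, rfl, hn⟩
  eq_none := by
    intro v x hn
    by_cases hx : ∃ u, cluster u = x
    · obtain ⟨u, rfl⟩ := hx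
      exact (h.done u (hc u)).eq_none v hn
    · exact h.todo x (fun u hu => absurd ⟨u, hu⟩ hx) v

end Program

/-- The algorithm that turns a decomposition into a cover, for labels of `a log n` bits. -/
noncomputable def expandAlgorithm (a n k c d : ℕ) : DistAlgorithm DecompositionInput TreePointers :=
  Instr.toAlgorithm (Finset.range (2 ^ (a * logBits n) + 1)) ⟨0, by simp⟩
    (fun _ _ x => ⟨x, none, none, fun _ => none⟩) (ExpandState.expandProgram k c d)
    ExpandState.out

theorem expandAlgorithm_usesBits (a n k c d : ℕ) :
    (expandAlgorithm a n k c d).UsesBits ((a + 1) * logBits n) := by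
  refine Network.toAlgorithm_usesBits ?_
  have h1 := one_le_logBits n
  have h2 := Nat.two_pow_pos (a * logBits n)
  calc (Finset.range (2 ^ (a * logBits n) + 1)).card = 2 ^ (a * logBits n) + 1 := by simp
    _ ≤ 2 ^ (a * logBits n) * 2 ^ 1 := by omega
    _ ≤ 2 ^ (a * logBits n) * 2 ^ logBits n :=
        Nat.mul_le_mul_left _ (Nat.pow_le_pow_right (by norm_num) h1)
    _ = 2 ^ ((a + 1) * logBits n) := by rw [← pow_add]; ring_nf

theorem expandAlgorithm_spec {V : Type} (N : Network V) {a n k c d : ℕ} {color cluster : V → ℕ}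
    {F : TreeFamily N.graph} {ptr : V → TreePointers}
    (hW : IsWeakDecomposition N.graph c d (2 * k) color cluster F) (hR : Represents N ptr F)
    (hcl : ∀ v, cluster v < 2 ^ (a * logBits n)) :
    ExpandSpec N k cluster ptr
      ((expandAlgorithm a n k c d).result N fun v => ⟨color v, cluster v, ptr v⟩) := by
  obtain ⟨hsafe, hinv⟩ := Network.Triple.range (N := N)
    (M := (Finset.range (2 ^ (a * logBits n) + 1) : Set ℕ))
    (Inv := ExpandInv N k color cluster ptr) (f := ExpandState.expandColor k d) c
    (fun j _ => triple_expandColor hW hR (fun v => Nat.succ_lt_succ (hcl v)) (Nat.succ_pos _) j)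
    (fun v => ⟨⟨color v, cluster v, ptr v⟩, none, none, fun _ => none⟩)
    ⟨fun _ => rfl, fun _ h => absurd h (by omega), fun _ _ _ => rfl⟩
  have hres : (expandAlgorithm a n k c d).result N (fun v => ⟨color v, cluster v, ptr v⟩) = _ :=
    Network.toAlgorithm_result (N := N) _ hsafe
  rw [hres]
  exact hinv.expandSpec hW.color_lt

theorem mainTheorem4 :
    -- From a decomposition of `G^(2k)` to a cover. Identifiers have at most `a log n` bits,
    -- messages at most `b log n` bits.
    (∃ K : ℕ, ∀ a : ℕ, ∃ (b : ℕ)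
      (A : (n k c d : ℕ) → DistAlgorithm DecompositionInput TreePointers),
      ∀ n k c d : ℕ, 1 ≤ k →
        (A n k c d).UsesBits (b * logBits n) ∧
        (A n k c d).rounds ≤ K * (c * (d + k)) ∧
        ∀ (V : Type) [Fintype V], Fintype.card V = n →
          ∀ N : Network V, (∀ v, N.id v < 2 ^ (a * logBits n)) →
          ∀ (color cluster : V → ℕ) (F : TreeFamily N.graph) (ptr : V → TreePointers),
            IsWeakDecomposition N.graph c d (2 * k) color cluster F →
            (∀ v, cluster v < 2 ^ (a * logBits n)) →
            Represents N ptr F →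
            ∃ F' : TreeFamily N.graph,
              Represents N
                ((A n k c d).result N fun v => ⟨color v, cluster v, ptr v⟩) F' ∧
              IsNeighborhoodCover N.graph c k (d + 2 * k) F' ∧
              (∀ l : F'.labels, (F'.tree l).depth ≤ ((d + k : ℕ) : ℕ∞)) ∧
              ∀ r : ℕ, (∀ l : F.labels, (F.tree l).depth ≤ r) →
                ∀ l : F'.labels, (F'.tree l).depth ≤ ((r + k : ℕ) : ℕ∞)) ∧
    -- Covers from scratch, with `f n = 2 ^ O(√(log n))`.
    (∀ a : ℕ, ∃ (b : ℕ) (f : ℕ → ℕ) (C : ℝ)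
      (A : (n k : ℕ) → DistAlgorithm Unit TreePointers),
      (∀ n : ℕ, 1 ≤ n → (f n : ℝ) ≤ (2 : ℝ) ^ (C * √(Real.logb 2 n))) ∧
      ∀ n k : ℕ, 1 ≤ k →
        (A n k).UsesBits (b * logBits n) ∧
        (A n k).rounds ≤ k * f n ∧
        ∀ (V : Type) [Fintype V], Fintype.card V = n →
          ∀ N : Network V, (∀ v, N.id v < 2 ^ (a * logBits n)) →
            ∃ F' : TreeFamily N.graph,
              Represents N ((A n k).result N fun _ => ()) F' ∧
              IsNeighborhoodCover N.graph (f n) k (k * f n) F') := by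
  refine ⟨⟨3, fun a => ⟨a + 1, expandAlgorithm a, fun n k c d hk =>
    ⟨expandAlgorithm_usesBits a n k c d, length_expandProgram_le k c d hk, ?_⟩⟩⟩, fun a =>
    ⟨2 * (a + 3), coverFactor a, _, coverAlgorithm a, coverFactor_le a, fun n k hk =>
      ⟨Network.toAlgorithm_usesBits (card_pairMsgs_le a n), coverAlgorithm_rounds_le a n k hk, ?_⟩⟩⟩
  · intro V _ _ N _ color cluster F ptr hW hcl hR
    exact (expandAlgorithm_spec N hW hR hcl).exists_cover hW hR
  · intro V _ hV N hid
    exact coverAlgorithm_correct a n k hV N hid
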